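/- **Setting.** "Small" refers to a fixed universe of sets. Let $\mathcal V$ be a category with pullbacks and a terminal object $*$ (hence finite products) that is cartesian closed, with internal homs $[X,Y]$, and extensive: it has all small coproducts, and for every small family $(X_i)_{i\in I}$ of objects the coproduct functor $\prod_{i}\mathcal V_{/X_i}\to\mathcal V_{/\coprod_i X_i}$ is an equivalence of categories. It follows that $\mathcal V$ has small products. Let $\mathcal I$ and $\mathcal C$ be small $\mathcal V$-categories, and let $G\colon\mathcal I\to\mathcal C$ and $W\colon\mathcal I\to\mathcal V$ be $\mathcal V$-functors. **Weighted limits.** Let $\mathcal V^{\mathcal I}$ be the $\mathcal V$-category of $\mathcal V$-functors $\mathcal I\to\mathcal V$, where $\mathcal V^{\mathcal I}(F,F')$ is the end of $[F-,F'-]$, and let $\mathcal C(-,G)\colon\mathcal C^{\mathrm{op}}\to\mathcal V^{\mathcal I}$ be the $\mathcal V$-functor with $A\mapsto\mathcal C(A,G-)$, given on hom-objects by the composition of $\mathcal C$. For $L\in\mathcal C$ and a $\mathcal V$-natural transformation $\lambda\colon W\Rightarrow\mathcal C(L,G-)$, the pair $(L,\lambda)$ is a *$W$-weighted $\mathcal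 V$-limit* of $G$ if the $\mathcal V$-natural transformation $\lambda^*\colon\mathcal C(-,L)\Rightarrow\mathcal V^{\mathcal I}(W,\mathcal C(-,G))$ that corresponds to $\lambda$ under the Yoneda lemma is an isomorphism. **Internal categories.** Let $\mathrm{Cat}(\mathcal V)$ be the category of categories internal to $\mathcal V$; an internal category $\mathbb A$ has an object of objects $\mathbb A_0$, an object of arrows $\mathbb A_1$, source and target maps $s,t\colon \mathbb A_1\to\mathbb A_0$, and an identity and a composition map. - For a $\mathcal V$-category $\mathcal D$ with a small set of objects, $\mathrm{Int}\,\mathcal D$ is the internal category with $(\mathrm{Int}\,\mathcal D)_0=\coprod_{A\in \mathcal D}*$ and $(\mathrm{Int}\,\mathcal D)_1=\coprod_{A,B\in \mathcal D}\mathcal D(A,B)$ and with the structure induced by that of $\mathcal D$; this is functorial in $\mathcal V$-functors. - An *element* of $\mathbb A$ is a map $*\to\mathbb A_0$, equivalently an internal functor $*\to\mathbb A$. - For $X\in\mathcal V$, $\mathrm{cst}X$ is the internal category with $X$ as object of objects and of arrows. The internal hom $\llbracket\mathrm{cst}X,\mathbb A\rrbracket$ is given levelwise by $[X,\mathbb A_0]$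 and $[X,\mathbb A_1]$. An element $T$ of $\mathbb A$ is regarded as an element of $\llbracket\mathrm{cst}X,\mathbb A\rrbracket$ through the internal functor $!^*\colon\mathbb A\to\llbracket\mathrm{cst}X,\mathbb A\rrbracket$ of constant families. - $\llbracket\mathbb 2,\mathbb B\rrbracket$ is the internal category of arrows and commutative squares of $\mathbb B$, and $\langle0,1\rangle^*\colon\llbracket\mathbb 2,\mathbb B\rrbracket\to\mathbb B\times\mathbb B$ takes sources and targets. For an internal functor $H\colon\mathbb A\to\mathbb B$ and an element $B$ of $\mathbb B$, the comma internal category $H\downarrow B$, with its projection to $\mathbb A$, is the pullback in $\mathrm{Cat}(\mathcal V)$ of $\langle0,1\rangle^*$ along $H\times B\colon\mathbb A\cong\mathbb A\times *\to\mathbb B\times\mathbb B$. The slice of $\mathbb A$ over an element $T$ is $\mathbb A_{/T}=\mathrm{id}_{\mathbb A}\downarrow T$. The element $T$ is an *internal terminal object* of $\mathbb A$ if the projection $\mathbb A_{/T}\to\mathbb A$ is an isomorphism of internal categories. - $\mathrm{Und}\,\mathbb A$ is the $\mathcal V$-category whose objects are the elements of $\mathbb A$, where $\mathrm{Und}\,\mathbb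 A(A,B)$ is the pullback of $(s,t)\colon\mathbb A_1\to\mathbb A_0\times\mathbb A_0$ along $(A,B)\colon *\to\mathbb A_0\times\mathbb A_0$. An object $T$ of a $\mathcal V$-category $\mathcal D$ is *$\mathcal V$-terminal* if $\mathcal D(A,T)\to *$ is an isomorphism in $\mathcal V$ for every $A\in\mathcal D$. **The internal category of weighted cones.** Put $W\downarrow\mathrm{Int}\,\mathcal C(-,G):=H\downarrow W$ for the internal functor $H=\mathrm{Int}\,\mathcal C(-,G)^{\mathrm{op}}\colon\mathrm{Int}\,\mathcal C\to\mathrm{Int}\,(\mathcal V^{\mathcal I})^{\mathrm{op}}$. Here, to have small coproducts only, $\mathcal V^{\mathcal I}$ is replaced by its small full sub-$\mathcal V$-category on the objects $W$ and $\mathcal C(A,G-)$ for $A\in\mathcal C$, which contains every object that the definition involves. A pair $(L,\lambda)$ as above determines an element of $W\downarrow\mathrm{Int}\,\mathcal C(-,G)$: its image in $\mathrm{Int}\,\mathcal C$ is $L$, and its image in $\llbracket\mathbb 2,\mathrm{Int}\,(\mathcal V^{\mathcal I})^{\mathrm{op}}\rrbracket$ is $\lambda$, regarded as an arrow from $\mathcal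 C(L,G-)$ to $W$ of the opposite. **Conservative families.** A family $\mathcal G$ of objects of $\mathcal V$ is *conservative* if a map $f\colon Y\to Z$ of $\mathcal V$ is an isomorphism if and only if $f_*\colon\mathcal V(X,Y)\to\mathcal V(X,Z)$ is bijective for every $X\in\mathcal G$. **Theorem.** Let $L\in\mathcal C$, let $\lambda\colon W\Rightarrow\mathcal C(L,G-)$ be a $\mathcal V$-natural transformation, and let $\mathcal G$ be a conservative family of objects of $\mathcal V$. The following are equivalent: 1. $(L,\lambda)$ is a $W$-weighted $\mathcal V$-limit of $G$; 2. $(L,\lambda)$ is an internal terminal object in the internal category $W\downarrow\mathrm{Int}\,\mathcal C(-,G)$; 3. for every $X\in\mathcal G$, $(L,\lambda)$ is a $\mathcal V$-terminal object in the $\mathcal V$-category $\mathrm{Und}\llbracket\mathrm{cst}X,W\downarrow\mathrm{Int}\,\mathcal C(-,G)\rrbracket$. -/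

import Mathlib

open CategoryTheory Limits MonoidalCategory CartesianMonoidalCategory Opposite
open MonoidalClosed (curry uncurry)

attribute [local instance] CategoryTheory.MonoidalClosed.enrichedCategorySelf

universe w v u u₁ u₂ u₃

namespace EnrichedInternal

noncomputable section

/-! ### Generalized elements of hom-objects

Throughout, `V` is a cartesian monoidal category. A morphism `Z ⟶ (X ⟶[V] Y)` is regarded as a
generalized element of the hom-object, and composition maps are used through such elements. -/

section Elements

variable {V : Type u} [Category.{v} V] [CartesianMonoidalCategory V]

section

variable {C : Type u₁} [EnrichedCategory V C] {D : Type u₂} [EnrichedCategory V D]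

/-- The composite of two generalized elements of hom-objects. -/
def eMul {Z : V} {X Y W : C} (f : Z ⟶ (X ⟶[V] Y)) (g : Z ⟶ (Y ⟶[V] W)) : Z ⟶ (X ⟶[V] W) :=
  lift f g ≫ eComp V X Y W

/-- The identity of `X`, as a generalized element over `Z`. -/
def eOne (Z : V) (X : C) : Z ⟶ (X ⟶[V] X) := toUnit Z ≫ eId V X

theorem comp_eMul {T Z : V} {X Y W : C} (z : T ⟶ Z) (f : Z ⟶ (X ⟶[V] Y)) (g : Z ⟶ (Y ⟶[V] W)) :
    z ≫ eMul f g = eMul (z ≫ f) (z ≫ g) := by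
  simp [eMul, ← Category.assoc, comp_lift]

theorem comp_eOne {T Z : V} (X : C) (z : T ⟶ Z) : z ≫ eOne Z X = eOne T X := by
  simp [eOne, ← Category.assoc]

theorem eOne_eMul {Z : V} {X Y : C} (f : Z ⟶ (X ⟶[V] Y)) : eMul (eOne Z X) f = f := by
  have e : f ≫ (λ_ (X ⟶[V] Y)).inv ≫ eId V X ▷ (X ⟶[V] Y) = lift (toUnit Z ≫ eId V X) f := by
    ext <;> simp
  simp [eMul, eOne, ← e]

theorem eMul_eOne {Z : V} {X Y : C} (f : Z ⟶ (X ⟶[V] Y)) : eMul f (eOne Z Y) = f := by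
  have e : f ≫ (ρ_ (X ⟶[V] Y)).inv ≫ (X ⟶[V] Y) ◁ eId V Y = lift f (toUnit Z ≫ eId V Y) := by
    ext <;> simp
  simp [eMul, eOne, ← e]

theorem eMul_assoc {Z : V} {A X Y W : C} (f : Z ⟶ (A ⟶[V] X)) (g : Z ⟶ (X ⟶[V] Y))
    (h : Z ⟶ (Y ⟶[V] W)) : eMul (eMul f g) h = eMul f (eMul g h) := by
  have k := lift f (lift g h) ≫= e_assoc V A X Y W
  have e1 : lift f (lift g h) ≫ (α_ _ _ _).inv ≫ eComp V A X Y ▷ (Y ⟶[V] W) =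
      lift (lift f g ≫ eComp V A X Y) h := by
    rw [lift_lift_associator_inv_assoc, lift_whiskerRight]
  have e2 : lift f (lift g h) ≫ (A ⟶[V] X) ◁ eComp V X Y W =
      lift f (lift g h ≫ eComp V X Y W) := by
    rw [lift_whiskerLeft]
  unfold eMul
  rw [← e1, ← e2]
  simpa only [Category.assoc] using k

theorem eMul_map (F : EnrichedFunctor V C D) {Z : V} {X Y W : C} (f : Z ⟶ (X ⟶[V] Y))
    (g : Z ⟶ (Y ⟶[V] W)) : eMul f g ≫ F.map X W = eMul (f ≫ F.map X Y) (g ≫ F.map Y W) := by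
  simp [eMul]

theorem eOne_map (F : EnrichedFunctor V C D) (Z : V) (X : C) :
    eOne Z X ≫ F.map X X = eOne Z (F.obj X) := by
  simp [eOne]

theorem eMul_fst_snd (X Y W : C) :
    eMul (fst (X ⟶[V] Y) (Y ⟶[V] W)) (snd _ _) = eComp V X Y W := by
  simp [eMul]

theorem eMul_op [BraidedCategory V] {Z : V} {X Y W : Cᵒᵖ} (f : Z ⟶ (X ⟶[V] Y))
    (g : Z ⟶ (Y ⟶[V] W)) :
    eMul f g = eMul (C := C) (X := W.unop) (Y := Y.unop) (W := X.unop) g f := by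
  unfold eMul
  rw [eComp_op_eq, ← Category.assoc]
  congr 1
  exact lift_braiding_hom f g

end

/-- A `V`-category from laws stated on generalized elements. -/
@[reducible]
def enrichedOfElements {C : Type u₁} (Hom : C → C → V) (id : ∀ X, 𝟙_ V ⟶ Hom X X)
    (comp : ∀ X Y Z, Hom X Y ⊗ Hom Y Z ⟶ Hom X Z)
    (id_comp : ∀ X Y, lift (toUnit _ ≫ id X) (𝟙 (Hom X Y)) ≫ comp X X Y = 𝟙 _)
    (comp_id : ∀ X Y, lift (𝟙 (Hom X Y)) (toUnit _ ≫ id Y) ≫ comp X Y Y = 𝟙 _)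
    (assoc : ∀ (A X Y W) {Z : V} (f : Z ⟶ Hom A X) (g : Z ⟶ Hom X Y) (h : Z ⟶ Hom Y W),
      lift (lift f g ≫ comp A X Y) h ≫ comp A Y W = lift f (lift g h ≫ comp X Y W) ≫ comp A X W) :
    EnrichedCategory V C where
  Hom := Hom
  id := id
  comp := comp
  id_comp X Y := by
    rw [← id_comp X Y, ← Category.assoc]
    congr 1
    ext <;> simp
  comp_id X Y := by
    rw [← comp_id X Y, ← Category.assoc]
    congr 1
    ext <;> simp
  assoc A X Y W := by
    have h := assoc A X Y W (fst (Hom A X) (Hom X Y ⊗ Hom Y W)) (snd _ _ ≫ fst _ _)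
      (snd _ _ ≫ snd _ _)
    have e1 : lift (lift (fst (Hom A X) (Hom X Y ⊗ Hom Y W)) (snd _ _ ≫ fst _ _) ≫ comp A X Y)
        (snd _ _ ≫ snd _ _) = (α_ _ _ _).inv ≫ comp A X Y ▷ Hom Y W := by
      ext
      · simp only [lift_fst, Category.assoc, whiskerRight_fst]
        rw [← Category.assoc]
        congr 1
        ext <;> simp
      · simp
    have e2 : lift (fst (Hom A X) (Hom X Y ⊗ Hom Y W)) (lift (snd _ _ ≫ fst _ _)
        (snd _ _ ≫ snd _ _) ≫ comp X Y W) = Hom A X ◁ comp X Y W := by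
      ext
      · simp
      · simp only [lift_snd, whiskerLeft_snd]
        congr 1
        ext <;> simp
    rw [e1, e2] at h
    simpa using h

/-- A `V`-functor from laws stated on generalized elements. -/
def functorOfElements {C : Type u₁} [EnrichedCategory V C] {D : Type u₂} [EnrichedCategory V D]
    (obj : C → D) (map : ∀ X Y : C, (X ⟶[V] Y) ⟶ (obj X ⟶[V] obj Y))
    (map_id : ∀ X, eId V X ≫ map X X = eId V (obj X))
    (map_mul : ∀ (X Y W : C) {Z : V} (f : Z ⟶ (X ⟶[V] Y)) (g : Z ⟶ (Y ⟶[V] W)),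
      eMul f g ≫ map X W = eMul (f ≫ map X Y) (g ≫ map Y W)) :
    EnrichedFunctor V C D where
  obj := obj
  map := map
  map_id := map_id
  map_comp X Y W := by
    rw [← eMul_fst_snd, map_mul, eMul]
    congr 1
    ext <;> simp

/-! ### Generalized elements of internal homs -/

variable [MonoidalClosed V]

/-- Application of a generalized element of `[X, Y]` to a generalized element of `X`. -/
def ap {Z X Y : V} (x : Z ⟶ X) (f : Z ⟶ (ihom X).obj Y) : Z ⟶ Y :=
  lift x f ≫ (ihom.ev X).app Y

theorem comp_ap {T Z X Y : V} (z : T ⟶ Z) (x : Z ⟶ X) (f : Z ⟶ (ihom X).obj Y) :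
    z ≫ ap x f = ap (z ≫ x) (z ≫ f) := by
  simp only [ap, ← Category.assoc, comp_lift]

theorem ap_curry {T Z X Y : V} (x : T ⟶ X) (z : T ⟶ Z) (h : X ⊗ Z ⟶ Y) :
    ap x (z ≫ curry h) = lift x z ≫ h := by
  have : lift x (z ≫ curry h) = lift x z ≫ X ◁ curry h := by simp
  rw [ap, this, Category.assoc, ← MonoidalClosed.uncurry_eq, MonoidalClosed.uncurry_curry]

theorem ap_map {Z X Y Y' : V} (x : Z ⟶ X) (f : Z ⟶ (ihom X).obj Y) (k : Y ⟶ Y') :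
    ap x (f ≫ (ihom X).map k) = ap x f ≫ k := by
  have : lift x (f ≫ (ihom X).map k) = lift x f ≫ X ◁ (ihom X).map k := by simp
  rw [ap, this, Category.assoc, ap, Category.assoc]
  congr 1
  exact (ihom.ev X).naturality k

theorem ap_ext {Z X Y : V} {f g : Z ⟶ (ihom X).obj Y}
    (h : ∀ {T : V} (x : T ⟶ X) (z : T ⟶ Z), ap x (z ≫ f) = ap x (z ≫ g)) : f = g := by
  apply MonoidalClosed.uncurry_injective
  have := h (fst X Z) (snd X Z)
  have e (k : Z ⟶ (ihom X).obj Y) : ap (fst X Z) (snd X Z ≫ k) = uncurry k := by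
    rw [MonoidalClosed.uncurry_eq, ap]
    congr 1
    ext <;> simp
  rwa [e, e] at this

theorem ap_eMul {Z X Y W : V} (x : Z ⟶ X) (f : Z ⟶ (ihom X).obj Y) (g : Z ⟶ (ihom Y).obj W) :
    ap x (eMul (V := V) (C := V) f g) = ap (ap x f) g := by
  have e : eMul (V := V) (C := V) f g = lift f g ≫ curry (MonoidalClosed.compTranspose X Y W) := rfl
  rw [e, ap_curry, MonoidalClosed.compTranspose_eq]
  unfold ap
  simp only [← Category.assoc]
  congr 1
  ext <;> simp

theorem ap_eOne {Z X : V} (x : Z ⟶ X) : ap x (eOne (V := V) (C := V) Z X) = x := by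
  have e : eOne (V := V) (C := V) Z X = toUnit Z ≫ curry (ρ_ X).hom := rfl
  rw [e, ap_curry]
  simp

end Elements

/-! ### Extensive categories -/

set_option linter.unusedSectionVars false

section Extensive

/-- The functor `∏ i, V / X i ⥤ V / ∐ X` taking coproducts. -/
def sigmaOver {V : Type u} [Category.{v} V] [HasCoproducts.{w} V] {I : Type w} (X : I → V) :
    (∀ i, Over (X i)) ⥤ Over (∐ X) where
  obj Y := Over.mk (Limits.Sigma.map fun i => (Y i).hom)
  map f := Over.homMk (Limits.Sigma.map fun i => (f i).left) (by
    apply Limits.Sigma.hom_ext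
    intro i
    simp)
  map_id Y := by
    ext
    simp
  map_comp f g := by
    apply Over.OverMorphism.ext
    exact (Limits.Sigma.map_comp_map (fun i => (f i).left) (fun i => (g i).left)).symm

/-- A category is extensive if it has all small coproducts and taking coproducts gives
equivalences `∏ i, V / X i ≌ V / ∐ X`; "small" means indexed by a type in `Type w`. -/
class IsExtensive (V : Type u) [Category.{v} V] : Prop where
  hasCoproducts : HasCoproducts.{w} V
  isEquivalence : ∀ {I : Type w} (X : I → V), (sigmaOver X).IsEquivalence

attribute [instance] IsExtensive.hasCoproducts IsExtensive.isEquivalence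

variable {V : Type u} [Category.{v} V] [HasPullbacks V] [IsExtensive.{w} V] {I : Type w}

/-- Summands of a map of coproducts are pullbacks along the inclusions. -/
theorem sigma_isPullback {X Y : I → V} (g : ∀ i, Y i ⟶ X i) (i : I) :
    IsPullback (Limits.Sigma.ι Y i) (g i) (Limits.Sigma.map g) (Limits.Sigma.ι X i) := by
  let Y₁ : ∀ i, Over (X i) := fun i => Over.mk (g i)
  let Y₂ : ∀ i, Over (X i) := fun i =>
    Over.mk (pullback.snd (Limits.Sigma.map g) (Limits.Sigma.ι X i))
  let m (i : I) : Y i ⟶ pullback (Limits.Sigma.map g) (Limits.Sigma.ι X i) :=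
    pullback.lift (Limits.Sigma.ι Y i) (g i) (by simp)
  have m₁ (i : I) : m i ≫ pullback.fst _ _ = Limits.Sigma.ι Y i := pullback.lift_fst _ _ _
  have m₂ (i : I) : m i ≫ pullback.snd _ _ = g i := pullback.lift_snd _ _ _
  let η : Y₁ ⟶ Y₂ := fun i => Over.homMk (m i) (m₂ i)
  let d : (∐ fun i => pullback (Limits.Sigma.map g) (Limits.Sigma.ι X i)) ⟶ ∐ Y :=
    Limits.Sigma.desc fun i => pullback.fst (Limits.Sigma.map g) (Limits.Sigma.ι X i)
  have hd (i : I) : Limits.Sigma.ι _ i ≫ d = pullback.fst _ _ := Limits.Sigma.ι_desc _ _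
  have hdg : d ≫ Limits.Sigma.map g = Limits.Sigma.map fun i =>
      pullback.snd (Limits.Sigma.map g) (Limits.Sigma.ι X i) := by
    apply Limits.Sigma.hom_ext
    intro i
    rw [← Category.assoc, hd, Limits.Sigma.ι_map]
    exact pullback.condition
  let ε : (sigmaOver X).obj Y₂ ⟶ (sigmaOver X).obj Y₁ := Over.homMk d hdg
  obtain ⟨e, he⟩ := (sigmaOver X).map_surjective ε
  have h₁ : η ≫ e = 𝟙 _ := by
    apply (sigmaOver X).map_injective
    rw [Functor.map_comp, he]
    apply Over.OverMorphism.ext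
    have hm : Limits.Sigma.map m ≫ d = 𝟙 (∐ Y) := by
      apply Limits.Sigma.hom_ext
      intro i
      rw [← Category.assoc, Limits.Sigma.ι_map, Category.assoc, hd, m₁, Category.comp_id]
    rw [(sigmaOver X).map_id]
    exact hm
  let e' (i : I) : pullback (Limits.Sigma.map g) (Limits.Sigma.ι X i) ⟶ Y i := (e i).left
  have h₁' : m i ≫ e' i = 𝟙 _ := congrArg (fun k => (k i).left) h₁
  have he' : e' i ≫ Limits.Sigma.ι Y i = pullback.fst _ _ := by
    have h := congrArg (fun k => Limits.Sigma.ι _ i ≫ k.left) he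
    exact (Limits.Sigma.ι_map (fun i => (e i).left) i).symm.trans (h.trans (hd i))
  have he'' : e' i ≫ g i = pullback.snd _ _ := Over.w (e i)
  have h₂ : e' i ≫ m i = 𝟙 _ := by
    apply pullback.hom_ext
    · rw [Category.assoc, m₁, he', Category.id_comp]
    · rw [Category.assoc, m₂, he'', Category.id_comp]
  exact IsPullback.of_iso_pullback ⟨by simp⟩ ⟨m i, e' i, h₁', h₂⟩ (m₁ i) (m₂ i)

/-- A map to a coproduct presents its source as the coproduct of the fibres. -/
theorem exists_fibres {X : I → V} {Z : V} (f : Z ⟶ ∐ X) :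
    ∃ (Y : I → V) (g : ∀ i, Y i ⟶ X i) (e : ∐ Y ≅ Z), Limits.Sigma.map g = e.hom ≫ f := by
  let Y := (sigmaOver X).objPreimage (Over.mk f)
  let e := (sigmaOver X).objObjPreimageIso (Over.mk f)
  exact ⟨fun i => (Y i).left, fun i => (Y i).hom, (Over.forget _).mapIso e, (Over.w e.hom).symm⟩

/-- Maps out of an object over a coproduct are determined on the fibres. -/
theorem cover_ext {X : I → V} {Z Q : V} (f : Z ⟶ ∐ X) {a b : Z ⟶ Q}
    (h : ∀ (i : I) {T : V} (z : T ⟶ Z) (f' : T ⟶ X i), z ≫ f = f' ≫ Limits.Sigma.ι X i →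
      z ≫ a = z ≫ b) : a = b := by
  obtain ⟨Y, g, e, he⟩ := exists_fibres f
  rw [← cancel_epi e.hom]
  apply Limits.Sigma.hom_ext
  intro i
  have := h i (Limits.Sigma.ι Y i ≫ e.hom) (g i) (by simp [← he])
  simpa using this

/-- Maps out of an object over a coproduct can be defined on the fibres. -/
theorem cover_glue {X : I → V} {Z Q : V} (f : Z ⟶ ∐ X)
    (m : ∀ (i : I) {T : V} (z : T ⟶ Z) (f' : T ⟶ X i), z ≫ f = f' ≫ Limits.Sigma.ι X i → (T ⟶ Q))
    (hm : ∀ (i : I) {S T : V} (y : S ⟶ T) (z : T ⟶ Z) (f' : T ⟶ X i)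
      (h : z ≫ f = f' ≫ Limits.Sigma.ι X i),
      y ≫ m i z f' h = m i (y ≫ z) (y ≫ f') (by simp [h])) :
    ∃ c : Z ⟶ Q, ∀ (i : I) {T : V} (z : T ⟶ Z) (f' : T ⟶ X i)
      (h : z ≫ f = f' ≫ Limits.Sigma.ι X i), z ≫ c = m i z f' h := by
  obtain ⟨Y, g, e, he⟩ := exists_fibres f
  refine ⟨e.inv ≫ Limits.Sigma.desc fun i =>
    m i (Limits.Sigma.ι Y i ≫ e.hom) (g i) (by simp [← he]), ?_⟩
  intro i T z f' h
  have hp := sigma_isPullback g i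
  obtain ⟨l, hl₁, hl₂⟩ : ∃ l : T ⟶ Y i, l ≫ Limits.Sigma.ι Y i = z ≫ e.inv ∧ l ≫ g i = f' :=
    ⟨hp.lift (z ≫ e.inv) f' (by simp [he, h]), hp.lift_fst _ _ _, hp.lift_snd _ _ _⟩
  have hz : l ≫ Limits.Sigma.ι Y i ≫ e.hom = z := by
    rw [← Category.assoc, hl₁]
    simp
  rw [← Category.assoc, ← hl₁, Category.assoc, Limits.Sigma.ι_desc, hm]
  subst hl₂
  simp only [hz]

/-- The family equal to `X i` at `i` and to the initial object elsewhere. -/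
abbrev single (X : I → V) (i : I) : I → V :=
  fun k => ∐ fun _ : ULift.{w} (PLift (k = i)) => X k

/-- The canonical maps from the family concentrated at `i`. -/
def singleMap (X : I → V) (i k : I) : single X i k ⟶ X k :=
  Limits.Sigma.desc fun _ => 𝟙 _

/-- The inclusion of the only nontrivial summand. -/
def singleι (X : I → V) (i : I) : X i ⟶ single X i i :=
  Limits.Sigma.ι (fun _ : ULift.{w} (PLift (i = i)) => X i) ⟨⟨rfl⟩⟩

theorem singleι_map (X : I → V) (i : I) : singleι X i ≫ singleMap X i i = 𝟙 _ :=
  Limits.Sigma.ι_desc _ _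

theorem singleMap_ι (X : I → V) (i : I) : singleMap X i i ≫ singleι X i = 𝟙 _ := by
  apply Limits.Sigma.hom_ext
  intro k
  have h : Limits.Sigma.ι _ k ≫ singleMap X i i = 𝟙 _ := Limits.Sigma.ι_desc _ _
  rw [← Category.assoc, h, Category.id_comp, Category.comp_id]
  rfl

/-- Distinct summands of a coproduct are disjoint. -/
theorem sigma_disjoint (X : I → V) {i j : I} (hij : i ≠ j) {T : V} (a : T ⟶ X i) (b : T ⟶ X j)
    (h : a ≫ Limits.Sigma.ι X i = b ≫ Limits.Sigma.ι X j) (Q : V) :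
    Nonempty (Unique (T ⟶ Q)) := by
  have hp := sigma_isPullback (singleMap X i) j
  let l : T ⟶ single X i j := hp.lift (a ≫ singleι X i ≫ Limits.Sigma.ι (single X i) i) b (by
    simp only [Category.assoc, Limits.Sigma.ι_map]
    rw [← Category.assoc (singleι X i), singleι_map, Category.id_comp, h])
  have : IsEmpty (ULift.{w} (PLift (j = i))) := ⟨fun k => hij k.down.down.symm⟩
  refine ⟨⟨⟨l ≫ Limits.Sigma.desc fun k => isEmptyElim k⟩, fun p => ?_⟩⟩
  exact cover_ext l fun k => isEmptyElim k

instance sigma_mono (X : I → V) (i : I) : Mono (Limits.Sigma.ι X i) where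
  right_cancellation {T} a b h := by
    have hp := sigma_isPullback (singleMap X i) i
    let r : ∐ single X i ⟶ X i := Limits.Sigma.desc fun k =>
      Limits.Sigma.desc fun h => eqToHom (by rw [h.down.down])
    have hr : Limits.Sigma.ι (single X i) i ≫ r = singleMap X i i := by
      refine (Limits.Sigma.ι_desc (f := single X i) _ _).trans ?_
      rfl
    let l : T ⟶ single X i i :=
      hp.lift (a ≫ singleι X i ≫ Limits.Sigma.ι (single X i) i) b (by
        simp only [Category.assoc, Limits.Sigma.ι_map]
        rw [← Category.assoc (singleι X i), singleι_map, Category.id_comp, h])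
    have h₁ : l ≫ Limits.Sigma.ι (single X i) i = _ := hp.lift_fst _ _ _
    have h₂ : l ≫ singleMap X i i = b := hp.lift_snd _ _ _
    have h₃ := h₁ =≫ r
    simp only [Category.assoc, hr, singleι_map] at h₃
    rw [h₂] at h₃
    simpa using h₃.symm

end Extensive

/-! ### Small products in an extensive cartesian closed category with pullbacks -/

section Products

variable (V : Type u) [Category.{v} V] [CartesianMonoidalCategory V] [HasPullbacks V]

instance hasEqualizers_of_pullbacks : HasEqualizers V :=
  hasEqualizers_of_hasPullbacks_and_binary_products

variable {V} [MonoidalClosed V] [IsExtensive.{w} V]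

/-- The product of a family is the object of sections of `∐ X ⟶ ∐ 1`. -/
theorem exists_product {J : Type w} (X : J → V) : HasProduct X := by
  let S : V := ∐ fun _ : J => 𝟙_ V
  let p : ∐ X ⟶ S := Limits.Sigma.map fun j => toUnit (X j)
  let P : V := pullback ((ihom S).map p) (curry (fst S (𝟙_ V)))
  have hP {T : V} (s : T ⟶ S) (z : T ⟶ P) : ap s (z ≫ pullback.fst _ _) ≫ p = s := by
    rw [← ap_map, Category.assoc, pullback.condition, ← Category.assoc, ap_curry]
    simp
  let pt (j : J) : 𝟙_ V ⟶ S := Limits.Sigma.ι (fun _ : J => 𝟙_ V) j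
  have sq (j : J) := sigma_isPullback (fun j => toUnit (X j)) j
  let π (j : J) : P ⟶ X j := (sq j).lift (ap (toUnit P ≫ pt j) (pullback.fst _ _)) (toUnit P) (by
    have := hP (toUnit P ≫ pt j) (𝟙 P)
    simpa using this)
  have hπ (j : J) : π j ≫ Limits.Sigma.ι X j = ap (toUnit P ≫ pt j) (pullback.fst _ _) :=
    (sq j).lift_fst _ _ _
  have key {T : V} (x : ∀ j, T ⟶ X j) : ∃ c : S ⊗ T ⟶ ∐ X, ∀ (j : J) {Z : V} (z : Z ⟶ S ⊗ T)
      (f' : Z ⟶ 𝟙_ V), z ≫ fst S T = f' ≫ pt j → z ≫ c = z ≫ snd S T ≫ x j ≫ Limits.Sigma.ι X j :=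
    cover_glue (X := fun _ : J => 𝟙_ V) (fst S T) (fun j _ z _ _ => z ≫ snd S T ≫ x j ≫ Limits.Sigma.ι X j)
      (fun j _ _ y z f' h => by simp)
  choose c hc using @key
  have hcp {T : V} (x : ∀ j, T ⟶ X j) : c x ≫ p = fst S T := by
    apply cover_ext (X := fun _ : J => 𝟙_ V) (fst S T)
    intro j Z z f' h
    rw [← Category.assoc, hc x j z f' h, h]
    simp only [p, Category.assoc, Limits.Sigma.ι_map]
    simp only [← Category.assoc]
    congr 1
    exact toUnit_unique _ _
  refine ⟨⟨⟨Fan.mk P π, Fan.IsLimit.mk _ (fun s => pullback.lift (curry (c s.proj)) (toUnit _) ?_) ?_ ?_⟩⟩⟩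
  · apply ap_ext
    intro T x z
    rw [← Category.assoc, ap_map, ap_curry, Category.assoc, hcp, ← Category.assoc, ap_curry]
    simp
  · intro s j
    change _ ≫ π j = _
    rw [← cancel_mono (Limits.Sigma.ι X j), Category.assoc, hπ, comp_ap, pullback.lift_fst]
    have := ap_curry (pullback.lift (curry (c s.proj)) (toUnit _) (by
      apply ap_ext
      intro T x z
      rw [← Category.assoc, ap_map, ap_curry, Category.assoc, hcp, ← Category.assoc, ap_curry]
      simp) ≫ toUnit P ≫ pt j) (𝟙 _) (c s.proj)
    rw [Category.id_comp] at this
    rw [this, hc s.proj j _ (toUnit _)]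
    · simp
    · simp only [lift_fst, ← Category.assoc]
      congr 1
      exact toUnit_unique _ _
  · intro s m hm
    apply pullback.hom_ext
    · rw [pullback.lift_fst]
      apply MonoidalClosed.uncurry_injective
      rw [MonoidalClosed.uncurry_curry]
      apply cover_ext (X := fun _ : J => 𝟙_ V) (fst S _)
      intro j Z z f' h
      rw [hc s.proj j z f' h, ← hm j]
      change _ = _ ≫ _ ≫ (m ≫ π j) ≫ _
      have e : uncurry (m ≫ pullback.fst ((ihom S).map p) (curry (fst S (𝟙_ V)))) =
          ap (fst _ _) (snd _ _ ≫ m ≫ pullback.fst _ _) := by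
        rw [MonoidalClosed.uncurry_eq, ap]
        congr 1
        ext <;> simp
      rw [e, comp_ap, h, Category.assoc m, hπ, comp_ap, comp_ap, comp_ap]
      congr 1
      simp only [← Category.assoc]
      congr 1
      exact toUnit_unique _ _
    · exact toUnit_unique _ _

instance hasProducts_of_extensive : HasProducts.{w} V := fun J =>
  ⟨fun F => by
    have : HasLimit (Discrete.functor (F.obj ∘ Discrete.mk)) :=
      exists_product (fun j : J => F.obj ⟨j⟩)
    exact hasLimit_of_iso (Discrete.natIsoFunctor (F := F)).symm⟩

end Products

/-! ### `V`-natural transformations and `V`-categories of `V`-functors -/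

section Functors

variable {V : Type u} [Category.{v} V] [CartesianMonoidalCategory V]

section

variable {C : Type u₁} [EnrichedCategory V C] {D : Type u₂} [EnrichedCategory V D]

/-- A `V`-natural transformation: naturality is an equality of morphisms in `V` out of every
hom-object, and not only of its global elements. -/
@[ext]
structure VNatTrans (F G : EnrichedFunctor V C D) where
  app : ∀ A : C, 𝟙_ V ⟶ (F.obj A ⟶[V] G.obj A)
  naturality : ∀ A B : C,
    eMul (F.map A B) (toUnit _ ≫ app B) = eMul (toUnit _ ≫ app A) (G.map A B)

namespace VNatTrans

/-- The identity `V`-natural transformation. -/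
def id (F : EnrichedFunctor V C D) : VNatTrans F F where
  app A := eId V (F.obj A)
  naturality A B := by
    have h (X : C) : toUnit (A ⟶[V] B) ≫ eId V (F.obj X) = eOne _ (F.obj X) := rfl
    rw [h, h, eMul_eOne, eOne_eMul]

/-- Composition of `V`-natural transformations. -/
def comp {F G H : EnrichedFunctor V C D} (α : VNatTrans F G) (β : VNatTrans G H) :
    VNatTrans F H where
  app A := eMul (α.app A) (β.app A)
  naturality A B := by
    rw [comp_eMul, comp_eMul, ← eMul_assoc, α.naturality, eMul_assoc, β.naturality, eMul_assoc]

/-- A `V`-natural transformation is an isomorphism if it has a two-sided inverse. -/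
def IsIso {F G : EnrichedFunctor V C D} (α : VNatTrans F G) : Prop :=
  ∃ β : VNatTrans G F, α.comp β = VNatTrans.id F ∧ β.comp α = VNatTrans.id G

end VNatTrans

end

variable [MonoidalClosed V] [HasPullbacks V] [IsExtensive.{w} V]

section FunctorCategory

variable {I : Type w} [EnrichedCategory V I] {D : Type u₂} [EnrichedCategory V D]

/-- The first of the two parallel maps whose equalizer is the object of `V`-natural
transformations; it is induced by `F`. -/
def natLeft (F G : EnrichedFunctor V I D) :
    (∏ᶜ fun A : I => (F.obj A ⟶[V] G.obj A)) ⟶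
      ∏ᶜ fun p : I × I => (ihom (p.1 ⟶[V] p.2)).obj (F.obj p.1 ⟶[V] G.obj p.2) :=
  Pi.lift fun p => curry (eMul (fst _ _ ≫ F.map p.1 p.2) (snd _ _ ≫ Pi.π _ p.2))

/-- The second of the two parallel maps; it is induced by `G`. -/
def natRight (F G : EnrichedFunctor V I D) :
    (∏ᶜ fun A : I => (F.obj A ⟶[V] G.obj A)) ⟶
      ∏ᶜ fun p : I × I => (ihom (p.1 ⟶[V] p.2)).obj (F.obj p.1 ⟶[V] G.obj p.2) :=
  Pi.lift fun p => curry (eMul (snd _ _ ≫ Pi.π _ p.1) (fst _ _ ≫ G.map p.1 p.2))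

theorem natLeft_π (F G : EnrichedFunctor V I D) (A B : I) :
    natLeft F G ≫ Pi.π (fun p : I × I => (ihom (p.1 ⟶[V] p.2)).obj (F.obj p.1 ⟶[V] G.obj p.2))
      (A, B) = curry (eMul (fst _ _ ≫ F.map A B) (snd _ _ ≫ Pi.π _ B)) :=
  Pi.lift_π _ _

theorem natRight_π (F G : EnrichedFunctor V I D) (A B : I) :
    natRight F G ≫ Pi.π (fun p : I × I => (ihom (p.1 ⟶[V] p.2)).obj (F.obj p.1 ⟶[V] G.obj p.2))
      (A, B) = curry (eMul (snd (A ⟶[V] B) (∏ᶜ fun A : I => (F.obj A ⟶[V] G.obj A)) ≫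
        Pi.π (fun A : I => (F.obj A ⟶[V] G.obj A)) A) (fst _ _ ≫ G.map A B)) :=
  Pi.lift_π _ _

/-- The object of `V`-natural transformations, that is the end of `D(F -, G -)`. -/
def natObj (F G : EnrichedFunctor V I D) : V := equalizer (natLeft F G) (natRight F G)

/-- The inclusion of the object of `V`-natural transformations into the product. -/
def natι (F G : EnrichedFunctor V I D) : natObj F G ⟶ ∏ᶜ fun A : I => (F.obj A ⟶[V] G.obj A) :=
  equalizer.ι (natLeft F G) (natRight F G)

theorem natι_condition (F G : EnrichedFunctor V I D) :
    natι F G ≫ natLeft F G = natι F G ≫ natRight F G :=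
  equalizer.condition (natLeft F G) (natRight F G)

/-- The component at `A` of the object of `V`-natural transformations. -/
def natπ (F G : EnrichedFunctor V I D) (A : I) : natObj F G ⟶ (F.obj A ⟶[V] G.obj A) :=
  natι F G ≫ Pi.π _ A

theorem natπ_naturality (F G : EnrichedFunctor V I D) (A B : I) {T : V} (f : T ⟶ (A ⟶[V] B))
    (z : T ⟶ natObj F G) :
    eMul (f ≫ F.map A B) (z ≫ natπ F G B) = eMul (z ≫ natπ F G A) (f ≫ G.map A B) := by
  have e : (z ≫ natι F G) ≫ natLeft F G = (z ≫ natι F G) ≫ natRight F G := by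
    rw [Category.assoc, natι_condition, Category.assoc]
  have h : ap f ((z ≫ natι F G) ≫ natLeft F G ≫ Pi.π (fun p : I × I =>
      (ihom (p.1 ⟶[V] p.2)).obj (F.obj p.1 ⟶[V] G.obj p.2)) (A, B)) =
      ap f ((z ≫ natι F G) ≫ natRight F G ≫ Pi.π (fun p : I × I =>
      (ihom (p.1 ⟶[V] p.2)).obj (F.obj p.1 ⟶[V] G.obj p.2)) (A, B)) := by
    rw [← Category.assoc, e, Category.assoc]
  rw [natLeft_π, natRight_π, ap_curry, ap_curry, comp_eMul, comp_eMul, lift_fst_assoc,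
    lift_fst_assoc, lift_snd_assoc, lift_snd_assoc] at h
  exact (congrArg (eMul _) (Category.assoc _ _ _).symm).trans
    (h.trans (congrArg (fun k => eMul k _) (Category.assoc _ _ _)))

/-- The map into the object of `V`-natural transformations given by a natural family. -/
def natLift {F G : EnrichedFunctor V I D} {Z : V} (h : ∀ A, Z ⟶ (F.obj A ⟶[V] G.obj A))
    (nat : ∀ (A B : I) {T : V} (f : T ⟶ (A ⟶[V] B)) (z : T ⟶ Z),
      eMul (f ≫ F.map A B) (z ≫ h B) = eMul (z ≫ h A) (f ≫ G.map A B)) : Z ⟶ natObj F G :=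
  equalizer.lift (Pi.lift h) (by
    apply Pi.hom_ext
    rintro ⟨A, B⟩
    rw [Category.assoc, Category.assoc, natLeft_π, natRight_π]
    apply ap_ext
    intro T f z
    have e (A : I) : (z ≫ Pi.lift h) ≫ Pi.π (fun A : I => (F.obj A ⟶[V] G.obj A)) A = z ≫ h A := by
      rw [Category.assoc, Pi.lift_π]
    rw [← Category.assoc, ← Category.assoc, ap_curry, ap_curry, comp_eMul, comp_eMul,
      lift_fst_assoc, lift_fst_assoc, lift_snd_assoc, lift_snd_assoc, e, e]
    exact nat A B f z)

theorem natLift_π {F G : EnrichedFunctor V I D} {Z : V} (h : ∀ A, Z ⟶ (F.obj A ⟶[V] G.obj A))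
    (nat : ∀ (A B : I) {T : V} (f : T ⟶ (A ⟶[V] B)) (z : T ⟶ Z),
      eMul (f ≫ F.map A B) (z ≫ h B) = eMul (z ≫ h A) (f ≫ G.map A B)) (A : I) :
    natLift h nat ≫ natπ F G A = h A := by
  exact (Category.assoc _ _ _).symm.trans
    ((equalizer.lift_ι _ _ =≫ _).trans (Pi.lift_π _ _))

theorem natObj_ext {F G : EnrichedFunctor V I D} {Z : V} {a b : Z ⟶ natObj F G}
    (h : ∀ A, a ≫ natπ F G A = b ≫ natπ F G A) : a = b := by
  apply equalizer.hom_ext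
  apply Pi.hom_ext
  intro A
  exact (Category.assoc _ _ _).trans ((h A).trans (Category.assoc _ _ _).symm)

/-- The identity in the `V`-category of `V`-functors. -/
def natId (F : EnrichedFunctor V I D) : 𝟙_ V ⟶ natObj F F :=
  natLift (fun A => eId V (F.obj A)) (by
    intro A B T f z
    have h (X : I) : z ≫ eId V (F.obj X) = eOne T (F.obj X) := by
      rw [eOne, toUnit_unique (toUnit T) z]
    rw [h, h, eMul_eOne, eOne_eMul])

/-- The composition in the `V`-category of `V`-functors. -/
def natComp (F G H : EnrichedFunctor V I D) : natObj F G ⊗ natObj G H ⟶ natObj F H :=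
  natLift (fun A => eMul (fst _ _ ≫ natπ F G A) (snd _ _ ≫ natπ G H A)) (by
    intro A B T f z
    simp only [comp_eMul, ← Category.assoc]
    rw [← eMul_assoc, natπ_naturality, eMul_assoc, natπ_naturality, eMul_assoc])

theorem natId_π (F : EnrichedFunctor V I D) (A : I) :
    natId F ≫ natπ F F A = eId V (F.obj A) := natLift_π _ _ _

theorem natComp_π {F G H : EnrichedFunctor V I D} {Z : V} (f : Z ⟶ natObj F G)
    (g : Z ⟶ natObj G H) (A : I) :
    (lift f g ≫ natComp F G H) ≫ natπ F H A = eMul (f ≫ natπ F G A) (g ≫ natπ G H A) := by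
  rw [Category.assoc, natComp, natLift_π, comp_eMul, ← Category.assoc, lift_fst,
    ← Category.assoc, lift_snd]

/-- The `V`-category of `V`-functors. -/
instance functorEnriched : EnrichedCategory V (EnrichedFunctor V I D) :=
  enrichedOfElements natObj natId natComp
    (by
      intro F G
      apply natObj_ext
      intro A
      rw [natComp_π, Category.assoc, natId_π]
      exact eOne_eMul _)
    (by
      intro F G
      apply natObj_ext
      intro A
      rw [natComp_π, Category.assoc, natId_π]
      exact eMul_eOne _)
    (by
      intro F G H K Z f g h
      apply natObj_ext
      intro A
      simp only [natComp_π, eMul_assoc])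

theorem eMul_natπ {F G H : EnrichedFunctor V I D} {Z : V} (f : Z ⟶ (F ⟶[V] G))
    (g : Z ⟶ (G ⟶[V] H)) (A : I) :
    eMul f g ≫ natπ F H A = eMul (f ≫ natπ F G A) (g ≫ natπ G H A) :=
  natComp_π f g A

theorem eId_natπ (F : EnrichedFunctor V I D) (A : I) :
    eId V F ≫ natπ F F A = eId V (F.obj A) :=
  natId_π F A

/-- The element of the object of `V`-natural transformations given by a `V`-natural
transformation. -/
def VNatTrans.toHom {F G : EnrichedFunctor V I D} (α : VNatTrans F G) : 𝟙_ V ⟶ (F ⟶[V] G) :=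
  natLift α.app (by
    intro A B T f z
    have h := f ≫= α.naturality A B
    simp only [comp_eMul, ← Category.assoc] at h
    rw [toUnit_unique z (f ≫ toUnit _)]
    exact h)

end FunctorCategory

/-! ### Representable `V`-functors -/

section Representable

variable [BraidedCategory V] {C : Type u₁} [EnrichedCategory V C]

theorem ap_eComp {X B B' : C} {T : V} (x : T ⟶ (X ⟶[V] B)) (f : T ⟶ (B ⟶[V] B')) :
    ap x (f ≫ curry (eComp V X B B')) = eMul x f := by
  rw [ap_curry, eMul]

/-- The covariant representable `V`-functor `C(X, -)`. -/
def coyo (X : C) : EnrichedFunctor V C V :=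
  functorOfElements (fun B => (X ⟶[V] B)) (fun B B' => curry (eComp V X B B'))
    (by
      intro B
      apply ap_ext
      intro T x z
      have h : z ≫ eId V B = eOne T B := by
        rw [eOne, toUnit_unique (toUnit T) z]
      rw [← Category.assoc, h, ap_eComp, eMul_eOne, toUnit_unique z (toUnit T)]
      exact (ap_eOne x).symm)
    (by
      intro B B' B'' Z f g
      apply ap_ext
      intro T x z
      rw [comp_eMul, ap_eMul]
      simp only [← Category.assoc, ap_eComp, comp_eMul]
      exact (eMul_assoc _ _ _).symm)

/-- The map `C(A', A) ⟶ [C(A, X), C(A', X)]` corresponding to composition. -/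
def yoMap (X A A' : C) : (A' ⟶[V] A) ⟶ (ihom (A ⟶[V] X)).obj (A' ⟶[V] X) :=
  curry (eMul (snd _ _) (fst _ _))

theorem ap_yoMap {X A A' : C} {T : V} (x : T ⟶ (A ⟶[V] X)) (f : T ⟶ (A' ⟶[V] A)) :
    ap x (f ≫ yoMap X A A') = eMul f x := by
  rw [yoMap, ap_curry, comp_eMul, lift_fst, lift_snd]

/-- The contravariant representable `V`-functor `C(-, X)`. -/
def yo (X : C) : EnrichedFunctor V Cᵒᵖ V :=
  functorOfElements (fun A => (A.unop ⟶[V] X)) (fun A A' => yoMap X A.unop A'.unop)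
    (by
      intro A
      apply ap_ext
      intro T x z
      have h : z ≫ eId V A = eOne (C := C) T A.unop := by
        rw [eOne, toUnit_unique (toUnit T) z]
        rfl
      rw [← Category.assoc, h, ap_yoMap, eOne_eMul, toUnit_unique z (toUnit T)]
      exact (ap_eOne x).symm)
    (by
      intro A A' A'' Z f g
      apply ap_ext
      intro T x z
      rw [comp_eMul, ap_eMul, ← Category.assoc, ← Category.assoc, ← Category.assoc, comp_eMul,
        eMul_op, ap_yoMap]
      refine (eMul_assoc _ _ _).trans ?_
      refine Eq.trans ?_ (ap_yoMap _ _).symm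
      exact congrArg (eMul _) (ap_yoMap _ _).symm)

/-- The map `C(A, B) × F B ⟶ F A` of a `V`-functor `F : Cᵒᵖ ⥤ V`. -/
def evMap (F : EnrichedFunctor V Cᵒᵖ V) (A B : C) : (A ⟶[V] B) ⊗ F.obj (op B) ⟶ F.obj (op A) :=
  ap (snd _ _) (fst (A ⟶[V] B) (F.obj (op B)) ≫ F.map (op B) (op A))

theorem evMap_apply (F : EnrichedFunctor V Cᵒᵖ V) (A B : C) {T : V} (f : T ⟶ (A ⟶[V] B))
    (y : T ⟶ F.obj (op B)) : lift f y ≫ evMap F A B = ap y (f ≫ F.map (op B) (op A)) := by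
  rw [evMap, comp_ap, ← Category.assoc, lift_fst, lift_snd]

/-- The `V`-natural transformation `C(-, X) ⟹ F` corresponding to an element `x` of `F X` under
the Yoneda lemma: its component at `A` is `C(A, X) ≅ C(A, X) × 1 ⟶ C(A, X) × F X ⟶ F A`. -/
def yonedaTrans (F : EnrichedFunctor V Cᵒᵖ V) (X : C) (x : 𝟙_ V ⟶ F.obj (op X)) :
    VNatTrans (yo X) F where
  app A := curry (lift (fst _ _) (toUnit _ ≫ x) ≫ evMap F A.unop X)
  naturality A B := by
    apply ap_ext
    intro T y f
    rw [comp_eMul, comp_eMul]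
    refine (ap_eMul _ _ _).trans (Eq.trans ?_ (ap_eMul _ _ _).symm)
    have hc (A : Cᵒᵖ) (a : T ⟶ (A.unop ⟶[V] X)) (k : T ⟶ 𝟙_ V) :
        ap a (k ≫ curry (lift (fst (A.unop ⟶[V] X) (𝟙_ V)) (toUnit _ ≫ x) ≫ evMap F A.unop X)) =
          ap (toUnit T ≫ x) (a ≫ F.map (op X) A) := by
      rw [ap_curry, ← Category.assoc, comp_lift, evMap_apply, lift_fst, ← Category.assoc,
        comp_toUnit]
    have e₁ : ap y (f ≫ (yo X).map A B) = eMul (C := C) f y := ap_yoMap _ _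
    rw [e₁, ← Category.assoc, ← Category.assoc]
    refine (hc B _ _).trans ?_
    refine Eq.trans ?_ (congrArg (fun k => ap k _) (hc A y _).symm)
    have e₂ : eMul (C := C) f y = eMul (C := Cᵒᵖ) (X := op X) (Y := A) (W := B) y f :=
      (eMul_op (C := C) (X := op X) (Y := A) (W := B) y f).symm
    rw [e₂]
    exact (congrArg (ap _) (eMul_map F _ _)).trans (ap_eMul _ _ _)

/-- A `V`-functor `F : Cᵒᵖ ⥤ V` is represented by an object `X` with an element `x` of `F X`
if the corresponding `V`-natural transformation `C(-, X) ⟹ F` is an isomorphism. -/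
def IsRepresentedBy (F : EnrichedFunctor V Cᵒᵖ V) (X : C) (x : 𝟙_ V ⟶ F.obj (op X)) : Prop :=
  (yonedaTrans F X x).IsIso

end Representable

/-! ### Weighted limits -/

section WeightedLimit

variable [BraidedCategory V] {I : Type w} [EnrichedCategory V I] {C : Type u₁}
  [EnrichedCategory V C]

/-- The action of `C(-, G) : Cᵒᵖ ⥤ V^I` on hom-objects: its component at `i` corresponds to the
composition map `C(A, B) × C(B, G i) ⟶ C(A, G i)`. -/
def coneMap (G : EnrichedFunctor V I C) (B A : Cᵒᵖ) :
    (B ⟶[V] A) ⟶ natObj (G.comp V (coyo B.unop)) (G.comp V (coyo A.unop)) :=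
  natLift (fun i => (yo (G.obj i)).map B A) (by
    intro i j T f z
    apply ap_ext
    intro S x y
    rw [comp_eMul, comp_eMul]
    refine (ap_eMul _ _ _).trans (Eq.trans ?_ (ap_eMul _ _ _).symm)
    have h₁ (A : Cᵒᵖ) (a : S ⟶ (A.unop ⟶[V] G.obj i)) :
        ap a (y ≫ f ≫ (G.comp V (coyo A.unop)).map i j) = eMul a (y ≫ f ≫ G.map i j) := by
      change ap a (y ≫ f ≫ G.map i j ≫ curry _) = _
      rw [← Category.assoc f, ← Category.assoc]
      refine (ap_curry _ _ _).trans rfl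
    have h₂ (i : I) (b : S ⟶ (B.unop ⟶[V] G.obj i)) :
        ap b (y ≫ z ≫ (yo (G.obj i)).map B A) = eMul (C := C) (y ≫ z) b :=
      (congrArg (ap b) (Category.assoc _ _ _).symm).trans (ap_yoMap _ _)
    refine (congrArg (fun k => ap k _) (h₁ B x)).trans ?_
    refine (h₂ j _).trans ?_
    refine Eq.trans ?_ (congrArg (fun k => ap k _) (h₂ i x).symm)
    refine Eq.trans ?_ (h₁ A _).symm
    exact (eMul_assoc _ _ _).symm)

theorem coneMap_π (G : EnrichedFunctor V I C) (B A : Cᵒᵖ) (i : I) :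
    coneMap G B A ≫ natπ _ _ i = (yo (G.obj i)).map B A :=
  natLift_π _ _ _

/-- The `V`-functor `C(-, G) : Cᵒᵖ ⥤ V^I`. -/
def coneFunctor (G : EnrichedFunctor V I C) : EnrichedFunctor V Cᵒᵖ (EnrichedFunctor V I V) :=
  functorOfElements (fun A => G.comp V (coyo A.unop)) (coneMap G)
    (by
      intro A
      apply natObj_ext
      intro i
      refine (Category.assoc _ _ _).trans ?_
      refine (congrArg (eId V A ≫ ·) (coneMap_π G A A i)).trans ?_
      exact ((yo (G.obj i)).map_id A).trans (eId_natπ (G.comp V (coyo A.unop)) i).symm)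
    (by
      intro A B D Z f g
      apply natObj_ext
      intro i
      have e {A B : Cᵒᵖ} (f : Z ⟶ (A ⟶[V] B)) :
          (f ≫ coneMap G A B) ≫ natπ _ _ i = f ≫ (yo (G.obj i)).map A B :=
        (Category.assoc _ _ _).trans (congrArg (f ≫ ·) (coneMap_π G A B i))
      refine (e _).trans (Eq.trans ?_ (eMul_natπ _ _ i).symm)
      refine (eMul_map _ _ _).trans ?_
      exact congrArg₂ eMul (e f).symm (e g).symm)

/-- The `V`-functor `V^I(W, C(-, G)) : Cᵒᵖ ⥤ V` of `W`-weighted cones over `G`. -/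
def weightedConeFunctor (W : EnrichedFunctor V I V) (G : EnrichedFunctor V I C) :
    EnrichedFunctor V Cᵒᵖ V :=
  (coneFunctor G).comp V (coyo W)

/-- The pair `(L, l)` is a `W`-weighted `V`-limit of `G`: the `V`-natural transformation
`C(-, L) ⟹ V^I(W, C(-, G))` induced by `l : W ⟹ C(L, G -)` is an isomorphism. -/
def IsWeightedLimit (W : EnrichedFunctor V I V) (G : EnrichedFunctor V I C) (L : C)
    (l : VNatTrans W (G.comp V (coyo L))) : Prop :=
  IsRepresentedBy (weightedConeFunctor W G) L l.toHom

end WeightedLimit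

end Functors

/-! ### Internal categories -/

section Internal

variable (V : Type u) [Category.{v} V] [HasPullbacks V]

/-- A category internal to `V`. The map `c` is the composition of composable arrows in
diagrammatic order. The unit and associativity laws are stated for generalized elements. -/
structure InternalCat where
  obj₀ : V
  obj₁ : V
  s : obj₁ ⟶ obj₀
  t : obj₁ ⟶ obj₀
  i : obj₀ ⟶ obj₁
  c : pullback t s ⟶ obj₁
  i_s : i ≫ s = 𝟙 obj₀
  i_t : i ≫ t = 𝟙 obj₀
  c_s : c ≫ s = pullback.fst t s ≫ s
  c_t : c ≫ t = pullback.snd t s ≫ t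
  id_c : ∀ {Z : V} (f : Z ⟶ obj₁),
    pullback.lift ((f ≫ s) ≫ i) f (by rw [Category.assoc, i_t, Category.comp_id]) ≫ c = f
  c_id : ∀ {Z : V} (f : Z ⟶ obj₁),
    pullback.lift f ((f ≫ t) ≫ i) (by rw [Category.assoc, i_s, Category.comp_id]) ≫ c = f
  assoc_c : ∀ {Z : V} (f g h : Z ⟶ obj₁) (e : f ≫ t = g ≫ s) (e' : g ≫ t = h ≫ s),
    pullback.lift (pullback.lift f g e ≫ c) h
        (by rw [Category.assoc, c_t, pullback.lift_snd_assoc, e']) ≫ c =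
      pullback.lift f (pullback.lift g h e' ≫ c)
        (by rw [Category.assoc, c_s, pullback.lift_fst_assoc, e]) ≫ c

variable {V}

namespace InternalCat

/-- The composite of generalized arrows of an internal category. -/
def mul (A : InternalCat V) {Z : V} (f g : Z ⟶ A.obj₁) (e : f ≫ A.t = g ≫ A.s) : Z ⟶ A.obj₁ :=
  pullback.lift f g e ≫ A.c

variable (A : InternalCat V) {Z : V}

theorem mul_s (f g : Z ⟶ A.obj₁) (e : f ≫ A.t = g ≫ A.s) : A.mul f g e ≫ A.s = f ≫ A.s := by
  rw [mul, Category.assoc, A.c_s, pullback.lift_fst_assoc]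

theorem mul_t (f g : Z ⟶ A.obj₁) (e : f ≫ A.t = g ≫ A.s) : A.mul f g e ≫ A.t = g ≫ A.t := by
  rw [mul, Category.assoc, A.c_t, pullback.lift_snd_assoc]

theorem comp_mul {T : V} (z : T ⟶ Z) (f g : Z ⟶ A.obj₁) (e : f ≫ A.t = g ≫ A.s) :
    z ≫ A.mul f g e = A.mul (z ≫ f) (z ≫ g) (by rw [Category.assoc, e, Category.assoc]) := by
  rw [mul, mul, ← Category.assoc]
  congr 1
  apply pullback.hom_ext
  · rw [Category.assoc, pullback.lift_fst, pullback.lift_fst]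
  · rw [Category.assoc, pullback.lift_snd, pullback.lift_snd]

theorem mul_congr {f f' g g' : Z ⟶ A.obj₁} (hf : f = f') (hg : g = g') (e : f ≫ A.t = g ≫ A.s) :
    A.mul f g e = A.mul f' g' (by rw [← hf, ← hg, e]) := by
  subst hf hg
  rfl

theorem id_mul (f : Z ⟶ A.obj₁) (x : Z ⟶ A.obj₀) (h : f ≫ A.s = x) :
    A.mul (x ≫ A.i) f (by rw [Category.assoc, A.i_t, Category.comp_id, h]) = f := by
  subst h
  exact A.id_c f

theorem mul_id (f : Z ⟶ A.obj₁) (x : Z ⟶ A.obj₀) (h : f ≫ A.t = x) :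
    A.mul f (x ≫ A.i) (by rw [Category.assoc, A.i_s, Category.comp_id, h]) = f := by
  subst h
  exact A.c_id f

theorem mul_assoc (f g h : Z ⟶ A.obj₁) (e : f ≫ A.t = g ≫ A.s) (e' : g ≫ A.t = h ≫ A.s) :
    A.mul (A.mul f g e) h (by rw [mul_t, e']) = A.mul f (A.mul g h e') (by rw [mul_s, e]) :=
  A.assoc_c f g h e e'

theorem i_mul_i (x : Z ⟶ A.obj₀) (e : (x ≫ A.i) ≫ A.t = (x ≫ A.i) ≫ A.s) :
    A.mul (x ≫ A.i) (x ≫ A.i) e = x ≫ A.i :=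
  A.id_mul _ _ (by rw [Category.assoc, A.i_s, Category.comp_id])

end InternalCat

variable (V) in
/-- The data of an internal category whose composition is given on generalized elements, by a
natural operation. -/
structure InternalCatData where
  obj₀ : V
  obj₁ : V
  s : obj₁ ⟶ obj₀
  t : obj₁ ⟶ obj₀
  i : obj₀ ⟶ obj₁
  m : ∀ {Z : V} (f g : Z ⟶ obj₁), f ≫ t = g ≫ s → (Z ⟶ obj₁)
  comp_m : ∀ {T Z : V} (z : T ⟶ Z) (f g : Z ⟶ obj₁) (e : f ≫ t = g ≫ s),
    z ≫ m f g e = m (z ≫ f) (z ≫ g) (by rw [Category.assoc, e, Category.assoc])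
  i_s : i ≫ s = 𝟙 obj₀
  i_t : i ≫ t = 𝟙 obj₀
  m_s : ∀ {Z : V} (f g : Z ⟶ obj₁) (e : f ≫ t = g ≫ s), m f g e ≫ s = f ≫ s
  m_t : ∀ {Z : V} (f g : Z ⟶ obj₁) (e : f ≫ t = g ≫ s), m f g e ≫ t = g ≫ t
  id_m : ∀ {Z : V} (f : Z ⟶ obj₁),
    m ((f ≫ s) ≫ i) f (by rw [Category.assoc, i_t, Category.comp_id]) = f
  m_id : ∀ {Z : V} (f : Z ⟶ obj₁),
    m f ((f ≫ t) ≫ i) (by rw [Category.assoc, i_s, Category.comp_id]) = f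
  m_assoc : ∀ {Z : V} (f g h : Z ⟶ obj₁) (e : f ≫ t = g ≫ s) (e' : g ≫ t = h ≫ s),
    m (m f g e) h (by rw [m_t, e']) = m f (m g h e') (by rw [m_s, e])

namespace InternalCatData

variable (d : InternalCatData V)

theorem lift_m {Z : V} (f g : Z ⟶ d.obj₁) (e : f ≫ d.t = g ≫ d.s) :
    pullback.lift f g e ≫ d.m (pullback.fst d.t d.s) (pullback.snd d.t d.s) pullback.condition =
      d.m f g e := by
  rw [d.comp_m]
  congr 1
  · exact pullback.lift_fst _ _ _
  · exact pullback.lift_snd _ _ _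

/-- The internal category with composition given on generalized elements. -/
def toInternalCat : InternalCat V where
  obj₀ := d.obj₀
  obj₁ := d.obj₁
  s := d.s
  t := d.t
  i := d.i
  c := d.m (pullback.fst d.t d.s) (pullback.snd d.t d.s) pullback.condition
  i_s := d.i_s
  i_t := d.i_t
  c_s := d.m_s _ _ _
  c_t := d.m_t _ _ _
  id_c := fun f => (d.lift_m _ _ _).trans (d.id_m f)
  c_id := fun f => (d.lift_m _ _ _).trans (d.m_id f)
  assoc_c := fun f g h e e' => by
    refine (d.lift_m _ _ _).trans (Eq.trans ?_ (d.lift_m _ _ _).symm)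
    simp only [d.lift_m]
    exact d.m_assoc f g h e e'

theorem mul_eq {Z : V} (f g : Z ⟶ d.obj₁) (e : f ≫ d.t = g ≫ d.s) :
    d.toInternalCat.mul f g e = d.m f g e :=
  d.lift_m f g e

end InternalCatData

/-- An internal functor; compatibility with composition is stated for generalized elements. -/
@[ext]
structure InternalFunctor (A B : InternalCat V) where
  map₀ : A.obj₀ ⟶ B.obj₀
  map₁ : A.obj₁ ⟶ B.obj₁
  map_s : map₁ ≫ B.s = A.s ≫ map₀
  map_t : map₁ ≫ B.t = A.t ≫ map₀
  map_i : A.i ≫ map₁ = map₀ ≫ B.i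
  map_mul : ∀ {Z : V} (f g : Z ⟶ A.obj₁) (e : f ≫ A.t = g ≫ A.s),
    A.mul f g e ≫ map₁ = B.mul (f ≫ map₁) (g ≫ map₁)
      (by rw [Category.assoc, Category.assoc, map_t, map_s, ← Category.assoc, e, Category.assoc])

/-- The category `Cat(V)` of internal categories and internal functors. -/
instance : Category (InternalCat V) where
  Hom := InternalFunctor
  id A :=
    { map₀ := 𝟙 _
      map₁ := 𝟙 _
      map_s := by simp
      map_t := by simp
      map_i := by simp
      map_mul := by
        intro Z f g e
        rw [Category.comp_id]
        exact A.mul_congr (Category.comp_id _).symm (Category.comp_id _).symm _ }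
  comp {A B D} F G :=
    { map₀ := F.map₀ ≫ G.map₀
      map₁ := F.map₁ ≫ G.map₁
      map_s := by rw [Category.assoc, G.map_s, ← Category.assoc, F.map_s, Category.assoc]
      map_t := by rw [Category.assoc, G.map_t, ← Category.assoc, F.map_t, Category.assoc]
      map_i := by rw [← Category.assoc, F.map_i, Category.assoc, G.map_i, Category.assoc]
      map_mul := by
        intro Z f g e
        rw [← Category.assoc, F.map_mul, G.map_mul]
        exact D.mul_congr (Category.assoc _ _ _) (Category.assoc _ _ _) _ }
  id_comp F := InternalFunctor.ext (Category.id_comp _) (Category.id_comp _)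
  comp_id F := InternalFunctor.ext (Category.comp_id _) (Category.comp_id _)
  assoc F G H := InternalFunctor.ext (Category.assoc _ _ _) (Category.assoc _ _ _)

namespace InternalCat

/-! #### Pullbacks of internal categories -/

section Pullback

variable {A B D : InternalCat V} (F : A ⟶ D) (G : B ⟶ D)

/-- The source map of the levelwise pullback. -/
def pbS : pullback F.map₁ G.map₁ ⟶ pullback F.map₀ G.map₀ :=
  pullback.lift (pullback.fst _ _ ≫ A.s) (pullback.snd _ _ ≫ B.s) (by
    rw [Category.assoc, Category.assoc, ← F.map_s, ← G.map_s, pullback.condition_assoc])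

/-- The target map of the levelwise pullback. -/
def pbT : pullback F.map₁ G.map₁ ⟶ pullback F.map₀ G.map₀ :=
  pullback.lift (pullback.fst _ _ ≫ A.t) (pullback.snd _ _ ≫ B.t) (by
    rw [Category.assoc, Category.assoc, ← F.map_t, ← G.map_t, pullback.condition_assoc])

/-- The identity map of the levelwise pullback. -/
def pbI : pullback F.map₀ G.map₀ ⟶ pullback F.map₁ G.map₁ :=
  pullback.lift (pullback.fst _ _ ≫ A.i) (pullback.snd _ _ ≫ B.i) (by
    rw [Category.assoc, Category.assoc, F.map_i, G.map_i, pullback.condition_assoc])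

theorem pbS_fst : pbS F G ≫ pullback.fst _ _ = pullback.fst _ _ ≫ A.s := pullback.lift_fst _ _ _
theorem pbS_snd : pbS F G ≫ pullback.snd _ _ = pullback.snd _ _ ≫ B.s := pullback.lift_snd _ _ _
theorem pbT_fst : pbT F G ≫ pullback.fst _ _ = pullback.fst _ _ ≫ A.t := pullback.lift_fst _ _ _
theorem pbT_snd : pbT F G ≫ pullback.snd _ _ = pullback.snd _ _ ≫ B.t := pullback.lift_snd _ _ _
theorem pbI_fst : pbI F G ≫ pullback.fst _ _ = pullback.fst _ _ ≫ A.i := pullback.lift_fst _ _ _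
theorem pbI_snd : pbI F G ≫ pullback.snd _ _ = pullback.snd _ _ ≫ B.i := pullback.lift_snd _ _ _

variable {F G}

theorem pb_fst {Z : V} {f g : Z ⟶ pullback F.map₁ G.map₁} (e : f ≫ pbT F G = g ≫ pbS F G) :
    (f ≫ pullback.fst _ _) ≫ A.t = (g ≫ pullback.fst _ _) ≫ A.s := by
  rw [Category.assoc, Category.assoc, ← pbT_fst, ← pbS_fst, ← Category.assoc, e, Category.assoc]

theorem pb_snd {Z : V} {f g : Z ⟶ pullback F.map₁ G.map₁} (e : f ≫ pbT F G = g ≫ pbS F G) :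
    (f ≫ pullback.snd _ _) ≫ B.t = (g ≫ pullback.snd _ _) ≫ B.s := by
  rw [Category.assoc, Category.assoc, ← pbT_snd, ← pbS_snd, ← Category.assoc, e, Category.assoc]

/-- The composition of generalized arrows of the levelwise pullback. -/
def pbMul {Z : V} (f g : Z ⟶ pullback F.map₁ G.map₁) (e : f ≫ pbT F G = g ≫ pbS F G) :
    Z ⟶ pullback F.map₁ G.map₁ :=
  pullback.lift (A.mul (f ≫ pullback.fst _ _) (g ≫ pullback.fst _ _) (pb_fst e))
    (B.mul (f ≫ pullback.snd _ _) (g ≫ pullback.snd _ _) (pb_snd e)) (by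
      rw [F.map_mul, G.map_mul]
      apply D.mul_congr
      · rw [Category.assoc, pullback.condition, Category.assoc]
      · rw [Category.assoc, pullback.condition, Category.assoc])

theorem pbMul_fst {Z : V} (f g : Z ⟶ pullback F.map₁ G.map₁) (e : f ≫ pbT F G = g ≫ pbS F G) :
    pbMul f g e ≫ pullback.fst _ _ =
      A.mul (f ≫ pullback.fst _ _) (g ≫ pullback.fst _ _) (pb_fst e) :=
  pullback.lift_fst _ _ _

theorem pbMul_snd {Z : V} (f g : Z ⟶ pullback F.map₁ G.map₁) (e : f ≫ pbT F G = g ≫ pbS F G) :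
    pbMul f g e ≫ pullback.snd _ _ =
      B.mul (f ≫ pullback.snd _ _) (g ≫ pullback.snd _ _) (pb_snd e) :=
  pullback.lift_snd _ _ _

variable (F G)

/-- The pullback of internal categories along internal functors, computed levelwise, on generalized
elements. -/
def pbData : InternalCatData V where
  obj₀ := pullback F.map₀ G.map₀
  obj₁ := pullback F.map₁ G.map₁
  s := pbS F G
  t := pbT F G
  i := pbI F G
  m := pbMul
  comp_m := by
    intro T Z z f g e
    apply pullback.hom_ext
    · rw [Category.assoc, pbMul_fst, pbMul_fst, comp_mul]
      exact A.mul_congr (Category.assoc _ _ _).symm (Category.assoc _ _ _).symm _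
    · rw [Category.assoc, pbMul_snd, pbMul_snd, comp_mul]
      exact B.mul_congr (Category.assoc _ _ _).symm (Category.assoc _ _ _).symm _
  i_s := by
    apply pullback.hom_ext
    · rw [Category.assoc, pbS_fst, ← Category.assoc, pbI_fst, Category.assoc, A.i_s]
      simp
    · rw [Category.assoc, pbS_snd, ← Category.assoc, pbI_snd, Category.assoc, B.i_s]
      simp
  i_t := by
    apply pullback.hom_ext
    · rw [Category.assoc, pbT_fst, ← Category.assoc, pbI_fst, Category.assoc, A.i_t]
      simp
    · rw [Category.assoc, pbT_snd, ← Category.assoc, pbI_snd, Category.assoc, B.i_t]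
      simp
  m_s := by
    intro Z f g e
    apply pullback.hom_ext
    · rw [Category.assoc, pbS_fst, ← Category.assoc, pbMul_fst, A.mul_s, Category.assoc,
        Category.assoc, pbS_fst]
    · rw [Category.assoc, pbS_snd, ← Category.assoc, pbMul_snd, B.mul_s, Category.assoc,
        Category.assoc, pbS_snd]
  m_t := by
    intro Z f g e
    apply pullback.hom_ext
    · rw [Category.assoc, pbT_fst, ← Category.assoc, pbMul_fst, A.mul_t, Category.assoc,
        Category.assoc, pbT_fst]
    · rw [Category.assoc, pbT_snd, ← Category.assoc, pbMul_snd, B.mul_t, Category.assoc,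
        Category.assoc, pbT_snd]
  id_m := by
    intro Z f
    apply pullback.hom_ext
    · rw [pbMul_fst]
      refine (A.mul_congr ?_ rfl _).trans (A.id_mul _ _ rfl)
      rw [Category.assoc, pbI_fst, Category.assoc f, ← Category.assoc (pbS F G), pbS_fst]
      simp only [Category.assoc]
    · rw [pbMul_snd]
      refine (B.mul_congr ?_ rfl _).trans (B.id_mul _ _ rfl)
      rw [Category.assoc, pbI_snd, Category.assoc f, ← Category.assoc (pbS F G), pbS_snd]
      simp only [Category.assoc]
  m_id := by
    intro Z f
    apply pullback.hom_ext
    · rw [pbMul_fst]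
      refine (A.mul_congr rfl ?_ _).trans (A.mul_id _ _ rfl)
      rw [Category.assoc, pbI_fst, Category.assoc f, ← Category.assoc (pbT F G), pbT_fst]
      simp only [Category.assoc]
    · rw [pbMul_snd]
      refine (B.mul_congr rfl ?_ _).trans (B.mul_id _ _ rfl)
      rw [Category.assoc, pbI_snd, Category.assoc f, ← Category.assoc (pbT F G), pbT_snd]
      simp only [Category.assoc]
  m_assoc := by
    intro Z f g h e e'
    apply pullback.hom_ext
    · refine (pbMul_fst _ _ _).trans (Eq.trans ?_ (pbMul_fst _ _ _).symm)
      refine (A.mul_congr (pbMul_fst f g e) rfl _).trans ?_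
      refine (A.mul_assoc _ _ _ (pb_fst e) (pb_fst e')).trans ?_
      exact A.mul_congr rfl (pbMul_fst g h e').symm _
    · refine (pbMul_snd _ _ _).trans (Eq.trans ?_ (pbMul_snd _ _ _).symm)
      refine (B.mul_congr (pbMul_snd f g e) rfl _).trans ?_
      refine (B.mul_assoc _ _ _ (pb_snd e) (pb_snd e')).trans ?_
      exact B.mul_congr rfl (pbMul_snd g h e').symm _

/-- The pullback of internal categories along internal functors, computed levelwise. -/
def pb : InternalCat V := (pbData F G).toInternalCat

/-- The first projection of the pullback. -/
def pbFst : pb F G ⟶ A where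
  map₀ := pullback.fst F.map₀ G.map₀
  map₁ := pullback.fst F.map₁ G.map₁
  map_s := (pbS_fst F G).symm
  map_t := (pbT_fst F G).symm
  map_i := pbI_fst F G
  map_mul f g e := (congrArg (· ≫ pullback.fst _ _) ((pbData F G).mul_eq f g e)).trans (pbMul_fst f g e)

/-- The second projection of the pullback. -/
def pbSnd : pb F G ⟶ B where
  map₀ := pullback.snd F.map₀ G.map₀
  map₁ := pullback.snd F.map₁ G.map₁
  map_s := (pbS_snd F G).symm
  map_t := (pbT_snd F G).symm
  map_i := pbI_snd F G
  map_mul f g e := (congrArg (· ≫ pullback.snd _ _) ((pbData F G).mul_eq f g e)).trans (pbMul_snd f g e)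

end Pullback

end InternalCat

end Internal

/-! #### Universal property of pullbacks, constant internal categories, products -/

section Internal

variable {V : Type u} [Category.{v} V] [HasPullbacks V]

namespace InternalCat

theorem hom_ext {A B : InternalCat V} {F G : A ⟶ B} (h₀ : F.map₀ = G.map₀)
    (h₁ : F.map₁ = G.map₁) : F = G :=
  InternalFunctor.ext h₀ h₁

section Pullback

variable {A B D : InternalCat V} (F : A ⟶ D) (G : B ⟶ D)

theorem pb_condition : pbFst F G ≫ F = pbSnd F G ≫ G :=
  hom_ext pullback.condition pullback.condition

variable {F G}

theorem pbLift_s {E : InternalCat V} (H : E ⟶ A) (K : E ⟶ B) (h : H ≫ F = K ≫ G) :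
    pullback.lift H.map₁ K.map₁ (congrArg InternalFunctor.map₁ h) ≫ pbS F G =
      E.s ≫ pullback.lift H.map₀ K.map₀ (congrArg InternalFunctor.map₀ h) := by
  apply pullback.hom_ext
  · rw [Category.assoc, pbS_fst, pullback.lift_fst_assoc, Category.assoc, pullback.lift_fst, H.map_s]
  · rw [Category.assoc, pbS_snd, pullback.lift_snd_assoc, Category.assoc, pullback.lift_snd, K.map_s]

theorem pbLift_t {E : InternalCat V} (H : E ⟶ A) (K : E ⟶ B) (h : H ≫ F = K ≫ G) :
    pullback.lift H.map₁ K.map₁ (congrArg InternalFunctor.map₁ h) ≫ pbT F G =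
      E.t ≫ pullback.lift H.map₀ K.map₀ (congrArg InternalFunctor.map₀ h) := by
  apply pullback.hom_ext
  · rw [Category.assoc, pbT_fst, pullback.lift_fst_assoc, Category.assoc, pullback.lift_fst, H.map_t]
  · rw [Category.assoc, pbT_snd, pullback.lift_snd_assoc, Category.assoc, pullback.lift_snd, K.map_t]

/-- The internal functor into the pullback induced by two internal functors. -/
def pbLift {E : InternalCat V} (H : E ⟶ A) (K : E ⟶ B) (h : H ≫ F = K ≫ G) : E ⟶ pb F G where
  map₀ := pullback.lift H.map₀ K.map₀ (congrArg InternalFunctor.map₀ h)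
  map₁ := pullback.lift H.map₁ K.map₁ (congrArg InternalFunctor.map₁ h)
  map_s := pbLift_s H K h
  map_t := pbLift_t H K h
  map_i := by
    apply pullback.hom_ext
    · refine Eq.trans ?_ (Eq.trans (congrArg (_ ≫ ·) (pbI_fst F G)).symm
        (Category.assoc _ _ _).symm)
      exact (Category.assoc _ _ _).trans ((congrArg (E.i ≫ ·) (pullback.lift_fst _ _ _)).trans
        (H.map_i.trans (pullback.lift_fst_assoc _ _ _ _).symm))
    · refine Eq.trans ?_ (Eq.trans (congrArg (_ ≫ ·) (pbI_snd F G)).symm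
        (Category.assoc _ _ _).symm)
      exact (Category.assoc _ _ _).trans ((congrArg (E.i ≫ ·) (pullback.lift_snd _ _ _)).trans
        (K.map_i.trans (pullback.lift_snd_assoc _ _ _ _).symm))
  map_mul f g e := by
    have ee : (f ≫ pullback.lift H.map₁ K.map₁ (congrArg InternalFunctor.map₁ h)) ≫ pbT F G =
        (g ≫ pullback.lift H.map₁ K.map₁ (congrArg InternalFunctor.map₁ h)) ≫ pbS F G := by
      rw [Category.assoc, Category.assoc, pbLift_s H K h, pbLift_t H K h, ← Category.assoc, e, Category.assoc]
    refine Eq.trans ?_ ((pbData F G).mul_eq _ _ ee).symm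
    apply pullback.hom_ext
    · refine Eq.trans ?_ (pbMul_fst _ _ ee).symm
      refine (Category.assoc _ _ _).trans ((congrArg (_ ≫ ·) (pullback.lift_fst _ _ _)).trans ?_)
      refine (H.map_mul f g e).trans (A.mul_congr ?_ ?_ _)
      · exact ((Category.assoc _ _ _).trans (congrArg (f ≫ ·) (pullback.lift_fst _ _ _))).symm
      · exact ((Category.assoc _ _ _).trans (congrArg (g ≫ ·) (pullback.lift_fst _ _ _))).symm
    · refine Eq.trans ?_ (pbMul_snd _ _ ee).symm
      refine (Category.assoc _ _ _).trans ((congrArg (_ ≫ ·) (pullback.lift_snd _ _ _)).trans ?_)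
      refine (K.map_mul f g e).trans (B.mul_congr ?_ ?_ _)
      · exact ((Category.assoc _ _ _).trans (congrArg (f ≫ ·) (pullback.lift_snd _ _ _))).symm
      · exact ((Category.assoc _ _ _).trans (congrArg (g ≫ ·) (pullback.lift_snd _ _ _))).symm

/-- The levelwise pullback is a pullback in the category of internal categories. -/
theorem isPullback_pb : IsPullback (pbFst F G) (pbSnd F G) F G where
  w := pb_condition F G
  isLimit' := ⟨PullbackCone.IsLimit.mk _ (fun s => pbLift s.fst s.snd s.condition)
    (fun _ => hom_ext (pullback.lift_fst _ _ _) (pullback.lift_fst _ _ _))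
    (fun _ => hom_ext (pullback.lift_snd _ _ _) (pullback.lift_snd _ _ _))
    (fun s m h₁ h₂ => by
      apply hom_ext
      · apply pullback.hom_ext
        · refine Eq.trans ?_ (pullback.lift_fst _ _ _).symm
          exact congrArg InternalFunctor.map₀ h₁
        · refine Eq.trans ?_ (pullback.lift_snd _ _ _).symm
          exact congrArg InternalFunctor.map₀ h₂
      · apply pullback.hom_ext
        · refine Eq.trans ?_ (pullback.lift_fst _ _ _).symm
          exact congrArg InternalFunctor.map₁ h₁
        · refine Eq.trans ?_ (pullback.lift_snd _ _ _).symm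
          exact congrArg InternalFunctor.map₁ h₂)⟩

end Pullback

/-- The constant internal category at `X`, with generalized elements. -/
def cstData (X : V) : InternalCatData V where
  obj₀ := X
  obj₁ := X
  s := 𝟙 X
  t := 𝟙 X
  i := 𝟙 X
  m f _ _ := f
  comp_m _ _ _ _ := rfl
  i_s := Category.comp_id _
  i_t := Category.comp_id _
  m_s _ _ _ := rfl
  m_t _ _ e := e
  id_m _ := by simp
  m_id _ := rfl
  m_assoc _ _ _ _ _ := rfl

/-- The constant internal category at `X`, with `X` as object of objects and of arrows. -/
def cst (X : V) : InternalCat V := (cstData X).toInternalCat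

/-- The internal functor from a constant internal category given by a generalized object. -/
def ofCst (A : InternalCat V) {X : V} (x : X ⟶ A.obj₀) : cst X ⟶ A where
  map₀ := x
  map₁ := x ≫ A.i
  map_s := by
    refine (Category.assoc _ _ _).trans ?_
    exact ((congrArg (x ≫ ·) A.i_s).trans (Category.comp_id _)).trans (Category.id_comp _).symm
  map_t := by
    refine (Category.assoc _ _ _).trans ?_
    exact ((congrArg (x ≫ ·) A.i_t).trans (Category.comp_id _)).trans (Category.id_comp _).symm
  map_i := Category.id_comp _
  map_mul {Z} f g e := by
    have e' : f = g := (Category.comp_id f).symm.trans (e.trans (Category.comp_id g))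
    subst e'
    rw [show (cst X).mul f f e = f from (cstData X).mul_eq f f e]
    have h : f ≫ x ≫ A.i = (f ≫ x) ≫ A.i := (Category.assoc _ _ _).symm
    refine h.trans ?_
    refine Eq.trans (A.i_mul_i (f ≫ x) ?_).symm (A.mul_congr h.symm h.symm _)
    rw [Category.assoc, Category.assoc (f ≫ x), A.i_s, A.i_t]

/-! #### The internal category of arrows -/

section Arrow

variable (B : InternalCat V)

/-- The object of commutative squares `u ≫ q = p ≫ v` of an internal category. -/
def sq : V := pullback B.c B.c

/-- The upper path `(u, q)` of a square `u ≫ q = p ≫ v`. -/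
def sqL : B.sq ⟶ pullback B.t B.s := pullback.fst B.c B.c

/-- The lower path `(p, v)` of a square `u ≫ q = p ≫ v`. -/
def sqR : B.sq ⟶ pullback B.t B.s := pullback.snd B.c B.c

/-- The source `u` of a square `u ≫ q = p ≫ v`, regarded as an arrow from `u` to `v`. -/
def sqU : B.sq ⟶ B.obj₁ := B.sqL ≫ pullback.fst B.t B.s

/-- The component `q` of a square `u ≫ q = p ≫ v` at the targets of `u` and `v`. -/
def sqQ : B.sq ⟶ B.obj₁ := B.sqL ≫ pullback.snd B.t B.s

/-- The component `p` of a square `u ≫ q = p ≫ v` at the sources of `u` and `v`. -/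
def sqP : B.sq ⟶ B.obj₁ := B.sqR ≫ pullback.fst B.t B.s

/-- The target `v` of a square `u ≫ q = p ≫ v`, regarded as an arrow from `u` to `v`. -/
def sqV : B.sq ⟶ B.obj₁ := B.sqR ≫ pullback.snd B.t B.s

theorem sq_uq : B.sqU ≫ B.t = B.sqQ ≫ B.s := by
  rw [sqU, sqQ, Category.assoc, Category.assoc, pullback.condition]

theorem sq_pv : B.sqP ≫ B.t = B.sqV ≫ B.s := by
  rw [sqP, sqV, Category.assoc, Category.assoc, pullback.condition]

theorem sq_comm : B.mul B.sqU B.sqQ B.sq_uq = B.mul B.sqP B.sqV B.sq_pv := by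
  have h₁ : pullback.lift B.sqU B.sqQ B.sq_uq = B.sqL := by
    apply pullback.hom_ext
    · rw [pullback.lift_fst, sqU]
    · rw [pullback.lift_snd, sqQ]
  have h₂ : pullback.lift B.sqP B.sqV B.sq_pv = B.sqR := by
    apply pullback.hom_ext
    · rw [pullback.lift_fst, sqP]
    · rw [pullback.lift_snd, sqV]
  exact (congrArg (· ≫ B.c) h₁).trans (pullback.condition.trans (congrArg (· ≫ B.c) h₂).symm)

variable {B} {Z : V}

theorem gsq_uq (w : Z ⟶ B.sq) : (w ≫ B.sqU) ≫ B.t = (w ≫ B.sqQ) ≫ B.s := by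
  rw [Category.assoc, sq_uq, Category.assoc]

theorem gsq_pv (w : Z ⟶ B.sq) : (w ≫ B.sqP) ≫ B.t = (w ≫ B.sqV) ≫ B.s := by
  rw [Category.assoc, sq_pv, Category.assoc]

theorem gsq_comm (w : Z ⟶ B.sq) :
    B.mul (w ≫ B.sqU) (w ≫ B.sqQ) (gsq_uq w) = B.mul (w ≫ B.sqP) (w ≫ B.sqV) (gsq_pv w) := by
  rw [← B.comp_mul w _ _ B.sq_uq, ← B.comp_mul w _ _ B.sq_pv, sq_comm]

/-- The generalized square given by its sides. -/
def sqLift (u q p v : Z ⟶ B.obj₁) (e : u ≫ B.t = q ≫ B.s) (e' : p ≫ B.t = v ≫ B.s)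
    (h : B.mul u q e = B.mul p v e') : Z ⟶ B.sq :=
  pullback.lift (pullback.lift u q e) (pullback.lift p v e') h

section

variable (u q p v : Z ⟶ B.obj₁) (e : u ≫ B.t = q ≫ B.s) (e' : p ≫ B.t = v ≫ B.s)
    (h : B.mul u q e = B.mul p v e')

theorem sqLift_U : sqLift u q p v e e' h ≫ B.sqU = u :=
  (Category.assoc _ _ _).symm.trans
    ((congrArg (· ≫ _) (pullback.lift_fst _ _ _)).trans (pullback.lift_fst _ _ _))

theorem sqLift_Q : sqLift u q p v e e' h ≫ B.sqQ = q :=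
  (Category.assoc _ _ _).symm.trans
    ((congrArg (· ≫ _) (pullback.lift_fst _ _ _)).trans (pullback.lift_snd _ _ _))

theorem sqLift_P : sqLift u q p v e e' h ≫ B.sqP = p :=
  (Category.assoc _ _ _).symm.trans
    ((congrArg (· ≫ _) (pullback.lift_snd _ _ _)).trans (pullback.lift_fst _ _ _))

theorem sqLift_V : sqLift u q p v e e' h ≫ B.sqV = v :=
  (Category.assoc _ _ _).symm.trans
    ((congrArg (· ≫ _) (pullback.lift_snd _ _ _)).trans (pullback.lift_snd _ _ _))

end

theorem sq_ext {a b : Z ⟶ B.sq} (hU : a ≫ B.sqU = b ≫ B.sqU) (hQ : a ≫ B.sqQ = b ≫ B.sqQ)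
    (hP : a ≫ B.sqP = b ≫ B.sqP) (hV : a ≫ B.sqV = b ≫ B.sqV) : a = b := by
  apply pullback.hom_ext
  · apply pullback.hom_ext
    · exact (Category.assoc _ _ _).trans (hU.trans (Category.assoc _ _ _).symm)
    · exact (Category.assoc _ _ _).trans (hQ.trans (Category.assoc _ _ _).symm)
  · apply pullback.hom_ext
    · exact (Category.assoc _ _ _).trans (hP.trans (Category.assoc _ _ _).symm)
    · exact (Category.assoc _ _ _).trans (hV.trans (Category.assoc _ _ _).symm)

theorem sq_ps (w : Z ⟶ B.sq) : (w ≫ B.sqP) ≫ B.s = (w ≫ B.sqU) ≫ B.s := by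
  have h := gsq_comm w =≫ B.s
  rw [mul_s, mul_s] at h
  exact h.symm

theorem sq_qt (w : Z ⟶ B.sq) : (w ≫ B.sqQ) ≫ B.t = (w ≫ B.sqV) ≫ B.t := by
  have h := gsq_comm w =≫ B.t
  rw [mul_t, mul_t] at h
  exact h

theorem sq_pp {f g : Z ⟶ B.sq} (e : f ≫ B.sqV = g ≫ B.sqU) :
    (f ≫ B.sqP) ≫ B.t = (g ≫ B.sqP) ≫ B.s := by
  rw [gsq_pv, e, sq_ps]

theorem sq_qq {f g : Z ⟶ B.sq} (e : f ≫ B.sqV = g ≫ B.sqU) :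
    (f ≫ B.sqQ) ≫ B.t = (g ≫ B.sqQ) ≫ B.s := by
  rw [sq_qt, e, gsq_uq]

/-- The pasting of two generalized squares. -/
def sqMul (f g : Z ⟶ B.sq) (e : f ≫ B.sqV = g ≫ B.sqU) : Z ⟶ B.sq :=
  sqLift (f ≫ B.sqU) (B.mul (f ≫ B.sqQ) (g ≫ B.sqQ) (sq_qq e))
    (B.mul (f ≫ B.sqP) (g ≫ B.sqP) (sq_pp e)) (g ≫ B.sqV)
    (by rw [mul_s, gsq_uq]) (by rw [mul_t, gsq_pv]) (by
      rw [← B.mul_assoc _ _ _ (gsq_uq f) (sq_qq e), B.mul_assoc _ _ _ (sq_pp e) (gsq_pv g)]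
      refine (B.mul_congr (gsq_comm f) rfl _).trans ?_
      refine Eq.trans ?_ (B.mul_congr rfl (gsq_comm g) ?_)
      · refine (B.mul_assoc _ _ _ (gsq_pv f) (by rw [e, gsq_uq])).trans ?_
        exact B.mul_congr rfl (B.mul_congr e rfl _) _)

variable (B)

/-- The map of identity squares `u ≫ id = id ≫ u`. -/
def sqI : B.obj₁ ⟶ B.sq :=
  sqLift (𝟙 _) (B.t ≫ B.i) (B.s ≫ B.i) (𝟙 _)
    (by rw [Category.assoc, B.i_s, Category.comp_id, Category.id_comp])
    (by rw [Category.assoc, B.i_t, Category.comp_id, Category.id_comp])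
    ((B.mul_id _ _ (Category.id_comp _)).trans (B.id_mul _ _ (Category.id_comp _)).symm)

/-- The internal category of arrows, with generalized elements. -/
def arrData : InternalCatData V where
  obj₀ := B.obj₁
  obj₁ := B.sq
  s := B.sqU
  t := B.sqV
  i := B.sqI
  m f g e := sqMul f g e
  comp_m z f g e := by
    apply sq_ext
    · rw [Category.assoc, sqMul, sqMul, sqLift_U, sqLift_U, Category.assoc]
    · rw [Category.assoc, sqMul, sqMul, sqLift_Q, sqLift_Q, comp_mul]
      exact B.mul_congr (Category.assoc _ _ _).symm (Category.assoc _ _ _).symm _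
    · rw [Category.assoc, sqMul, sqMul, sqLift_P, sqLift_P, comp_mul]
      exact B.mul_congr (Category.assoc _ _ _).symm (Category.assoc _ _ _).symm _
    · rw [Category.assoc, sqMul, sqMul, sqLift_V, sqLift_V, Category.assoc]
  i_s := sqLift_U _ _ _ _ _ _ _
  i_t := sqLift_V _ _ _ _ _ _ _
  m_s _ _ _ := sqLift_U _ _ _ _ _ _ _
  m_t _ _ _ := sqLift_V _ _ _ _ _ _ _
  id_m f := by
    apply sq_ext
    · rw [sqMul, sqLift_U, Category.assoc, sqI, sqLift_U, Category.comp_id]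
    · rw [sqMul, sqLift_Q]
      refine (B.mul_congr ?_ rfl _).trans (B.id_mul (f ≫ B.sqQ) _ rfl)
      rw [Category.assoc, sqI, sqLift_Q, ← Category.assoc, gsq_uq]
    · rw [sqMul, sqLift_P]
      refine (B.mul_congr ?_ rfl _).trans (B.id_mul (f ≫ B.sqP) _ rfl)
      rw [Category.assoc, sqI, sqLift_P, ← Category.assoc, sq_ps]
    · rw [sqMul, sqLift_V]
  m_id f := by
    apply sq_ext
    · rw [sqMul, sqLift_U]
    · rw [sqMul, sqLift_Q]
      refine (B.mul_congr rfl ?_ _).trans (B.mul_id (f ≫ B.sqQ) _ rfl)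
      rw [Category.assoc, sqI, sqLift_Q, ← Category.assoc, sq_qt]
    · rw [sqMul, sqLift_P]
      refine (B.mul_congr rfl ?_ _).trans (B.mul_id (f ≫ B.sqP) _ rfl)
      rw [Category.assoc, sqI, sqLift_P, ← Category.assoc, gsq_pv]
    · rw [sqMul, sqLift_V, Category.assoc, sqI, sqLift_V, Category.comp_id]
  m_assoc f g h e e' := by
    apply sq_ext
    · simp only [sqMul, sqLift_U]
    · simp only [sqMul, sqLift_Q]
      exact B.mul_assoc _ _ _ _ _
    · simp only [sqMul, sqLift_P]
      exact B.mul_assoc _ _ _ _ _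
    · simp only [sqMul, sqLift_V]

/-- The internal category `⟦𝟚, B⟧` of arrows and commutative squares. -/
def arr : InternalCat V := B.arrData.toInternalCat

/-- The internal functor `⟦𝟚, B⟧ ⥤ B` taking sources of arrows. -/
def dom : B.arr ⟶ B where
  map₀ := B.s
  map₁ := B.sqP
  map_s := by
    have h := sq_ps (𝟙 B.sq)
    rwa [Category.id_comp, Category.id_comp] at h
  map_t := B.sq_pv
  map_i := sqLift_P _ _ _ _ _ _ _
  map_mul f g e := (congrArg (· ≫ B.sqP) (B.arrData.mul_eq f g e)).trans (sqLift_P _ _ _ _ _ _ _)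

/-- The internal functor `⟦𝟚, B⟧ ⥤ B` taking targets of arrows. -/
def cod : B.arr ⟶ B where
  map₀ := B.t
  map₁ := B.sqQ
  map_s := B.sq_uq.symm
  map_t := by
    have h := sq_qt (𝟙 B.sq)
    rwa [Category.id_comp, Category.id_comp] at h
  map_i := sqLift_Q _ _ _ _ _ _ _
  map_mul f g e := (congrArg (· ≫ B.sqQ) (B.arrData.mul_eq f g e)).trans (sqLift_Q _ _ _ _ _ _ _)

end Arrow

end InternalCat

end Internal

/-! #### Products, comma and slice internal categories, internal terminal objects -/

section Comma

variable {V : Type u} [Category.{v} V] [CartesianMonoidalCategory V] [HasPullbacks V]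

namespace InternalCat

/-- The internal functor to the terminal internal category. -/
def toTerminal (A : InternalCat V) : A ⟶ cst (𝟙_ V) where
  map₀ := toUnit _
  map₁ := toUnit _
  map_s := toUnit_unique _ _
  map_t := toUnit_unique _ _
  map_i := toUnit_unique _ _
  map_mul _ _ _ := toUnit_unique _ _

theorem toTerminal_unique {A : InternalCat V} (F G : A ⟶ cst (𝟙_ V)) : F = G :=
  hom_ext (toUnit_unique _ _) (toUnit_unique _ _)

/-- The product of internal categories, the pullback over the terminal internal category. -/
def prod (A B : InternalCat V) : InternalCat V := pb A.toTerminal B.toTerminal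

/-- The internal functor into the product induced by two internal functors. -/
def pair {D A B : InternalCat V} (F : D ⟶ A) (G : D ⟶ B) : D ⟶ prod A B :=
  pbLift F G (toTerminal_unique _ _)

/-- The internal functor `⟨0, 1⟩^* : ⟦𝟚, B⟧ ⥤ B × B` taking an arrow to its source and target. -/
def ends (B : InternalCat V) : B.arr ⟶ prod B B := pair B.dom B.cod

/-- The internal functor `A ⥤ B` that is constant at an element `b` of `B`. -/
def const (A B : InternalCat V) (b : 𝟙_ V ⟶ B.obj₀) : A ⟶ B := A.toTerminal ≫ B.ofCst b

/-- The comma internal category `H ↓ b`: the pullback of `⟨0, 1⟩^* : ⟦𝟚, B⟧ ⥤ B × B` along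
`H × b : A ⥤ B × B`. -/
def comma {A B : InternalCat V} (H : A ⟶ B) (b : 𝟙_ V ⟶ B.obj₀) : InternalCat V :=
  pb (pair H (const A B b)) (ends B)

/-- The projection `H ↓ b ⥤ A`. -/
def commaProj {A B : InternalCat V} (H : A ⟶ B) (b : 𝟙_ V ⟶ B.obj₀) : comma H b ⟶ A :=
  pbFst _ _

/-- The slice internal category `A / T` at an element `T` of `A`. -/
def slice (A : InternalCat V) (T : 𝟙_ V ⟶ A.obj₀) : InternalCat V := comma (𝟙 A) T

/-- The projection `A / T ⥤ A`. -/
def sliceProj (A : InternalCat V) (T : 𝟙_ V ⟶ A.obj₀) : slice A T ⟶ A := commaProj (𝟙 A) T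

/-- An element `T` of `A` is an internal terminal object if `A / T ⥤ A` is an isomorphism of
internal categories. -/
def IsInternalTerminal (A : InternalCat V) (T : 𝟙_ V ⟶ A.obj₀) : Prop := IsIso (sliceProj A T)

/-- The element of a comma internal category `H ↓ b` given by an element `a` of `A` and an
element `f` of the object of arrows of `B` from `H a` to `b`. -/
def commaElement {A B : InternalCat V} (H : A ⟶ B) (b : 𝟙_ V ⟶ B.obj₀) (a : 𝟙_ V ⟶ A.obj₀)
    (f : 𝟙_ V ⟶ B.obj₁) (hs : f ≫ B.s = a ≫ H.map₀) (ht : f ≫ B.t = b) :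
    𝟙_ V ⟶ (comma H b).obj₀ :=
  pullback.lift a f (by
    apply pullback.hom_ext
    · refine (Category.assoc _ _ _).trans ((congrArg (a ≫ ·) (pullback.lift_fst _ _ _)).trans ?_)
      refine Eq.trans ?_ ((Category.assoc _ _ _).trans
        (congrArg (f ≫ ·) (pullback.lift_fst _ _ _))).symm
      exact hs.symm
    · refine (Category.assoc _ _ _).trans ((congrArg (a ≫ ·) (pullback.lift_snd _ _ _)).trans ?_)
      refine Eq.trans ?_ ((Category.assoc _ _ _).trans
        (congrArg (f ≫ ·) (pullback.lift_snd _ _ _))).symm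
      refine Eq.trans ?_ ht.symm
      refine (Category.assoc _ _ _).symm.trans ?_
      refine (congrArg (· ≫ b) (toUnit_unique (a ≫ toUnit _) (𝟙 _))).trans ?_
      exact Category.id_comp _)

/-! #### Internal homs out of constant internal categories -/

section Cotensor

variable [MonoidalClosed V] (X : V) (A : InternalCat V)

variable {A} in
theorem uncurry_map {Z M O : V} (f : Z ⟶ (ihom X).obj M) (k : M ⟶ O) :
    uncurry (f ≫ (ihom X).map k) = uncurry f ≫ k :=
  MonoidalClosed.uncurry_natural_right f k

variable {X A} in
theorem uncurry_composable {Z : V} {f g : Z ⟶ (ihom X).obj A.obj₁}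
    (e : f ≫ (ihom X).map A.t = g ≫ (ihom X).map A.s) : uncurry f ≫ A.t = uncurry g ≫ A.s := by
  rw [← uncurry_map, e, uncurry_map]

/-- The internal category `⟦cst X, A⟧`, with generalized elements. -/
def cotensorData : InternalCatData V where
  obj₀ := (ihom X).obj A.obj₀
  obj₁ := (ihom X).obj A.obj₁
  s := (ihom X).map A.s
  t := (ihom X).map A.t
  i := (ihom X).map A.i
  m f g e := curry (A.mul (uncurry f) (uncurry g) (uncurry_composable e))
  comp_m z f g e := by
    rw [← MonoidalClosed.curry_natural_left, comp_mul]
    congr 1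
    exact A.mul_congr (MonoidalClosed.uncurry_natural_left z f).symm
      (MonoidalClosed.uncurry_natural_left z g).symm _
  i_s := by rw [← Functor.map_comp, A.i_s, CategoryTheory.Functor.map_id]
  i_t := by rw [← Functor.map_comp, A.i_t, CategoryTheory.Functor.map_id]
  m_s f g e := by
    apply MonoidalClosed.uncurry_injective
    rw [uncurry_map, uncurry_map, MonoidalClosed.uncurry_curry, mul_s]
  m_t f g e := by
    apply MonoidalClosed.uncurry_injective
    rw [uncurry_map, uncurry_map, MonoidalClosed.uncurry_curry, mul_t]
  id_m f := by
    apply MonoidalClosed.uncurry_injective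
    rw [MonoidalClosed.uncurry_curry]
    refine (A.mul_congr ?_ rfl _).trans (A.id_mul _ _ rfl)
    rw [uncurry_map, uncurry_map]
  m_id f := by
    apply MonoidalClosed.uncurry_injective
    rw [MonoidalClosed.uncurry_curry]
    refine (A.mul_congr rfl ?_ _).trans (A.mul_id _ _ rfl)
    rw [uncurry_map, uncurry_map]
  m_assoc f g h e e' := by
    congr 1
    simp only [MonoidalClosed.uncurry_curry]
    exact A.mul_assoc _ _ _ _ _

/-- The internal category `⟦cst X, A⟧`; it is given levelwise by `[X, A₀]` and `[X, A₁]`. -/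
def cotensor : InternalCat V := (cotensorData X A).toInternalCat

/-- The internal functor `!^* : A ⥤ ⟦cst X, A⟧` of constant families. -/
def diag : A ⟶ cotensor X A where
  map₀ := curry (snd X A.obj₀)
  map₁ := curry (snd X A.obj₁)
  map_s := by
    apply MonoidalClosed.uncurry_injective
    refine (uncurry_map _ _ _).trans ?_
    refine Eq.trans ?_ (MonoidalClosed.uncurry_natural_left _ _).symm
    rw [MonoidalClosed.uncurry_curry, MonoidalClosed.uncurry_curry, whiskerLeft_snd]
  map_t := by
    apply MonoidalClosed.uncurry_injective
    refine (uncurry_map _ _ _).trans ?_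
    refine Eq.trans ?_ (MonoidalClosed.uncurry_natural_left _ _).symm
    rw [MonoidalClosed.uncurry_curry, MonoidalClosed.uncurry_curry, whiskerLeft_snd]
  map_i := by
    apply MonoidalClosed.uncurry_injective
    refine Eq.trans ?_ (uncurry_map _ _ _).symm
    refine (MonoidalClosed.uncurry_natural_left _ _).trans ?_
    rw [MonoidalClosed.uncurry_curry, MonoidalClosed.uncurry_curry, whiskerLeft_snd]
  map_mul {Z} f g e := by
    have h (k : Z ⟶ A.obj₁) : uncurry (k ≫ curry (snd X A.obj₁)) = snd X Z ≫ k := by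
      rw [MonoidalClosed.uncurry_natural_left, MonoidalClosed.uncurry_curry, whiskerLeft_snd]
    have e' : (f ≫ curry (snd X A.obj₁)) ≫ (ihom X).map A.t =
        (g ≫ curry (snd X A.obj₁)) ≫ (ihom X).map A.s := by
      apply MonoidalClosed.uncurry_injective
      rw [uncurry_map, uncurry_map, h, h, Category.assoc, e, Category.assoc]
    refine Eq.trans ?_ ((cotensorData X A).mul_eq _ _ e').symm
    apply MonoidalClosed.uncurry_injective
    refine (h _).trans (Eq.trans ?_ (MonoidalClosed.uncurry_curry _).symm)
    rw [comp_mul]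
    exact A.mul_congr (h f).symm (h g).symm _

/-- The element of `⟦cst X, A⟧` that is constant at an element `T` of `A`. -/
def constElement (T : 𝟙_ V ⟶ A.obj₀) : 𝟙_ V ⟶ (cotensor X A).obj₀ := T ≫ (diag X A).map₀

end Cotensor

end InternalCat

/-! ### The underlying `V`-category of an internal category -/

/-- The objects of the underlying `V`-category of an internal category `A`: the elements of
`A`. -/
structure Und (A : InternalCat V) where
  elt : 𝟙_ V ⟶ A.obj₀

namespace Und

variable {A : InternalCat V}

/-- The hom-object from `a` to `b`: the pullback of `(s, t) : A₁ ⟶ A₀ × A₀` along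
`(a, b) : 1 ⟶ A₀ × A₀`. -/
def hom (a b : Und A) : V := pullback (lift a.elt b.elt) (lift A.s A.t)

/-- The map from the hom-object to the object of arrows. -/
def π (a b : Und A) : hom a b ⟶ A.obj₁ := pullback.snd _ _

theorem π_s (a b : Und A) : π a b ≫ A.s = toUnit _ ≫ a.elt := by
  have h := pullback.condition (f := lift a.elt b.elt) (g := lift A.s A.t) =≫ fst _ _
  rw [Category.assoc, Category.assoc, lift_fst, lift_fst] at h
  refine h.symm.trans ?_
  congr 1
  exact toUnit_unique _ _

theorem π_t (a b : Und A) : π a b ≫ A.t = toUnit _ ≫ b.elt := by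
  have h := pullback.condition (f := lift a.elt b.elt) (g := lift A.s A.t) =≫ snd _ _
  rw [Category.assoc, Category.assoc, lift_snd, lift_snd] at h
  refine h.symm.trans ?_
  congr 1
  exact toUnit_unique _ _

/-- The generalized element of a hom-object given by a generalized arrow. -/
def mk' {a b : Und A} {Z : V} (f : Z ⟶ A.obj₁) (hs : f ≫ A.s = toUnit _ ≫ a.elt)
    (ht : f ≫ A.t = toUnit _ ≫ b.elt) : Z ⟶ hom a b :=
  pullback.lift (toUnit _) f (by rw [comp_lift, comp_lift, hs, ht])

theorem mk'_π {a b : Und A} {Z : V} (f : Z ⟶ A.obj₁) (hs : f ≫ A.s = toUnit _ ≫ a.elt)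
    (ht : f ≫ A.t = toUnit _ ≫ b.elt) : mk' f hs ht ≫ π a b = f :=
  pullback.lift_snd _ _ _

theorem hom_ext {a b : Und A} {Z : V} {f g : Z ⟶ hom a b} (h : f ≫ π a b = g ≫ π a b) : f = g :=
  pullback.hom_ext (toUnit_unique _ _) h

theorem comp_π_s {a b : Und A} {Z : V} (f : Z ⟶ hom a b) :
    (f ≫ π a b) ≫ A.s = toUnit _ ≫ a.elt := by
  rw [Category.assoc, π_s, ← Category.assoc, comp_toUnit]

theorem comp_π_t {a b : Und A} {Z : V} (f : Z ⟶ hom a b) :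
    (f ≫ π a b) ≫ A.t = toUnit _ ≫ b.elt := by
  rw [Category.assoc, π_t, ← Category.assoc, comp_toUnit]

theorem composable {a b c : Und A} {Z : V} (f : Z ⟶ hom a b) (g : Z ⟶ hom b c) :
    (f ≫ π a b) ≫ A.t = (g ≫ π b c) ≫ A.s := by
  rw [comp_π_t, comp_π_s]

/-- Identities in the underlying `V`-category. -/
def one (a : Und A) : 𝟙_ V ⟶ hom a a :=
  mk' (a.elt ≫ A.i)
    (by rw [Category.assoc, A.i_s, Category.comp_id, toUnit_unique (toUnit _) (𝟙 _),
      Category.id_comp])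
    (by rw [Category.assoc, A.i_t, Category.comp_id, toUnit_unique (toUnit _) (𝟙 _),
      Category.id_comp])

/-- Composition in the underlying `V`-category, induced by the composition of `A`. -/
def comp (a b c : Und A) : hom a b ⊗ hom b c ⟶ hom a c :=
  mk' (A.mul (fst _ _ ≫ π a b) (snd _ _ ≫ π b c) (composable _ _))
    (by rw [A.mul_s, comp_π_s]) (by rw [A.mul_t, comp_π_t])

theorem one_π (a : Und A) : one a ≫ π a a = a.elt ≫ A.i := mk'_π _ _ _

theorem comp_π {a b c : Und A} {Z : V} (f : Z ⟶ hom a b) (g : Z ⟶ hom b c) :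
    (lift f g ≫ comp a b c) ≫ π a c = A.mul (f ≫ π a b) (g ≫ π b c) (composable f g) := by
  rw [Category.assoc, comp, mk'_π, A.comp_mul]
  apply A.mul_congr
  · rw [lift_fst_assoc]
  · rw [lift_snd_assoc]

/-- The underlying `V`-category of an internal category. -/
instance enriched (A : InternalCat V) : EnrichedCategory V (Und A) :=
  enrichedOfElements hom one comp
    (by
      intro a b
      apply hom_ext
      rw [comp_π]
      refine (A.mul_congr ?_ rfl _).trans (A.id_mul (𝟙 (hom a b) ≫ π a b) _ rfl)
      rw [Category.assoc, one_π, comp_π_s, Category.assoc])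
    (by
      intro a b
      apply hom_ext
      rw [comp_π]
      refine (A.mul_congr rfl ?_ _).trans (A.mul_id (𝟙 (hom a b) ≫ π a b) _ rfl)
      rw [Category.assoc, one_π, comp_π_t, Category.assoc])
    (by
      intro a b c d Z f g h
      apply hom_ext
      refine (comp_π _ _).trans (Eq.trans ?_ (comp_π _ _).symm)
      refine (A.mul_congr (comp_π f g) rfl _).trans ?_
      refine (A.mul_assoc _ _ _ (composable f g) (composable g h)).trans ?_
      exact A.mul_congr rfl (comp_π g h).symm _)

end Und

/-- An object `T` of a `V`-category `C` is `V`-terminal if `C(A, T) ⟶ 1` is an isomorphism for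
every object `A` of `C`. -/
def IsVTerminal (V : Type u) [Category.{v} V] [CartesianMonoidalCategory V] {C : Type u₁}
    [EnrichedCategory V C] (T : C) : Prop :=
  ∀ A : C, IsIso (toUnit (A ⟶[V] T))

end Comma

/-- A family of objects is conservative if a map `f` is an isomorphism if and only if
post-composition with `f` is bijective on maps out of each member of the family. -/
def IsConservative {V : Type u} [Category.{v} V] (𝒢 : Set V) : Prop :=
  ∀ {Y Z : V} (f : Y ⟶ Z),
    IsIso f ↔ ∀ X ∈ 𝒢, Function.Bijective fun g : X ⟶ Y => g ≫ f

/-! ### The internal category associated with a small `V`-category -/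

section Int

variable (V : Type u) [Category.{v} V] [CartesianMonoidalCategory V] [HasPullbacks V]
  [IsExtensive.{w} V] (C : Type w) [EnrichedCategory V C]

/-- The object of objects `∐ 1`, indexed by the objects of `C`. -/
def intObj : V := ∐ fun _ : C => 𝟙_ V

/-- The object of arrows `∐ C(A, B)`, indexed by the pairs of objects of `C`. -/
def intHom : V := ∐ fun p : C × C => (p.1 ⟶[V] p.2)

variable {C}

/-- The element of the object of objects given by an object of `C`. -/
def intι₀ (A : C) : 𝟙_ V ⟶ intObj V C := Limits.Sigma.ι (fun _ : C => 𝟙_ V) A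

/-- The inclusion of a hom-object into the object of arrows. -/
def intι₁ (A B : C) : (A ⟶[V] B) ⟶ intHom V C :=
  Limits.Sigma.ι (fun p : C × C => (p.1 ⟶[V] p.2)) (A, B)

variable (C)

/-- The source map; on `C(A, B)` it is `C(A, B) ⟶ 1 ⟶ ∐ 1`, the inclusion at `A`. -/
def intS : intHom V C ⟶ intObj V C := Limits.Sigma.desc fun p => toUnit _ ≫ intι₀ V p.1

/-- The target map; on `C(A, B)` it is `C(A, B) ⟶ 1 ⟶ ∐ 1`, the inclusion at `B`. -/
def intT : intHom V C ⟶ intObj V C := Limits.Sigma.desc fun p => toUnit _ ≫ intι₀ V p.2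

/-- The identity map, given by the identities of `C`. -/
def intI : intObj V C ⟶ intHom V C := Limits.Sigma.desc fun A => eId V A ≫ intι₁ V A A

variable {V C}

theorem intι₁_s (A B : C) : intι₁ V A B ≫ intS V C = toUnit _ ≫ intι₀ V A :=
  Limits.Sigma.ι_desc _ _

theorem intι₁_t (A B : C) : intι₁ V A B ≫ intT V C = toUnit _ ≫ intι₀ V B :=
  Limits.Sigma.ι_desc _ _

theorem intι₀_i (A : C) : intι₀ V A ≫ intI V C = eId V A ≫ intι₁ V A A :=
  Limits.Sigma.ι_desc _ _

theorem comp_intι₁_s {A B : C} {Z : V} (f : Z ⟶ (A ⟶[V] B)) :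
    (f ≫ intι₁ V A B) ≫ intS V C = toUnit _ ≫ intι₀ V A := by
  rw [Category.assoc, intι₁_s, ← Category.assoc, comp_toUnit]

theorem comp_intι₁_t {A B : C} {Z : V} (f : Z ⟶ (A ⟶[V] B)) :
    (f ≫ intι₁ V A B) ≫ intT V C = toUnit _ ≫ intι₀ V B := by
  rw [Category.assoc, intι₁_t, ← Category.assoc, comp_toUnit]

theorem int_composable {A B D : C} {Z : V} (f : Z ⟶ (A ⟶[V] B)) (g : Z ⟶ (B ⟶[V] D)) :
    (f ≫ intι₁ V A B) ≫ intT V C = (g ≫ intι₁ V B D) ≫ intS V C := by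
  rw [comp_intι₁_t, comp_intι₁_s]

theorem toUnit_intι₀_i {A : C} {Z : V} :
    (toUnit Z ≫ intι₀ V A) ≫ intI V C = eOne Z A ≫ intι₁ V A A := by
  rw [Category.assoc, intι₀_i, eOne, Category.assoc]

/-- Maps out of an object with a generalized arrow are determined on the parts on which the
arrow lies in a hom-object. -/
theorem int_ext₁ {Z Q : V} (f : Z ⟶ intHom V C) {a b : Z ⟶ Q}
    (h : ∀ (A B : C) {T : V} (z : T ⟶ Z) (f' : T ⟶ (A ⟶[V] B)), z ≫ f = f' ≫ intι₁ V A B →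
      z ≫ a = z ≫ b) : a = b :=
  cover_ext (X := fun p : C × C => (p.1 ⟶[V] p.2)) f fun p _ z f' e => h p.1 p.2 z f' e

/-- The relation "`k` is the composite of `f` and `g`" for generalized arrows. -/
def IsComp {Z : V} (f g k : Z ⟶ intHom V C) : Prop :=
  ∀ (A B D : C) {T : V} (z : T ⟶ Z) (f' : T ⟶ (A ⟶[V] B)) (g' : T ⟶ (B ⟶[V] D)),
    z ≫ f = f' ≫ intι₁ V A B → z ≫ g = g' ≫ intι₁ V B D → z ≫ k = eMul f' g' ≫ intι₁ V A D

/-- Generalized objects lying in two summands: the summands agree or the stage is initial. -/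
theorem int_eq_or {Z : V} {A B : C}
    (h : toUnit Z ≫ intι₀ V A = toUnit Z ≫ intι₀ V B) :
    A = B ∨ ∀ (Q : V) (a b : Z ⟶ Q), a = b := by
  by_cases hAB : A = B
  · exact Or.inl hAB
  · refine Or.inr fun Q a b => ?_
    obtain ⟨u⟩ := sigma_disjoint (fun _ : C => 𝟙_ V) hAB (toUnit Z) (toUnit Z) h Q
    exact (u.uniq a).trans (u.uniq b).symm

theorem int_middle {Z : V} {f g : Z ⟶ intHom V C} (e : f ≫ intT V C = g ≫ intS V C)
    {A B B' D : C} {T : V} (z : T ⟶ Z) (f' : T ⟶ (A ⟶[V] B)) (g' : T ⟶ (B' ⟶[V] D))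
    (hf : z ≫ f = f' ≫ intι₁ V A B) (hg : z ≫ g = g' ≫ intι₁ V B' D) :
    B = B' ∨ ∀ (Q : V) (a b : T ⟶ Q), a = b := by
  apply int_eq_or
  rw [← comp_intι₁_t f', ← hf, ← comp_intι₁_s g', ← hg, Category.assoc, e, Category.assoc]

/-- Maps out of an object with two composable generalized arrows are determined on the parts on
which the arrows lie in hom-objects. -/
theorem int_ext₂ {Z Q : V} (f g : Z ⟶ intHom V C) (e : f ≫ intT V C = g ≫ intS V C)
    {a b : Z ⟶ Q}
    (h : ∀ (A B D : C) {T : V} (z : T ⟶ Z) (f' : T ⟶ (A ⟶[V] B)) (g' : T ⟶ (B ⟶[V] D)),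
      z ≫ f = f' ≫ intι₁ V A B → z ≫ g = g' ≫ intι₁ V B D → z ≫ a = z ≫ b) : a = b := by
  apply int_ext₁ f
  intro A B T z f' hf
  apply int_ext₁ (z ≫ g)
  intro B' D S y g' hg
  rw [← Category.assoc] at hg
  have hf' : (y ≫ z) ≫ f = (y ≫ f') ≫ intι₁ V A B := by rw [Category.assoc, hf, Category.assoc]
  rw [← Category.assoc, ← Category.assoc]
  obtain rfl | hS := int_middle e (y ≫ z) (y ≫ f') g' hf' hg
  · exact h A B D (y ≫ z) (y ≫ f') g' hf' hg
  · exact hS _ _ _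

theorem IsComp.unique {Z : V} {f g k k' : Z ⟶ intHom V C} (e : f ≫ intT V C = g ≫ intS V C)
    (hk : IsComp f g k) (hk' : IsComp f g k') : k = k' :=
  int_ext₂ f g e fun A B D _ z f' g' hf hg =>
    (hk A B D z f' g' hf hg).trans (hk' A B D z f' g' hf hg).symm

theorem IsComp.precomp {T Z : V} {f g k : Z ⟶ intHom V C} (h : IsComp f g k) (z : T ⟶ Z) :
    IsComp (z ≫ f) (z ≫ g) (z ≫ k) := by
  intro A B D S y f' g' hf hg
  rw [← Category.assoc] at hf hg ⊢
  exact h A B D (y ≫ z) f' g' hf hg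

theorem intι₁_eq_or {Z : V} {A B A' B' : C} (f : Z ⟶ (A ⟶[V] B)) (f' : Z ⟶ (A' ⟶[V] B'))
    (h : f ≫ intι₁ V A B = f' ≫ intι₁ V A' B') :
    (A = A' ∧ B = B') ∨ ∀ (Q : V) (a b : Z ⟶ Q), a = b := by
  by_cases hp : ((A, B) : C × C) = (A', B')
  · exact Or.inl (Prod.mk.inj hp)
  · refine Or.inr fun Q a b => ?_
    obtain ⟨u⟩ := sigma_disjoint (fun p : C × C => (p.1 ⟶[V] p.2)) hp f f' h Q
    exact (u.uniq a).trans (u.uniq b).symm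

theorem intι₁_cancel {Z : V} {A B : C} {f f' : Z ⟶ (A ⟶[V] B)}
    (h : f ≫ intι₁ V A B = f' ≫ intι₁ V A B) : f = f' :=
  (cancel_mono (Limits.Sigma.ι (fun p : C × C => (p.1 ⟶[V] p.2)) (A, B))).1 h

theorem isComp_of {Z : V} {A B D : C} (f : Z ⟶ (A ⟶[V] B)) (g : Z ⟶ (B ⟶[V] D)) :
    IsComp (f ≫ intι₁ V A B) (g ≫ intι₁ V B D) (eMul f g ≫ intι₁ V A D) := by
  intro A' B' D' T z f' g' hf hg
  rw [← Category.assoc] at hf hg ⊢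
  obtain ⟨rfl, rfl⟩ | h := intι₁_eq_or _ _ hf
  · obtain ⟨_, rfl⟩ | h := intι₁_eq_or _ _ hg
    · rw [comp_eMul, intι₁_cancel hf, intι₁_cancel hg]
    · exact h _ _ _
  · exact h _ _ _

theorem exists_isComp₁ {A B : C} {Z : V} (f : Z ⟶ (A ⟶[V] B)) (g : Z ⟶ intHom V C)
    (e : (f ≫ intι₁ V A B) ≫ intT V C = g ≫ intS V C) : ∃ k, IsComp (f ≫ intι₁ V A B) g k := by
  have ex (p : C × C) {S : V} (z : S ⟶ Z) (g' : S ⟶ (p.1 ⟶[V] p.2))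
      (hg : z ≫ g = g' ≫ intι₁ V p.1 p.2) :
      ∃ k, IsComp (z ≫ f ≫ intι₁ V A B) (z ≫ g) k := by
    obtain ⟨B', D⟩ := p
    by_cases hB : B = B'
    · subst hB
      rw [← Category.assoc, hg]
      exact ⟨_, isComp_of (z ≫ f) g'⟩
    · refine ⟨z ≫ f ≫ intι₁ V A B, ?_⟩
      intro A' B'' D' R y f' g'' _ _
      have hR := int_middle e (y ≫ z) ((y ≫ z) ≫ f) (y ≫ g') (Category.assoc _ _ _).symm
        (by rw [Category.assoc, hg, Category.assoc])
      obtain h | hR := hR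
      · exact absurd h hB
      · exact hR _ _ _
  choose m hm using @ex
  have e' {S : V} (z : S ⟶ Z) : (z ≫ f ≫ intι₁ V A B) ≫ intT V C = (z ≫ g) ≫ intS V C := by
    rw [Category.assoc, e, Category.assoc]
  obtain ⟨c, hc⟩ := cover_glue (X := fun p : C × C => (p.1 ⟶[V] p.2)) g
    (fun p _ z g' h => m p z g' h) (by
      intro p S T y z g' h
      have h' : z ≫ g = g' ≫ intι₁ V p.1 p.2 := h
      have hy : (y ≫ z) ≫ g = (y ≫ g') ≫ intι₁ V p.1 p.2 := by
        rw [Category.assoc, h', Category.assoc]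
      refine IsComp.unique (e' (y ≫ z)) ?_ (hm p (y ≫ z) (y ≫ g') hy)
      have := (hm p z g' h).precomp y
      rwa [← Category.assoc y z g, ← Category.assoc y z (f ≫ _)] at this)
  refine ⟨c, ?_⟩
  intro A' B' D T z f' g' hf hg
  rw [hc (B', D) z g' hg]
  have := hm (B', D) z g' hg A' B' D (𝟙 T) f' g' (by rw [Category.id_comp, hf])
    (by rw [Category.id_comp, hg])
  rwa [Category.id_comp] at this

/-- Composable generalized arrows have a composite. -/
theorem exists_isComp {Z : V} (f g : Z ⟶ intHom V C) (e : f ≫ intT V C = g ≫ intS V C) :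
    ∃ k, IsComp f g k := by
  have e' {S : V} (z : S ⟶ Z) : (z ≫ f) ≫ intT V C = (z ≫ g) ≫ intS V C := by
    rw [Category.assoc, e, Category.assoc]
  have ex (p : C × C) {S : V} (z : S ⟶ Z) (f' : S ⟶ (p.1 ⟶[V] p.2))
      (hf : z ≫ f = f' ≫ intι₁ V p.1 p.2) : ∃ k, IsComp (z ≫ f) (z ≫ g) k := by
    have h := e' z
    rw [hf] at h ⊢
    exact exists_isComp₁ f' (z ≫ g) h
  choose m hm using @ex
  obtain ⟨c, hc⟩ := cover_glue (X := fun p : C × C => (p.1 ⟶[V] p.2)) f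
    (fun p _ z f' h => m p z f' h) (by
      intro p S T y z f' h
      have h' : z ≫ f = f' ≫ intι₁ V p.1 p.2 := h
      have hy : (y ≫ z) ≫ f = (y ≫ f') ≫ intι₁ V p.1 p.2 := by
        rw [Category.assoc, h', Category.assoc]
      refine IsComp.unique (e' (y ≫ z)) ?_ (hm p (y ≫ z) (y ≫ f') hy)
      have := (hm p z f' h).precomp y
      rwa [← Category.assoc, ← Category.assoc] at this)
  refine ⟨c, ?_⟩
  intro A B D T z f' g' hf hg
  rw [hc (A, B) z f' hf]
  have := hm (A, B) z f' hf A B D (𝟙 T) f' g' (by rw [Category.id_comp, hf])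
    (by rw [Category.id_comp, hg])
  rwa [Category.id_comp] at this

/-- The composite of composable generalized arrows: the unique one satisfying `IsComp`. -/
def intMul {Z : V} (f g : Z ⟶ intHom V C) (e : f ≫ intT V C = g ≫ intS V C) : Z ⟶ intHom V C :=
  (exists_isComp f g e).choose

theorem intMul_isComp {Z : V} (f g : Z ⟶ intHom V C) (e : f ≫ intT V C = g ≫ intS V C) :
    IsComp f g (intMul f g e) :=
  (exists_isComp f g e).choose_spec

theorem intMul_eq {Z : V} {f g k : Z ⟶ intHom V C} (e : f ≫ intT V C = g ≫ intS V C)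
    (h : IsComp f g k) : intMul f g e = k :=
  IsComp.unique e (intMul_isComp f g e) h

theorem comp_intMul {T Z : V} (z : T ⟶ Z) (f g : Z ⟶ intHom V C)
    (e : f ≫ intT V C = g ≫ intS V C) :
    z ≫ intMul f g e = intMul (z ≫ f) (z ≫ g) (by rw [Category.assoc, e, Category.assoc]) :=
  (intMul_eq _ ((intMul_isComp f g e).precomp z)).symm

/-- On generalized arrows lying in hom-objects, composition is that of `C`. -/
theorem intMul_ι {Z : V} {A B D : C} (f : Z ⟶ (A ⟶[V] B)) (g : Z ⟶ (B ⟶[V] D)) :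
    intMul (f ≫ intι₁ V A B) (g ≫ intι₁ V B D) (int_composable f g) =
      eMul f g ≫ intι₁ V A D :=
  intMul_eq _ (isComp_of f g)

theorem intMul_congr {Z : V} {f f' g g' : Z ⟶ intHom V C} (hf : f = f') (hg : g = g')
    (e : f ≫ intT V C = g ≫ intS V C) :
    intMul f g e = intMul f' g' (by rw [← hf, ← hg, e]) := by
  subst hf hg
  rfl

theorem intMul_s {Z : V} (f g : Z ⟶ intHom V C) (e : f ≫ intT V C = g ≫ intS V C) :
    intMul f g e ≫ intS V C = f ≫ intS V C := by
  apply int_ext₂ f g e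
  intro A B D T z f' g' hf hg
  rw [← Category.assoc, ← Category.assoc, intMul_isComp f g e A B D z f' g' hf hg, hf,
    comp_intι₁_s, comp_intι₁_s]

theorem intMul_t {Z : V} (f g : Z ⟶ intHom V C) (e : f ≫ intT V C = g ≫ intS V C) :
    intMul f g e ≫ intT V C = g ≫ intT V C := by
  apply int_ext₂ f g e
  intro A B D T z f' g' hf hg
  rw [← Category.assoc, ← Category.assoc, intMul_isComp f g e A B D z f' g' hf hg, hg,
    comp_intι₁_t, comp_intι₁_t]

variable (V C)

theorem intI_s : intI V C ≫ intS V C = 𝟙 _ := by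
  apply Limits.Sigma.hom_ext
  intro A
  have h : intι₀ V A ≫ intI V C ≫ intS V C = intι₀ V A ≫ 𝟙 _ := by
    rw [← Category.assoc, intι₀_i, comp_intι₁_s, Category.comp_id,
      toUnit_unique (toUnit (𝟙_ V)) (𝟙 _), Category.id_comp]
  exact h

theorem intI_t : intI V C ≫ intT V C = 𝟙 _ := by
  apply Limits.Sigma.hom_ext
  intro A
  have h : intι₀ V A ≫ intI V C ≫ intT V C = intι₀ V A ≫ 𝟙 _ := by
    rw [← Category.assoc, intι₀_i, comp_intι₁_t, Category.comp_id,
      toUnit_unique (toUnit (𝟙_ V)) (𝟙 _), Category.id_comp]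
  exact h

/-- The internal category associated with a `V`-category, with generalized elements. -/
def intData : InternalCatData V where
  obj₀ := intObj V C
  obj₁ := intHom V C
  s := intS V C
  t := intT V C
  i := intI V C
  m f g e := intMul f g e
  comp_m := comp_intMul
  i_s := intI_s V C
  i_t := intI_t V C
  m_s := intMul_s
  m_t := intMul_t
  id_m f := by
    apply int_ext₁ f
    intro A B T z f' hf
    refine (comp_intMul _ _ _ _).trans ?_
    have h : z ≫ (f ≫ intS V C) ≫ intI V C = eOne T A ≫ intι₁ V A A := by
      rw [← Category.assoc, ← Category.assoc, hf, comp_intι₁_s, toUnit_intι₀_i]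
    refine (intMul_congr h hf _).trans ((intMul_ι _ _).trans ?_)
    rw [eOne_eMul, hf]
  m_id f := by
    apply int_ext₁ f
    intro A B T z f' hf
    refine (comp_intMul _ _ _ _).trans ?_
    have h : z ≫ (f ≫ intT V C) ≫ intI V C = eOne T B ≫ intι₁ V B B := by
      rw [← Category.assoc, ← Category.assoc, hf, comp_intι₁_t, toUnit_intι₀_i]
    refine (intMul_congr hf h _).trans ((intMul_ι _ _).trans ?_)
    rw [eMul_eOne, hf]
  m_assoc f g h e e' := by
    apply int_ext₂ f g e
    intro A B D T z f' g' hf hg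
    apply int_ext₁ (z ≫ h)
    intro D' E S y h' hh
    rw [← Category.assoc] at hh
    have hf' : (y ≫ z) ≫ f = (y ≫ f') ≫ intι₁ V A B := by rw [Category.assoc, hf, Category.assoc]
    have hg' : (y ≫ z) ≫ g = (y ≫ g') ≫ intι₁ V B D := by rw [Category.assoc, hg, Category.assoc]
    rw [← Category.assoc, ← Category.assoc]
    obtain rfl | hS := int_middle e' (y ≫ z) (y ≫ g') h' hg' hh
    · have h₁ : (y ≫ z) ≫ intMul f g e = eMul (y ≫ f') (y ≫ g') ≫ intι₁ V A D :=
        intMul_isComp f g e A B D _ _ _ hf' hg'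
      have h₂ : (y ≫ z) ≫ intMul g h e' = eMul (y ≫ g') h' ≫ intι₁ V B E :=
        intMul_isComp g h e' B D E _ _ _ hg' hh
      refine (intMul_isComp _ _ _ A D E _ _ _ h₁ hh).trans ?_
      refine Eq.trans ?_ (intMul_isComp _ _ _ A B E _ _ _ hf' h₂).symm
      rw [eMul_assoc]
    · exact hS _ _ _

/-- The internal category `Int C` associated with a `V`-category `C`: it has `∐ 1` and
`∐ C(A, B)` as objects of objects and of arrows. -/
def int : InternalCat V := (intData V C).toInternalCat

variable {V C} {D : Type w} [EnrichedCategory V D] (F : EnrichedFunctor V C D)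

/-- The action on objects of the internal functor associated with a `V`-functor. -/
def intMap₀ : intObj V C ⟶ intObj V D := Limits.Sigma.desc fun A => intι₀ V (F.obj A)

/-- The action on arrows of the internal functor associated with a `V`-functor. -/
def intMap₁ : intHom V C ⟶ intHom V D :=
  Limits.Sigma.desc fun p => F.map p.1 p.2 ≫ intι₁ V (F.obj p.1) (F.obj p.2)

theorem intι₀_map (A : C) : intι₀ V A ≫ intMap₀ F = intι₀ V (F.obj A) := Limits.Sigma.ι_desc _ _

theorem intι₁_map (A B : C) :
    intι₁ V A B ≫ intMap₁ F = F.map A B ≫ intι₁ V (F.obj A) (F.obj B) :=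
  Limits.Sigma.ι_desc _ _

theorem int_hom_ext {Q : V} {a b : intHom V C ⟶ Q}
    (h : ∀ A B : C, intι₁ V A B ≫ a = intι₁ V A B ≫ b) : a = b :=
  Limits.Sigma.hom_ext _ _ fun p => h p.1 p.2

theorem int_obj_ext {Q : V} {a b : intObj V C ⟶ Q}
    (h : ∀ A : C, intι₀ V A ≫ a = intι₀ V A ≫ b) : a = b :=
  Limits.Sigma.hom_ext _ _ h

theorem intMap_s : intMap₁ F ≫ intS V D = intS V C ≫ intMap₀ F := by
  apply int_hom_ext
  intro A B
  rw [← Category.assoc, ← Category.assoc, intι₁_map, comp_intι₁_s, intι₁_s, Category.assoc,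
    intι₀_map]

theorem intMap_t : intMap₁ F ≫ intT V D = intT V C ≫ intMap₀ F := by
  apply int_hom_ext
  intro A B
  rw [← Category.assoc, ← Category.assoc, intι₁_map, comp_intι₁_t, intι₁_t, Category.assoc,
    intι₀_map]

theorem intMap_i : intI V C ≫ intMap₁ F = intMap₀ F ≫ intI V D := by
  apply int_obj_ext
  intro A
  rw [← Category.assoc, ← Category.assoc, intι₀_map, intι₀_i, intι₀_i, Category.assoc, intι₁_map,
    ← Category.assoc, EnrichedFunctor.map_id]

theorem intMap_composable {Z : V} {f g : Z ⟶ intHom V C} (e : f ≫ intT V C = g ≫ intS V C) :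
    (f ≫ intMap₁ F) ≫ intT V D = (g ≫ intMap₁ F) ≫ intS V D := by
  rw [Category.assoc, Category.assoc, intMap_s, intMap_t, ← Category.assoc, ← Category.assoc, e]

theorem intMap_mul {Z : V} (f g : Z ⟶ intHom V C) (e : f ≫ intT V C = g ≫ intS V C)
    (e' : (f ≫ intMap₁ F) ≫ intT V D = (g ≫ intMap₁ F) ≫ intS V D) :
    intMul f g e ≫ intMap₁ F = intMul (f ≫ intMap₁ F) (g ≫ intMap₁ F) e' := by
  apply int_ext₂ f g e
  intro A B E T z f' g' hf hg
  have hF {A B : C} (k : Z ⟶ intHom V C) (k' : T ⟶ (A ⟶[V] B)) (hk : z ≫ k = k' ≫ intι₁ V A B) :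
      z ≫ k ≫ intMap₁ F = (k' ≫ F.map A B) ≫ intι₁ V (F.obj A) (F.obj B) := by
    rw [← Category.assoc, hk, Category.assoc, intι₁_map, Category.assoc]
  rw [hF _ _ (intMul_isComp f g e A B E z f' g' hf hg), eMul_map]
  exact (intMul_isComp _ _ e' _ _ _ z _ _ (hF f f' hf) (hF g g' hg)).symm

/-- The internal functor `Int F` associated with a `V`-functor `F`. -/
def intMap : int V C ⟶ int V D where
  map₀ := intMap₀ F
  map₁ := intMap₁ F
  map_s := intMap_s F
  map_t := intMap_t F
  map_i := intMap_i F
  map_mul f g e := by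
    have e' := intMap_composable F e
    exact (congrArg (· ≫ intMap₁ F) ((intData V C).mul_eq f g e)).trans
      ((intMap_mul F f g e e').trans ((intData V D).mul_eq _ _ e').symm)

end Int

/-! ### The internal category of weighted cones -/

section WeightedCones

section FullSub

variable {V : Type u} [Category.{v} V] [CartesianMonoidalCategory V]

/-- The objects of the full sub-`V`-category of `D` on a family of objects. -/
structure FullSub {J : Type w} {D : Type u₁} (φ : J → D) where
  idx : J

/-- The full sub-`V`-category of `D` on a family of objects. -/
instance fullSubEnriched {J : Type w} {D : Type u₁} [EnrichedCategory V D] (φ : J → D) :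
    EnrichedCategory V (FullSub φ) where
  Hom X Y := φ X.idx ⟶[V] φ Y.idx
  id X := eId V (φ X.idx)
  comp X Y Z := eComp V (φ X.idx) (φ Y.idx) (φ Z.idx)
  id_comp X Y := e_id_comp V (φ X.idx) (φ Y.idx)
  comp_id X Y := e_comp_id V (φ X.idx) (φ Y.idx)
  assoc X Y Z T := e_assoc V (φ X.idx) (φ Y.idx) (φ Z.idx) (φ T.idx)

end FullSub

variable {V : Type u} [Category.{v} V] [CartesianMonoidalCategory V] [BraidedCategory V]
  [MonoidalClosed V] [HasPullbacks V] [IsExtensive.{w} V] {I : Type w} [EnrichedCategory V I]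
  {C : Type w} [EnrichedCategory V C] (W : EnrichedFunctor V I V) (G : EnrichedFunctor V I C)

/-- The family consisting of `W` and of the `V`-functors `C(A, G -)`. -/
def coneFamily : Option C → EnrichedFunctor V I V
  | none => W
  | some A => G.comp V (coyo A)

/-- The full sub-`V`-category of `V^I` on `W` and on the `V`-functors `C(A, G -)`. As opposed to
`V^I`, it has a small set of objects, so it has an associated internal category. -/
abbrev ConeCat : Type w := FullSub (coneFamily W G)

/-- The weight `W`, as an object of the opposite of the `V`-category `ConeCat W G`. -/
def weightObj : (ConeCat W G)ᵒᵖ := op ⟨none⟩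

/-- The `V`-functor `C(A, G -)`, as an object of the opposite of `ConeCat W G`. -/
def coneObj (A : C) : (ConeCat W G)ᵒᵖ := op ⟨some A⟩

/-- The `V`-functor `C(-, G)^op : C ⥤ (V^I)^op`. -/
def coneFunctorOp : EnrichedFunctor V C (ConeCat W G)ᵒᵖ :=
  functorOfElements (coneObj W G) (fun A B => (coneFunctor G).map (op B) (op A))
    (fun A => (coneFunctor G).map_id (op A))
    (by
      intro A B D Z f g
      have h₁ : eMul (C := Cᵒᵖ) (X := op D) (Y := op B) (W := op A) g f = eMul (C := C) f g :=
        eMul_op _ _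
      have h₂ := eMul_map (coneFunctor G) (X := op D) (Y := op B) (W := op A) g f
      rw [h₁] at h₂
      refine h₂.trans ?_
      exact (eMul_op (C := ConeCat W G) (X := coneObj W G A) (Y := coneObj W G B)
        (W := coneObj W G D) (f ≫ (coneFunctor G).map (op B) (op A))
        (g ≫ (coneFunctor G).map (op D) (op B))).symm)

/-- The internal category `W ↓ Int C(-, G)` of weighted cones: the comma internal category of
`Int C(-, G)^op : Int C ⥤ Int (V^I)^op` over the object `W`. -/
def weightedCones : InternalCat V :=
  InternalCat.comma (intMap (coneFunctorOp W G)) (intι₀ V (weightObj W G))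

variable {W G}

/-- The element of the object of arrows of `Int (V^I)^op` given by a `V`-natural transformation
`l : W ⟹ C(L, G -)`. -/
def coneArrow {L : C} (l : VNatTrans W (G.comp V (coyo L))) : 𝟙_ V ⟶ intHom V (ConeCat W G)ᵒᵖ :=
  (show 𝟙_ V ⟶ (coneObj W G L ⟶[V] weightObj W G) from l.toHom) ≫
    intι₁ V (coneObj W G L) (weightObj W G)

/-- The element of the internal category of weighted cones given by a pair `(L, l)` of an object
`L` and a `V`-natural transformation `l : W ⟹ C(L, G -)`. -/
def coneElement (L : C) (l : VNatTrans W (G.comp V (coyo L))) :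
    𝟙_ V ⟶ (weightedCones W G).obj₀ :=
  InternalCat.commaElement (intMap (coneFunctorOp W G)) (intι₀ V (weightObj W G)) (intι₀ V L)
    (coneArrow l)
    ((comp_intι₁_s _).trans (by
      rw [toUnit_unique (toUnit (𝟙_ V)) (𝟙 _), Category.id_comp]
      exact (intι₀_map (coneFunctorOp W G) L).symm))
    ((comp_intι₁_t _).trans (by
      rw [toUnit_unique (toUnit (𝟙_ V)) (𝟙 _), Category.id_comp]))

end WeightedCones

end

end EnrichedInternal

/-!
All three conditions say that every generalized weighted cone factors uniquely through `l`.

By the Yoneda lemma the comparison `C(-, L) ⟹ V^I(W, C(-, G))` sends a generalized arrow `k : A ⟶ L`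
to the restriction of `l` along `k`. A `V`-natural transformation between `V`-functors to `V` is
invertible as soon as its components are, so `(L, l)` is a weighted limit if and only if every
generalized element `f` of `V^I(W, C(A, G -))` is the restriction of `l` along a unique `k`
(`isWeightedLimit_iff`).

An element `T` of an internal category `A` is internal terminal if and only if every generalized
object of `A` has a unique generalized arrow to `T` (`InternalCat.isInternalTerminal_iff`): the
objects of `A / T` over `x` are the arrows `x ⟶ T`, and if these are unique then every triangle over
`T` commutes, so that the projection is invertible on arrows too. For a comma category
`H ↓ b` this becomes a unique factorization property in terms of arrows of the domain of `H`
(`InternalCat.comma_hasUniqueArrowsTo_iff`). A generalized object of `Int C` need not be an object of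
`C`, but it is one on each piece of a decomposition of its stage as a coproduct. Unique existence
is local for such decompositions (`cover_existsUnique`), and a generalized arrow of `Int C` with
constant ends lies in a hom-object of `C` (`exists_comp_intι₁_eq`). So for weighted cones internal
terminality is the same factorization property (`weightedCones_hasUniqueArrowsTo_iff`).

Finally, `V`-terminality in `Und ⟦cst X, A⟧` says that the objects of `A` at the stages `X × Z`
that are constant in `Z` have unique arrows to `T`. Taking `Z = 1`, this says that the projection
`(A / T)₀ ⟶ A₀` is bijective on maps out of `X`, and for all `X` in a conservative family it says that
the projection is invertible (`InternalCat.hasUniqueArrowsTo_iff_of_isConservative`).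
-/

namespace EnrichedInternal

/-! ### Isomorphisms detected on generalized elements -/

theorem isIso_toUnit_iff {V : Type u} [Category.{v} V] [CartesianMonoidalCategory V] (Y : V) :
    IsIso (toUnit Y) ↔ ∀ Z : V, ∃! _ : Z ⟶ Y, True := by
  constructor
  · intro h Z
    exact ⟨toUnit Z ≫ inv (toUnit Y), trivial, fun f _ =>
      (cancel_mono (toUnit Y)).1 (toUnit_unique _ _)⟩
  · intro h
    apply (isIso_iff_yoneda_map_bijective _).2
    intro Z
    obtain ⟨f, -, hf⟩ := h Z
    exact ⟨fun g g' _ => (hf g trivial).trans (hf g' trivial).symm,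
      fun k => ⟨f, toUnit_unique _ _⟩⟩

/-- An internal functor that is invertible on objects and on arrows is an isomorphism. -/
theorem InternalCat.isIso_of_isIso_map {V : Type u} [Category.{v} V]
    [HasPullbacks V] {A B : InternalCat V} (F : A ⟶ B) [IsIso F.map₀] [IsIso F.map₁] :
    IsIso F := by
  have hm {Z : V} (f : Z ⟶ B.obj₁) : (f ≫ inv F.map₁) ≫ F.map₁ = f := by simp
  let K : B ⟶ A :=
    { map₀ := inv F.map₀
      map₁ := inv F.map₁
      map_s := by rw [IsIso.inv_comp_eq, ← Category.assoc, F.map_s, Category.assoc,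
        IsIso.hom_inv_id, Category.comp_id]
      map_t := by rw [IsIso.inv_comp_eq, ← Category.assoc, F.map_t, Category.assoc,
        IsIso.hom_inv_id, Category.comp_id]
      map_i := by rw [IsIso.eq_inv_comp, ← Category.assoc, ← F.map_i, Category.assoc,
        IsIso.hom_inv_id, Category.comp_id]
      map_mul := by
        intro Z f g e
        rw [← cancel_mono F.map₁, hm, F.map_mul]
        exact B.mul_congr (hm f).symm (hm g).symm e }
  exact ⟨K, InternalCat.hom_ext (IsIso.hom_inv_id _) (IsIso.hom_inv_id _),
    InternalCat.hom_ext (IsIso.inv_hom_id _) (IsIso.inv_hom_id _)⟩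

/-! ### Generalized objects and arrows of a comma internal category -/

section Comma

variable {V : Type u} [Category.{v} V] [CartesianMonoidalCategory V] [HasPullbacks V]

namespace InternalCat

section

variable {A B : InternalCat V} (H : A ⟶ B) (b : 𝟙_ V ⟶ B.obj₀)

/-- The arrow `H a ⟶ b` that is part of an object of `H ↓ b`. -/
noncomputable def commaArr : (comma H b).obj₀ ⟶ B.obj₁ :=
  (pbSnd (pair H (const A B b)) (ends B)).map₀

/-- The square that is part of an arrow of `H ↓ b`. -/
noncomputable def commaSq : (comma H b).obj₁ ⟶ B.sq :=
  (pbSnd (pair H (const A B b)) (ends B)).map₁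

theorem pair_fst {D A B : InternalCat V} (F : D ⟶ A) (G : D ⟶ B) : pair F G ≫ pbFst _ _ = F :=
  hom_ext (pullback.lift_fst _ _ _) (pullback.lift_fst _ _ _)

theorem pair_snd {D A B : InternalCat V} (F : D ⟶ A) (G : D ⟶ B) : pair F G ≫ pbSnd _ _ = G :=
  hom_ext (pullback.lift_snd _ _ _) (pullback.lift_snd _ _ _)

theorem commaProj_comp : commaProj H b ≫ H = pbSnd (pair H (const A B b)) (ends B) ≫ B.dom := by
  refine (congrArg (commaProj H b ≫ ·) (pair_fst H (const A B b))).symm.trans ?_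
  refine Eq.trans ?_ (congrArg (pbSnd (pair H (const A B b)) (ends B) ≫ ·) (pair_fst B.dom B.cod))
  exact (Category.assoc _ _ _).symm.trans
    ((congrArg (· ≫ pbFst _ _) (pb_condition _ _)).trans (Category.assoc _ _ _))

theorem commaProj_comp_const :
    commaProj H b ≫ const A B b = pbSnd (pair H (const A B b)) (ends B) ≫ B.cod := by
  refine (congrArg (commaProj H b ≫ ·) (pair_snd H (const A B b))).symm.trans ?_
  refine Eq.trans ?_ (congrArg (pbSnd (pair H (const A B b)) (ends B) ≫ ·) (pair_snd B.dom B.cod))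
  exact (Category.assoc _ _ _).symm.trans
    ((congrArg (· ≫ pbSnd _ _) (pb_condition _ _)).trans (Category.assoc _ _ _))

variable {H b} {Z : V}

theorem comma_obj_source (y : Z ⟶ (comma H b).obj₀) :
    (y ≫ commaArr H b) ≫ B.s = (y ≫ (commaProj H b).map₀) ≫ H.map₀ := by
  have h : (commaProj H b).map₀ ≫ H.map₀ = commaArr H b ≫ B.s :=
    congrArg InternalFunctor.map₀ (commaProj_comp H b)
  rw [Category.assoc, Category.assoc, h]

theorem comma_obj_target (y : Z ⟶ (comma H b).obj₀) :
    (y ≫ commaArr H b) ≫ B.t = toUnit Z ≫ b := by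
  have h : (commaProj H b).map₀ ≫ toUnit _ ≫ b = commaArr H b ≫ B.t :=
    congrArg InternalFunctor.map₀ (commaProj_comp_const H b)
  rw [Category.assoc, ← h]
  simp only [← Category.assoc]
  congr 1
  exact toUnit_unique _ _

theorem comma_hom_source (y : Z ⟶ (comma H b).obj₁) :
    (y ≫ commaSq H b) ≫ B.sqP = (y ≫ (commaProj H b).map₁) ≫ H.map₁ := by
  have h : (commaProj H b).map₁ ≫ H.map₁ = commaSq H b ≫ B.sqP :=
    congrArg InternalFunctor.map₁ (commaProj_comp H b)
  rw [Category.assoc, Category.assoc, h]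

theorem comma_hom_target (y : Z ⟶ (comma H b).obj₁) :
    (y ≫ commaSq H b) ≫ B.sqQ = (toUnit Z ≫ b) ≫ B.i := by
  have h : (commaProj H b).map₁ ≫ toUnit _ ≫ b ≫ B.i = commaSq H b ≫ B.sqQ :=
    congrArg InternalFunctor.map₁ (commaProj_comp_const H b)
  rw [Category.assoc, ← h]
  simp only [← Category.assoc]
  congr 2
  exact toUnit_unique _ _

theorem comma_obj_ext {y y' : Z ⟶ (comma H b).obj₀}
    (h : y ≫ (commaProj H b).map₀ = y' ≫ (commaProj H b).map₀)
    (h' : y ≫ commaArr H b = y' ≫ commaArr H b) : y = y' :=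
  pullback.hom_ext h h'

theorem comma_hom_ext {y y' : Z ⟶ (comma H b).obj₁}
    (h : y ≫ (commaProj H b).map₁ = y' ≫ (commaProj H b).map₁)
    (h' : y ≫ commaSq H b = y' ≫ commaSq H b) : y = y' :=
  pullback.hom_ext h h'

theorem exists_comma_obj (a : Z ⟶ A.obj₀) (f : Z ⟶ B.obj₁) (hs : f ≫ B.s = a ≫ H.map₀)
    (ht : f ≫ B.t = toUnit Z ≫ b) : ∃ y : Z ⟶ (comma H b).obj₀,
      y ≫ (commaProj H b).map₀ = a ∧ y ≫ commaArr H b = f := by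
  have e : a ≫ (pair H (const A B b)).map₀ = f ≫ (ends B).map₀ := by
    apply pullback.hom_ext
    · refine (Category.assoc _ _ _).trans ((congrArg (a ≫ ·) (pullback.lift_fst _ _ _)).trans ?_)
      refine Eq.trans ?_ ((Category.assoc _ _ _).trans
        (congrArg (f ≫ ·) (pullback.lift_fst _ _ _))).symm
      exact hs.symm
    · refine (Category.assoc _ _ _).trans ((congrArg (a ≫ ·) (pullback.lift_snd _ _ _)).trans ?_)
      refine Eq.trans ?_ ((Category.assoc _ _ _).trans
        (congrArg (f ≫ ·) (pullback.lift_snd _ _ _))).symm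
      refine Eq.trans ?_ ht.symm
      refine (Category.assoc _ _ _).symm.trans ?_
      exact congrArg (· ≫ b) (toUnit_unique _ _)
  exact ⟨pullback.lift a f e, pullback.lift_fst _ _ _, pullback.lift_snd _ _ _⟩

theorem exists_comma_hom (k : Z ⟶ A.obj₁) (q : Z ⟶ B.sq) (hP : q ≫ B.sqP = k ≫ H.map₁)
    (hQ : q ≫ B.sqQ = (toUnit Z ≫ b) ≫ B.i) : ∃ y : Z ⟶ (comma H b).obj₁,
      y ≫ (commaProj H b).map₁ = k ∧ y ≫ commaSq H b = q := by
  have e : k ≫ (pair H (const A B b)).map₁ = q ≫ (ends B).map₁ := by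
    apply pullback.hom_ext
    · refine (Category.assoc _ _ _).trans ((congrArg (k ≫ ·) (pullback.lift_fst _ _ _)).trans ?_)
      refine Eq.trans ?_ ((Category.assoc _ _ _).trans
        (congrArg (q ≫ ·) (pullback.lift_fst _ _ _))).symm
      exact hP.symm
    · refine (Category.assoc _ _ _).trans ((congrArg (k ≫ ·) (pullback.lift_snd _ _ _)).trans ?_)
      refine Eq.trans ?_ ((Category.assoc _ _ _).trans
        (congrArg (q ≫ ·) (pullback.lift_snd _ _ _))).symm
      refine Eq.trans ?_ hQ.symm
      refine (Category.assoc _ _ _).symm.trans ((Category.assoc _ _ _).symm.trans ?_)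
      exact congrArg (fun u => (u ≫ b) ≫ B.i) (toUnit_unique _ _)
  exact ⟨pullback.lift k q e, pullback.lift_fst _ _ _, pullback.lift_snd _ _ _⟩

theorem comma_hom_ends_proj (y : Z ⟶ (comma H b).obj₁) :
    (y ≫ (commaProj H b).map₁) ≫ A.s = (y ≫ (comma H b).s) ≫ (commaProj H b).map₀ ∧
      (y ≫ (commaProj H b).map₁) ≫ A.t = (y ≫ (comma H b).t) ≫ (commaProj H b).map₀ := by
  simp only [Category.assoc, (commaProj H b).map_s, (commaProj H b).map_t, and_self]

theorem comma_hom_ends_arr (y : Z ⟶ (comma H b).obj₁) :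
    (y ≫ commaSq H b) ≫ B.sqU = (y ≫ (comma H b).s) ≫ commaArr H b ∧
      (y ≫ commaSq H b) ≫ B.sqV = (y ≫ (comma H b).t) ≫ commaArr H b := by
  have h₁ : commaSq H b ≫ B.sqU = (comma H b).s ≫ commaArr H b :=
    (pbSnd (pair H (const A B b)) (ends B)).map_s
  have h₂ : commaSq H b ≫ B.sqV = (comma H b).t ≫ commaArr H b :=
    (pbSnd (pair H (const A B b)) (ends B)).map_t
  simp only [Category.assoc, h₁, h₂, and_self]

/-- An arrow of `H ↓ b` is determined by its source, its target and its projection. -/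
theorem comma_hom_ext_ends {g g' : Z ⟶ (comma H b).obj₁}
    (hs : g ≫ (comma H b).s = g' ≫ (comma H b).s) (ht : g ≫ (comma H b).t = g' ≫ (comma H b).t)
    (hk : g ≫ (commaProj H b).map₁ = g' ≫ (commaProj H b).map₁) : g = g' := by
  refine comma_hom_ext hk (sq_ext ?_ ?_ ?_ ?_)
  · rw [(comma_hom_ends_arr g).1, (comma_hom_ends_arr g').1, hs]
  · rw [comma_hom_target, comma_hom_target]
  · rw [comma_hom_source, comma_hom_source, hk]
  · rw [(comma_hom_ends_arr g).2, (comma_hom_ends_arr g').2, ht]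

/-- The triangle over `b` that an arrow of `H ↓ b` makes commute. -/
theorem comma_hom_triangle (g : Z ⟶ (comma H b).obj₁) :
    ∃ e : ((g ≫ (commaProj H b).map₁) ≫ H.map₁) ≫ B.t =
        ((g ≫ (comma H b).t) ≫ commaArr H b) ≫ B.s,
      B.mul ((g ≫ (commaProj H b).map₁) ≫ H.map₁) ((g ≫ (comma H b).t) ≫ commaArr H b) e =
        (g ≫ (comma H b).s) ≫ commaArr H b := by
  obtain ⟨h₁, h₂⟩ := comma_hom_ends_arr g
  refine ⟨?_, ?_⟩
  · rw [← comma_hom_source, ← h₂, gsq_pv]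
  · refine (B.mul_congr (comma_hom_source g).symm h₂.symm _).trans ?_
    refine (gsq_comm _).symm.trans ?_
    -- the side of the square lying over `b` is an identity
    refine (B.mul_congr rfl (comma_hom_target g) _).trans ?_
    rw [← h₁]
    apply B.mul_id
    rw [h₁, comma_obj_target]

/-- An arrow `k` of `A` that makes the triangle over `b` commute lifts to an arrow of `H ↓ b`. -/
theorem exists_comma_hom_of_triangle {x y : Z ⟶ (comma H b).obj₀} (k : Z ⟶ A.obj₁)
    (hs : k ≫ A.s = x ≫ (commaProj H b).map₀) (ht : k ≫ A.t = y ≫ (commaProj H b).map₀)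
    (e : (k ≫ H.map₁) ≫ B.t = (y ≫ commaArr H b) ≫ B.s)
    (h : B.mul (k ≫ H.map₁) (y ≫ commaArr H b) e = x ≫ commaArr H b) :
    ∃ g : Z ⟶ (comma H b).obj₁, g ≫ (comma H b).s = x ∧ g ≫ (comma H b).t = y ∧
      g ≫ (commaProj H b).map₁ = k := by
  have e' : (x ≫ commaArr H b) ≫ B.t = ((toUnit Z ≫ b) ≫ B.i) ≫ B.s := by
    rw [comma_obj_target, Category.assoc _ B.i, B.i_s, Category.comp_id]
  have hc : B.mul (x ≫ commaArr H b) ((toUnit Z ≫ b) ≫ B.i) e' =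
      B.mul (k ≫ H.map₁) (y ≫ commaArr H b) e := by
    rw [h]
    exact B.mul_id _ _ (comma_obj_target x)
  obtain ⟨g, hg₁, hg₂⟩ := exists_comma_hom k (sqLift _ _ _ _ e' e hc)
    (sqLift_P _ _ _ _ _ _ _) (sqLift_Q _ _ _ _ _ _ _)
  obtain ⟨h₁, h₂⟩ := comma_hom_ends_proj g
  obtain ⟨h₃, h₄⟩ := comma_hom_ends_arr g
  rw [hg₁] at h₁ h₂
  rw [hg₂] at h₃ h₄
  refine ⟨g, comma_obj_ext ?_ ?_, comma_obj_ext ?_ ?_, hg₁⟩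
  · rw [← h₁, hs]
  · rw [← h₃, sqLift_U]
  · rw [← h₂, ht]
  · rw [← h₄, sqLift_V]

end

/-! ### Internal terminal objects through generalized elements -/

/-- The representable form of internal terminality: every generalized object of `A` has a unique generalized arrow to the element `T`. -/
def HasUniqueArrowsTo (A : InternalCat V) (T : 𝟙_ V ⟶ A.obj₀) : Prop :=
  ∀ ⦃Z : V⦄ (x : Z ⟶ A.obj₀),
    ∃! f : Z ⟶ A.obj₁, f ≫ A.s = x ∧ f ≫ A.t = toUnit Z ≫ T

/-- Unique arrows to an element `T` of `H ↓ b`, as unique factorizations `f = H k ≫ T` of generalized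
arrows `f : H a ⟶ b` through the arrow of `T`. -/
theorem comma_hasUniqueArrowsTo_iff {A B : InternalCat V} {H : A ⟶ B} {b : 𝟙_ V ⟶ B.obj₀}
    (T : 𝟙_ V ⟶ (comma H b).obj₀) :
    (comma H b).HasUniqueArrowsTo T ↔ ∀ {Z : V} (a : Z ⟶ A.obj₀) (f : Z ⟶ B.obj₁),
      f ≫ B.s = a ≫ H.map₀ → f ≫ B.t = toUnit Z ≫ b →
      ∃! k : Z ⟶ A.obj₁, k ≫ A.s = a ∧ k ≫ A.t = (toUnit Z ≫ T) ≫ (commaProj H b).map₀ ∧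
        ∃ e, B.mul (k ≫ H.map₁) ((toUnit Z ≫ T) ≫ commaArr H b) e = f := by
  constructor
  · intro h Z a f hs ht
    obtain ⟨y, rfl, rfl⟩ := exists_comma_obj a f hs ht
    obtain ⟨g, ⟨gs, gt⟩, gu⟩ := h y
    refine ⟨g ≫ (commaProj H b).map₁, ⟨?_, ?_, ?_⟩, ?_⟩
    · rw [(comma_hom_ends_proj g).1, gs]
    · rw [(comma_hom_ends_proj g).2, gt]
    · rw [← gt, ← gs]
      exact comma_hom_triangle g
    · rintro k ⟨ks, kt, e, he⟩
      obtain ⟨g', gs', gt', rfl⟩ := exists_comma_hom_of_triangle k ks kt e he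
      rw [gu g' ⟨gs', gt'⟩]
  · intro h Z y
    obtain ⟨k, ⟨ks, kt, e, he⟩, ku⟩ := h _ _ (comma_obj_source y) (comma_obj_target y)
    obtain ⟨g, gs, gt, rfl⟩ := exists_comma_hom_of_triangle k ks kt e he
    refine ⟨g, ⟨gs, gt⟩, ?_⟩
    rintro g' ⟨gs', gt'⟩
    refine comma_hom_ext_ends (gs'.trans gs.symm) (gt'.trans gt.symm) (ku _ ⟨?_, ?_, ?_⟩)
    · rw [(comma_hom_ends_proj g').1, gs']
    · rw [(comma_hom_ends_proj g').2, gt']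
    · rw [← gt', ← gs']
      exact comma_hom_triangle g'

/-- Objects of the slice `A / T` over a generalized object `x` of `A` are arrows from `x`
to `T`. -/
theorem bijective_commaProj_id_iff (A : InternalCat V) (T : 𝟙_ V ⟶ A.obj₀) (Z : V) :
    (Function.Bijective fun y : Z ⟶ (comma (𝟙 A) T).obj₀ => y ≫ (commaProj (𝟙 A) T).map₀) ↔
      ∀ x : Z ⟶ A.obj₀, ∃! f : Z ⟶ A.obj₁, f ≫ A.s = x ∧ f ≫ A.t = toUnit Z ≫ T := by
  have hid {x : Z ⟶ A.obj₀} : x ≫ InternalFunctor.map₀ (𝟙 A) = x := Category.comp_id x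
  rw [Function.bijective_iff_existsUnique]
  refine forall_congr' fun x => ?_
  constructor
  · rintro ⟨y, hy, hu⟩
    have hy : y ≫ (commaProj (𝟙 A) T).map₀ = x := hy
    refine ⟨y ≫ commaArr (𝟙 A) T, ⟨?_, comma_obj_target y⟩, ?_⟩
    · rw [comma_obj_source, hid, hy]
    · rintro f ⟨hs, ht⟩
      obtain ⟨y', hy', rfl⟩ := exists_comma_obj (H := 𝟙 A) (b := T) x f (hs.trans hid.symm) ht
      rw [hu y' hy']
  · rintro ⟨f, ⟨hs, ht⟩, hu⟩
    obtain ⟨y, hy, rfl⟩ := exists_comma_obj (H := 𝟙 A) (b := T) x f (hs.trans hid.symm) ht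
    refine ⟨y, hy, fun y' hy' => ?_⟩
    have hy' : y' ≫ (commaProj (𝟙 A) T).map₀ = x := hy'
    refine comma_obj_ext (hy'.trans hy.symm) (hu _ ⟨?_, comma_obj_target y'⟩)
    rw [comma_obj_source, hid, hy']

/-- An element `T` of `A` is internal terminal if and only if every generalized object has a unique
generalized arrow to it. -/
theorem isInternalTerminal_iff {A : InternalCat V} {T : 𝟙_ V ⟶ A.obj₀} :
    A.IsInternalTerminal T ↔ A.HasUniqueArrowsTo T := by
  have hid₀ {Z : V} {x : Z ⟶ A.obj₀} : x ≫ InternalFunctor.map₀ (𝟙 A) = x := Category.comp_id x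
  have hid₁ {Z : V} {x : Z ⟶ A.obj₁} : x ≫ InternalFunctor.map₁ (𝟙 A) = x := Category.comp_id x
  constructor
  · intro h Z
    have : IsIso (commaProj (𝟙 A) T) := h
    have : IsIso (commaProj (𝟙 A) T).map₀ :=
      ⟨(inv (commaProj (𝟙 A) T)).map₀,
        congrArg InternalFunctor.map₀ (IsIso.hom_inv_id (commaProj (𝟙 A) T)),
        congrArg InternalFunctor.map₀ (IsIso.inv_hom_id (commaProj (𝟙 A) T))⟩
    exact (bijective_commaProj_id_iff A T Z).1 ((isIso_iff_yoneda_map_bijective _).1 inferInstance Z)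
  · intro h
    have h₀ (Z : V) := (bijective_commaProj_id_iff A T Z).2 (h (Z := Z))
    have : IsIso (commaProj (𝟙 A) T).map₀ := (isIso_iff_yoneda_map_bijective _).2 h₀
    have : IsIso (commaProj (𝟙 A) T).map₁ := by
      apply (isIso_iff_yoneda_map_bijective _).2
      intro Z
      constructor
      · intro g g' (hg : g ≫ (commaProj (𝟙 A) T).map₁ = g' ≫ (commaProj (𝟙 A) T).map₁)
        refine comma_hom_ext_ends ((h₀ Z).1 ?_) ((h₀ Z).1 ?_) hg
        · exact (comma_hom_ends_proj g).1.symm.trans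
            ((congrArg (· ≫ A.s) hg).trans (comma_hom_ends_proj g').1)
        · exact (comma_hom_ends_proj g).2.symm.trans
            ((congrArg (· ≫ A.t) hg).trans (comma_hom_ends_proj g').2)
      · intro k
        obtain ⟨x, hx : x ≫ (commaProj (𝟙 A) T).map₀ = k ≫ A.s⟩ := (h₀ Z).2 (k ≫ A.s)
        obtain ⟨y, hy : y ≫ (commaProj (𝟙 A) T).map₀ = k ≫ A.t⟩ := (h₀ Z).2 (k ≫ A.t)
        have e : (k ≫ InternalFunctor.map₁ (𝟙 A)) ≫ A.t = (y ≫ commaArr (𝟙 A) T) ≫ A.s := by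
          rw [comma_obj_source, hid₁, hid₀, hy]
        -- the triangle commutes since both paths are arrows to `T` with the same source
        obtain ⟨g, -, -, hg⟩ := exists_comma_hom_of_triangle k hx.symm hy.symm e
          ((h (k ≫ A.s)).unique ⟨by rw [mul_s, hid₁], by rw [mul_t, comma_obj_target]⟩
            ⟨by rw [comma_obj_source, hid₀, hx], comma_obj_target x⟩)
        exact ⟨g, hg⟩
    exact isIso_of_isIso_map (commaProj (𝟙 A) T)

/-- Generalized elements of the hom-objects of `Und A` are the generalized arrows of `A` with the
given constant source and target. -/
theorem isVTerminal_und_iff {A : InternalCat V} (T : 𝟙_ V ⟶ A.obj₀) :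
    IsVTerminal V (Und.mk T) ↔ ∀ (a : 𝟙_ V ⟶ A.obj₀) (Z : V),
      ∃! f : Z ⟶ A.obj₁, f ≫ A.s = toUnit Z ≫ a ∧ f ≫ A.t = toUnit Z ≫ T := by
  have key (a : 𝟙_ V ⟶ A.obj₀) : IsIso (toUnit ((Und.mk a) ⟶[V] (Und.mk T))) ↔ ∀ Z : V,
      ∃! f : Z ⟶ A.obj₁, f ≫ A.s = toUnit Z ≫ a ∧ f ≫ A.t = toUnit Z ≫ T := by
    refine (isIso_toUnit_iff (Und.hom (Und.mk a) (Und.mk T))).trans (forall_congr' fun Z => ?_)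
    constructor
    · rintro ⟨g, -, hg⟩
      refine ⟨g ≫ Und.π _ _, ⟨Und.comp_π_s g, Und.comp_π_t g⟩, ?_⟩
      rintro f ⟨hs, ht⟩
      rw [← hg (Und.mk' f hs ht) trivial, Und.mk'_π]
    · rintro ⟨f, ⟨hs, ht⟩, hf⟩
      refine ⟨Und.mk' f hs ht, trivial, fun g _ => Und.hom_ext ?_⟩
      rw [Und.mk'_π]
      exact hf _ ⟨Und.comp_π_s g, Und.comp_π_t g⟩
  exact ⟨fun h a => (key a).1 (h (Und.mk a)), fun h a => (key a.elt).2 (h a.elt)⟩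

/-- Terminality in `Und ⟦cst X, A⟧` of a constant family, in terms of generalized arrows of `A`. -/
theorem isVTerminal_constElement_iff [MonoidalClosed V] (A : InternalCat V) (T : 𝟙_ V ⟶ A.obj₀)
    (X : V) : IsVTerminal V (Und.mk (A.constElement X T)) ↔
      ∀ (x : X ⟶ A.obj₀) (Z : V), ∃! f : X ⊗ Z ⟶ A.obj₁,
        f ≫ A.s = fst X Z ≫ x ∧ f ≫ A.t = toUnit _ ≫ T := by
  refine (isVTerminal_und_iff _).trans ?_
  have hT (Z : V) : uncurry (toUnit Z ≫ T ≫ curry (snd X A.obj₀)) = toUnit (X ⊗ Z) ≫ T := by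
    rw [MonoidalClosed.uncurry_natural_left, MonoidalClosed.uncurry_natural_left,
      MonoidalClosed.uncurry_curry, whiskerLeft_snd, whiskerLeft_snd_assoc, ← Category.assoc,
      comp_toUnit]
  have hx (x : X ⟶ A.obj₀) (Z : V) :
      uncurry (toUnit Z ≫ curry (fst X (𝟙_ V) ≫ x)) = fst X Z ≫ x := by
    rw [MonoidalClosed.uncurry_natural_left, MonoidalClosed.uncurry_curry, whiskerLeft_fst_assoc]
  have key (x : X ⟶ A.obj₀) (Z : V) :
      (∃! f : Z ⟶ (ihom X).obj A.obj₁, f ≫ (ihom X).map A.s = toUnit Z ≫ curry (fst X (𝟙_ V) ≫ x) ∧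
        f ≫ (ihom X).map A.t = toUnit Z ≫ T ≫ curry (snd X A.obj₀)) ↔
      ∃! f : X ⊗ Z ⟶ A.obj₁, f ≫ A.s = fst X Z ≫ x ∧ f ≫ A.t = toUnit _ ≫ T := by
    refine Equiv.existsUnique_congr ((ihom.adjunction X).homEquiv Z A.obj₁).symm fun f => ?_
    change _ ↔ uncurry f ≫ A.s = _ ∧ uncurry f ≫ A.t = _
    rw [← hx x Z, ← hT Z, ← uncurry_map, ← uncurry_map, MonoidalClosed.uncurry_injective.eq_iff,
      MonoidalClosed.uncurry_injective.eq_iff]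
  constructor
  · intro h x Z
    exact (key x Z).1 (h (curry (fst X (𝟙_ V) ≫ x)) Z)
  · intro h a Z
    have ha : a = curry (fst X (𝟙_ V) ≫ lift (𝟙 X) (toUnit X) ≫ uncurry a) := by
      apply MonoidalClosed.uncurry_injective
      rw [MonoidalClosed.uncurry_curry, ← Category.assoc]
      have e : fst X (𝟙_ V) ≫ lift (𝟙 X) (toUnit X) = 𝟙 _ := by
        ext
        simp
      rw [e, Category.id_comp]
    rw [ha]
    exact (key _ Z).2 (h _ Z)

/-- Internal terminality can be tested on the families indexed by a conservative family. -/
theorem hasUniqueArrowsTo_iff_of_isConservative [MonoidalClosed V] {𝒢 : Set V}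
    (h𝒢 : IsConservative 𝒢) (A : InternalCat V) (T : 𝟙_ V ⟶ A.obj₀) :
    A.HasUniqueArrowsTo T ↔ ∀ X ∈ 𝒢, IsVTerminal V (Und.mk (A.constElement X T)) := by
  constructor
  · intro h X _
    exact (isVTerminal_constElement_iff A T X).2 fun x Z => h (fst X Z ≫ x)
  · intro h
    have : IsIso (commaProj (𝟙 A) T).map₀ := by
      refine (h𝒢 _).2 fun X hX => (bijective_commaProj_id_iff A T X).2 fun x => ?_
      -- families indexed by `X` are families indexed by `X × 1`
      obtain ⟨f, ⟨hs, ht⟩, hu⟩ := (isVTerminal_constElement_iff A T X).1 (h X hX) x (𝟙_ V)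
      refine ⟨lift (𝟙 X) (toUnit X) ≫ f, ⟨?_, ?_⟩, ?_⟩
      · rw [Category.assoc, hs, lift_fst_assoc, Category.id_comp]
      · rw [Category.assoc, ht, ← Category.assoc, comp_toUnit]
      · rintro g ⟨gs, gt⟩
        rw [← hu (fst X (𝟙_ V) ≫ g) ⟨by rw [Category.assoc, gs],
          by rw [Category.assoc, gt, ← Category.assoc, comp_toUnit]⟩, lift_fst_assoc,
          Category.id_comp]
    intro Z
    exact (bijective_commaProj_id_iff A T Z).1 ((isIso_iff_yoneda_map_bijective _).1 inferInstance Z)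

end InternalCat

end Comma

/-! ### Locality over a coproduct -/

section Cover

variable {V : Type u} [Category.{v} V] [HasPullbacks V] [IsExtensive.{w} V] {I : Type w}

/-- Unique existence of a map with a local property can be checked on the fibres of a map to a
coproduct. -/
theorem cover_existsUnique {X : I → V} {Z Q : V} (f : Z ⟶ ∐ X)
    (R : ∀ {S : V}, (S ⟶ Z) → (S ⟶ Q) → Prop)
    (stable : ∀ {S T : V} (y : S ⟶ T) (z : T ⟶ Z) (k : T ⟶ Q), R z k → R (y ≫ z) (y ≫ k))
    (glue : ∀ k : Z ⟶ Q, (∀ (i : I) {S : V} (z : S ⟶ Z) (f' : S ⟶ X i),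
      z ≫ f = f' ≫ Limits.Sigma.ι X i → R z (z ≫ k)) → R (𝟙 Z) k)
    (h : ∀ (i : I) {S : V} (z : S ⟶ Z) (f' : S ⟶ X i),
      z ≫ f = f' ≫ Limits.Sigma.ι X i → ∃! k, R z k) : ∃! k, R (𝟙 Z) k := by
  -- the maps on the fibres are compatible by uniqueness and stability
  choose m hm hu using @h
  obtain ⟨c, hc⟩ := cover_glue f (fun i S z f' e => m i z f' e) (fun i S T y z f' e =>
    hu i (y ≫ z) (y ≫ f') (by rw [Category.assoc, e, Category.assoc]) _
      (stable y z _ (hm i z f' e)))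
  refine ⟨c, glue c fun i S z f' e => ?_, fun k hk => cover_ext f fun i S z f' e => ?_⟩
  · rw [hc i z f' e]
    exact hm i z f' e
  · rw [hc i z f' e]
    refine hu i z f' e _ ?_
    have := stable z _ _ hk
    rwa [Category.comp_id] at this

end Cover

section Int

variable {V : Type u} [Category.{v} V] [CartesianMonoidalCategory V] [HasPullbacks V]
  [IsExtensive.{w} V] {C : Type w} [EnrichedCategory V C]

/-- A generalized arrow of `Int C` with constant source `A` and target `B` lies in `C(A, B)`. -/
theorem exists_comp_intι₁_eq {Z : V} {A B : C} (g : Z ⟶ intHom V C)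
    (hs : g ≫ intS V C = toUnit Z ≫ intι₀ V A) (ht : g ≫ intT V C = toUnit Z ≫ intι₀ V B) :
    ∃ g' : Z ⟶ (A ⟶[V] B), g' ≫ intι₁ V A B = g := by
  have ex (p : C × C) {S : V} (z : S ⟶ Z) (f' : S ⟶ (p.1 ⟶[V] p.2))
      (h : z ≫ g = f' ≫ intι₁ V p.1 p.2) :
      ∃ m : S ⟶ (A ⟶[V] B), m ≫ intι₁ V A B = z ≫ g := by
    obtain ⟨A', B'⟩ := p
    have hA : toUnit S ≫ intι₀ V A' = toUnit S ≫ intι₀ V A := by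
      rw [← comp_intι₁_s f', ← h, Category.assoc, hs, ← Category.assoc, comp_toUnit]
    have hB : toUnit S ≫ intι₀ V B' = toUnit S ≫ intι₀ V B := by
      rw [← comp_intι₁_t f', ← h, Category.assoc, ht, ← Category.assoc, comp_toUnit]
    -- if `(A', B') ≠ (A, B)`, then `S` is initial by disjointness of coproducts
    by_cases h₁ : A' = A
    · by_cases h₂ : B' = B
      · subst h₁ h₂
        exact ⟨f', h.symm⟩
      · obtain ⟨k⟩ := sigma_disjoint (fun _ : C => 𝟙_ V) h₂ _ _ hB (A ⟶[V] B)
        obtain ⟨k'⟩ := sigma_disjoint (fun _ : C => 𝟙_ V) h₂ _ _ hB (intHom V C)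
        exact ⟨k.default, (k'.uniq _).trans (k'.uniq _).symm⟩
    · obtain ⟨k⟩ := sigma_disjoint (fun _ : C => 𝟙_ V) h₁ _ _ hA (A ⟶[V] B)
      obtain ⟨k'⟩ := sigma_disjoint (fun _ : C => 𝟙_ V) h₁ _ _ hA (intHom V C)
      exact ⟨k.default, (k'.uniq _).trans (k'.uniq _).symm⟩
  choose m hm using @ex
  obtain ⟨c, hc⟩ := cover_glue (X := fun p : C × C => (p.1 ⟶[V] p.2)) g
    (fun p _ z f' h => m p z f' h) (by
      intro p S T y z f' h
      apply intι₁_cancel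
      refine Eq.trans ?_ (hm p (y ≫ z) (y ≫ f') _).symm
      exact (Category.assoc _ _ _).trans
        ((congrArg (y ≫ ·) (hm p z f' h)).trans (Category.assoc _ _ _).symm))
  refine ⟨c, int_ext₁ g fun A' B' S z f' h => ?_⟩
  rw [← Category.assoc, hc (A', B') z f' h, hm]

namespace InternalCat

/-- If the objects of `A` lie over a coproduct, then it is enough to consider generalized objects of
`H ↓ b` whose projection lies over one of the summands. -/
theorem comma_hasUniqueArrowsTo_of_cover {A B : InternalCat V} {H : A ⟶ B} {b : 𝟙_ V ⟶ B.obj₀}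
    (T : 𝟙_ V ⟶ (comma H b).obj₀) {J : Type w} {X : J → V} (p : A.obj₀ ⟶ ∐ X)
    (h : ∀ (j : J) {Z : V} (a : Z ⟶ A.obj₀) (a' : Z ⟶ X j) (f : Z ⟶ B.obj₁),
      a ≫ p = a' ≫ Limits.Sigma.ι X j → f ≫ B.s = a ≫ H.map₀ → f ≫ B.t = toUnit Z ≫ b →
      ∃! k : Z ⟶ A.obj₁, k ≫ A.s = a ∧ k ≫ A.t = (toUnit Z ≫ T) ≫ (commaProj H b).map₀ ∧
        ∃ e, B.mul (k ≫ H.map₁) ((toUnit Z ≫ T) ≫ commaArr H b) e = f) :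
    (comma H b).HasUniqueArrowsTo T := by
  refine (comma_hasUniqueArrowsTo_iff T).2 ?_
  intro Z a f hs ht
  have hT {S T' : V} (y : S ⟶ T') {Q : V} (q : (comma H b).obj₀ ⟶ Q) :
      y ≫ (toUnit T' ≫ T) ≫ q = (toUnit S ≫ T) ≫ q := by
    rw [← Category.assoc, ← Category.assoc, comp_toUnit]
  have main := cover_existsUnique (Q := A.obj₁) (a ≫ p)
    (fun {S} z k => k ≫ A.s = z ≫ a ∧ k ≫ A.t = (toUnit S ≫ T) ≫ (commaProj H b).map₀ ∧
      ∃ e, B.mul (k ≫ H.map₁) ((toUnit S ≫ T) ≫ commaArr H b) e = z ≫ f) ?_ ?_ ?_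
  · simpa only [Category.id_comp] using main
  · rintro S T' y z k ⟨ks, kt, e, he⟩
    refine ⟨by rw [Category.assoc, ks, Category.assoc], by rw [Category.assoc, kt, hT], ?_, ?_⟩
    · rw [← hT y, Category.assoc y k, Category.assoc y, Category.assoc y, e]
    · rw [Category.assoc y z, ← he, comp_mul]
      exact B.mul_congr (Category.assoc _ _ _) (hT y _).symm _
  · intro k hk
    have kt : k ≫ A.t = (toUnit Z ≫ T) ≫ (commaProj H b).map₀ := by
      apply cover_ext (a ≫ p)
      intro j S z f' ha
      rw [← Category.assoc, (hk j z f' ha).2.1, hT]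
    refine ⟨?_, kt, ?_, ?_⟩
    · rw [Category.id_comp]
      apply cover_ext (a ≫ p)
      intro j S z f' ha
      rw [← Category.assoc, (hk j z f' ha).1]
    · rw [comma_obj_source, ← kt, Category.assoc, H.map_t, Category.assoc]
    · apply cover_ext (a ≫ p)
      intro j S z f' ha
      obtain ⟨-, -, e, he⟩ := hk j z f' ha
      rw [Category.id_comp, ← he, comp_mul]
      exact B.mul_congr (Category.assoc _ _ _).symm (hT z _) _
  · intro j S z f' ha
    apply h j (z ≫ a) f'
    · rw [Category.assoc, ha]
    · rw [Category.assoc, hs, ← Category.assoc]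
    · rw [Category.assoc, ht, ← Category.assoc, comp_toUnit]

end InternalCat

end Int

/-! ### Arrows between weighted cones -/

section WeightedCones

variable {V : Type u} [Category.{v} V] [CartesianMonoidalCategory V] [BraidedCategory V]
  [MonoidalClosed V] [HasPullbacks V] [IsExtensive.{w} V] {I : Type w} [EnrichedCategory V I]
  {C : Type w} [EnrichedCategory V C] {W : EnrichedFunctor V I V} {G : EnrichedFunctor V I C}

/-- The pair `(L, l)` receives a unique arrow from every generalized weighted cone if and only if
every generalized cone `W ⟹ C(A, G -)` is the restriction of `l` along a unique generalized
arrow `A ⟶ L`. -/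
theorem weightedCones_hasUniqueArrowsTo_iff {L : C} (l : VNatTrans W (G.comp V (coyo L))) :
    (weightedCones W G).HasUniqueArrowsTo (coneElement L l) ↔
      ∀ (A : C) {Z : V} (f : Z ⟶ natObj W (G.comp V (coyo A))),
        ∃! k : Z ⟶ (A ⟶[V] L), eMul (C := EnrichedFunctor V I V) (X := W)
          (Y := G.comp V (coyo L)) (W := G.comp V (coyo A)) (toUnit Z ≫ l.toHom)
          (k ≫ coneMap G (op L) (op A)) = f := by
  have hproj : coneElement L l ≫
      (InternalCat.commaProj (intMap (coneFunctorOp W G)) (intι₀ V (weightObj W G))).map₀ =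
        intι₀ V L := pullback.lift_fst _ _ _
  have harr : coneElement L l ≫
      InternalCat.commaArr (intMap (coneFunctorOp W G)) (intι₀ V (weightObj W G)) =
        coneArrow l := pullback.lift_snd _ _ _
  have hL (Z : V) : (toUnit Z ≫ coneElement L l) ≫
      (InternalCat.commaProj (intMap (coneFunctorOp W G)) (intι₀ V (weightObj W G))).map₀ =
        toUnit Z ≫ intι₀ V L :=
    (Category.assoc _ _ _).trans (congrArg (toUnit Z ≫ ·) hproj)
  have hl (Z : V) : (toUnit Z ≫ coneElement L l) ≫
      InternalCat.commaArr (intMap (coneFunctorOp W G)) (intι₀ V (weightObj W G)) =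
        ((toUnit Z ≫ l.toHom : Z ⟶ (coneObj W G L ⟶[V] weightObj W G))) ≫
          intι₁ V (coneObj W G L) (weightObj W G) :=
    (Category.assoc _ _ _).trans
      ((congrArg (toUnit Z ≫ ·) harr).trans (Category.assoc _ _ _).symm)
  have hmap {Z : V} {A : C} (k : Z ⟶ (A ⟶[V] L)) :
      (k ≫ intι₁ V A L) ≫ intMap₁ (coneFunctorOp W G) =
        (k ≫ (coneFunctorOp W G).map A L) ≫ intι₁ V (coneObj W G A) (coneObj W G L) :=
    (Category.assoc _ _ _).trans ((congrArg (k ≫ ·) (intι₁_map (coneFunctorOp W G) A L)).trans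
      (Category.assoc _ _ _).symm)
  -- the composition in `Int (V^I)^op` of the image of `k` with `l` is restriction along `k`
  have key {Z : V} {A : C} (k : Z ⟶ (A ⟶[V] L))
      (f : Z ⟶ (coneObj W G A ⟶[V] weightObj W G)) :
      (∃ e, (int V (ConeCat W G)ᵒᵖ).mul ((k ≫ intι₁ V A L) ≫ (intMap (coneFunctorOp W G)).map₁)
        ((toUnit Z ≫ coneElement L l) ≫
          InternalCat.commaArr (intMap (coneFunctorOp W G)) (intι₀ V (weightObj W G))) e =
        f ≫ intι₁ V (coneObj W G A) (weightObj W G)) ↔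
      eMul (C := EnrichedFunctor V I V) (X := W) (Y := G.comp V (coyo L))
        (W := G.comp V (coyo A)) (toUnit Z ≫ l.toHom) (k ≫ coneMap G (op L) (op A)) = f := by
    have e₀ := int_composable (k ≫ (coneFunctorOp W G).map A L)
      (toUnit Z ≫ l.toHom : Z ⟶ (coneObj W G L ⟶[V] weightObj W G))
    have hop : eMul (k ≫ (coneFunctorOp W G).map A L)
        (toUnit Z ≫ l.toHom : Z ⟶ (coneObj W G L ⟶[V] weightObj W G)) =
        eMul (C := EnrichedFunctor V I V) (X := W) (Y := G.comp V (coyo L))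
          (W := G.comp V (coyo A)) (toUnit Z ≫ l.toHom) (k ≫ coneMap G (op L) (op A)) :=
      eMul_op _ _
    have hm (e) : (int V (ConeCat W G)ᵒᵖ).mul
        ((k ≫ intι₁ V A L) ≫ (intMap (coneFunctorOp W G)).map₁)
        ((toUnit Z ≫ coneElement L l) ≫
          InternalCat.commaArr (intMap (coneFunctorOp W G)) (intι₀ V (weightObj W G))) e =
        eMul (C := (ConeCat W G)ᵒᵖ) (X := coneObj W G A) (Y := coneObj W G L)
          (W := weightObj W G) (k ≫ (coneFunctorOp W G).map A L) (toUnit Z ≫ l.toHom) ≫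
            intι₁ V (coneObj W G A) (weightObj W G) :=
      (InternalCat.mul_congr _ (hmap k) (hl Z) _).trans
        (((intData V (ConeCat W G)ᵒᵖ).mul_eq _ _ e₀).trans (intMul_ι _ _))
    constructor
    · rintro ⟨e, he⟩
      exact hop.symm.trans (intι₁_cancel ((hm e).symm.trans he))
    · intro h
      have e : ((k ≫ intι₁ V A L) ≫ (intMap (coneFunctorOp W G)).map₁) ≫
          (int V (ConeCat W G)ᵒᵖ).t = ((toUnit Z ≫ coneElement L l) ≫
          InternalCat.commaArr (intMap (coneFunctorOp W G)) (intι₀ V (weightObj W G))) ≫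
          (int V (ConeCat W G)ᵒᵖ).s :=
        (congrArg (· ≫ intT V (ConeCat W G)ᵒᵖ) (hmap k)).trans
          (e₀.trans (congrArg (· ≫ intS V (ConeCat W G)ᵒᵖ) (hl Z)).symm)
      exact ⟨e, (hm e).trans (congrArg (· ≫ intι₁ V (coneObj W G A) (weightObj W G))
        (hop.trans h))⟩
  have hobj (Z : V) (A : C) : (toUnit Z ≫ intι₀ V A) ≫ intMap₀ (coneFunctorOp W G) =
      toUnit Z ≫ intι₀ V (coneObj W G A) :=
    (Category.assoc _ _ _).trans (congrArg (toUnit Z ≫ ·) (intι₀_map (coneFunctorOp W G) A))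
  constructor
  · intro h A Z f
    obtain ⟨k, ⟨ks, kt, ke⟩, ku⟩ := (InternalCat.comma_hasUniqueArrowsTo_iff _).1 h
      (toUnit Z ≫ intι₀ V A) ((show Z ⟶ (coneObj W G A ⟶[V] weightObj W G) from f) ≫
        intι₁ V (coneObj W G A) (weightObj W G))
      ((comp_intι₁_s _).trans (hobj Z A).symm) (comp_intι₁_t _)
    obtain ⟨k, rfl⟩ := exists_comp_intι₁_eq k ks (kt.trans (hL Z))
    refine ⟨k, (key k f).1 ke, fun k' hk' => ?_⟩
    exact intι₁_cancel (ku (k' ≫ intι₁ V A L)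
      ⟨comp_intι₁_s _, (comp_intι₁_t _).trans (hL Z).symm, (key k' f).2 hk'⟩)
  · intro h
    refine InternalCat.comma_hasUniqueArrowsTo_of_cover _ (X := fun _ : C => 𝟙_ V)
      (𝟙 (intObj V C)) fun A Z a a' f ha hs ht => ?_
    obtain rfl : a = toUnit Z ≫ intι₀ V A := by
      rw [toUnit_unique (toUnit Z) a']
      exact (Category.comp_id _).symm.trans ha
    obtain ⟨f, rfl⟩ := exists_comp_intι₁_eq f (hs.trans (hobj Z A)) ht
    obtain ⟨k, hk, ku⟩ := h A f
    refine ⟨k ≫ intι₁ V A L,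
      ⟨comp_intι₁_s _, (comp_intι₁_t _).trans (hL Z).symm, (key k f).2 hk⟩, ?_⟩
    rintro k' ⟨ks, kt, ke⟩
    obtain ⟨k', rfl⟩ := exists_comp_intι₁_eq k' ks (kt.trans (hL Z))
    exact congrArg (· ≫ intι₁ V A L) (ku k' ((key k' f).1 ke))

end WeightedCones

/-! ### Isomorphisms of `V`-functors to `V` and representability -/

section Representable

variable {V : Type u} [Category.{v} V] [CartesianMonoidalCategory V] [MonoidalClosed V]

/-- A `V`-natural transformation of `V`-functors to `V` is an isomorphism if and only if its
components are bijective on generalized elements. -/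
theorem VNatTrans.isIso_iff_bijective {D : Type u₁} [EnrichedCategory V D]
    {F F' : EnrichedFunctor V D V} (α : VNatTrans F F') :
    α.IsIso ↔ ∀ (A : D) (Z : V),
      Function.Bijective fun x : Z ⟶ F.obj A => ap x (toUnit Z ≫ α.app A) := by
  have hid {F : EnrichedFunctor V D V} {A : D} {T : V} (x : T ⟶ F.obj A) (z : T ⟶ 𝟙_ V) :
      ap x (z ≫ eId V (F.obj A)) = x := by
    rw [toUnit_unique z (toUnit T)]
    exact ap_eOne x
  have hcomp {F F' F'' : EnrichedFunctor V D V} (α : VNatTrans F F') (β : VNatTrans F' F'') {A : D}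
      {T : V} (x : T ⟶ F.obj A) (z : T ⟶ 𝟙_ V) :
      ap x (z ≫ (α.comp β).app A) = ap (ap x (z ≫ α.app A)) (z ≫ β.app A) :=
    (congrArg (ap x) (comp_eMul _ _ _)).trans (ap_eMul _ _ _)
  constructor
  · rintro ⟨β, h₁, h₂⟩ A Z
    refine Function.bijective_iff_has_inverse.2 ⟨fun y => ap y (toUnit Z ≫ β.app A), ?_, ?_⟩
    · intro x
      refine (hcomp α β x _).symm.trans ?_
      rw [h₁]
      exact hid x _
    · intro y
      refine (hcomp β α y _).symm.trans ?_
      rw [h₂]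
      exact hid y _
  · intro h
    have hα {A : D} {T : V} (x : T ⟶ F.obj A) (z : T ⟶ 𝟙_ V) :
        ap x (z ≫ α.app A) = x ≫ ap (𝟙 _) (toUnit _ ≫ α.app A) := by
      rw [comp_ap, Category.comp_id, ← Category.assoc, comp_toUnit, toUnit_unique z]
    have iso (A : D) : CategoryTheory.IsIso (ap (𝟙 (F.obj A)) (toUnit _ ≫ α.app A)) := by
      apply (isIso_iff_yoneda_map_bijective _).2
      intro Z
      refine Eq.mp (congrArg Function.Bijective (funext fun x => ?_)) (h A Z)
      exact hα x _
    let ψ (A : D) : F'.obj A ⟶ F.obj A := inv (ap (𝟙 (F.obj A)) (toUnit _ ≫ α.app A))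
    have hβ {A : D} {T : V} (y : T ⟶ F'.obj A) (z : T ⟶ 𝟙_ V) :
        ap y (z ≫ curry (fst (F'.obj A) (𝟙_ V) ≫ ψ A)) = y ≫ ψ A := by
      rw [ap_curry, lift_fst_assoc]
    have hαβ {A : D} {T : V} (x : T ⟶ F.obj A) (z : T ⟶ 𝟙_ V) : ap x (z ≫ α.app A) ≫ ψ A = x := by
      rw [hα, Category.assoc, IsIso.hom_inv_id, Category.comp_id]
    have hβα {A : D} {T : V} (y : T ⟶ F'.obj A) (z : T ⟶ 𝟙_ V) :
        ap (y ≫ ψ A) (z ≫ α.app A) = y := by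
      rw [hα, Category.assoc, IsIso.inv_hom_id, Category.comp_id]
    have nat {A B : D} {T : V} (x : T ⟶ F.obj A) (f : T ⟶ (A ⟶[V] B)) :
        ap (ap x (f ≫ F.map A B)) (toUnit T ≫ α.app B) =
          ap (ap x (toUnit T ≫ α.app A)) (f ≫ F'.map A B) := by
      have e := congrArg (ap x) (f ≫= α.naturality A B)
      rw [comp_eMul, comp_eMul, ← Category.assoc, ← Category.assoc, comp_toUnit] at e
      exact (ap_eMul _ _ _).symm.trans (e.trans (ap_eMul _ _ _))
    refine ⟨⟨fun A => curry (fst (F'.obj A) (𝟙_ V) ≫ ψ A), fun A B => ?_⟩, ?_, ?_⟩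
    · apply ap_ext
      intro T y f
      rw [comp_eMul, comp_eMul, ← Category.assoc, ← Category.assoc, comp_toUnit]
      refine (ap_eMul _ _ _).trans (Eq.trans ?_ (ap_eMul _ _ _).symm)
      refine (hβ _ _).trans (Eq.trans ?_ (congrArg (fun k => ap k _) (hβ y _)).symm)
      -- naturality of the inverse follows from that of `α` by cancelling the component of `α` at `B`
      refine Eq.trans ?_ (hαβ (ap (y ≫ ψ A) (f ≫ F.map A B)) (toUnit T))
      rw [nat, hβα]
    · refine VNatTrans.ext (funext fun A => ap_ext fun x z => ?_)
      exact (hcomp α _ x z).trans ((hβ _ z).trans ((hαβ x z).trans (hid x z).symm))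
    · refine VNatTrans.ext (funext fun A => ap_ext fun y z => ?_)
      refine (hcomp _ α y z).trans ((congrArg (fun k => ap k _) (hβ y z)).trans ?_)
      exact (hβα y z).trans (hid y z).symm

end Representable

section WeightedLimit

variable {V : Type u} [Category.{v} V] [CartesianMonoidalCategory V] [BraidedCategory V]
  [MonoidalClosed V] [HasPullbacks V] [IsExtensive.{w} V]

/-- The transformation corresponding to `x` under the Yoneda lemma takes `a` to `F a x`. -/
theorem ap_yonedaTrans {C : Type u₁} [EnrichedCategory V C] (F : EnrichedFunctor V Cᵒᵖ V) (X : C)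
    (x : 𝟙_ V ⟶ F.obj (op X)) (A : C) {Z : V} (a : Z ⟶ (A ⟶[V] X)) :
    ap a (toUnit Z ≫ (yonedaTrans F X x).app (op A)) =
      ap (toUnit Z ≫ x) (a ≫ F.map (op X) (op A)) := by
  refine (ap_curry _ _ _).trans ?_
  have e : lift a (toUnit Z) ≫ lift (fst (A ⟶[V] X) (𝟙_ V)) (toUnit _ ≫ x) =
      lift a (toUnit Z ≫ x) := by
    rw [comp_lift, lift_fst, ← Category.assoc, comp_toUnit]
  refine (Category.assoc _ _ _).symm.trans ((congrArg (· ≫ evMap F A X) e).trans ?_)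
  exact evMap_apply F A X a _

/-- The pair `(L, l)` is a weighted limit if and only if every generalized cone `W ⟹ C(A, G -)` is
the restriction of `l` along a unique generalized arrow `A ⟶ L`. -/
theorem isWeightedLimit_iff {I : Type w} [EnrichedCategory V I] {C : Type u₁}
    [EnrichedCategory V C] (W : EnrichedFunctor V I V) (G : EnrichedFunctor V I C) (L : C)
    (l : VNatTrans W (G.comp V (coyo L))) :
    IsWeightedLimit W G L l ↔ ∀ (A : C) {Z : V} (f : Z ⟶ natObj W (G.comp V (coyo A))),
        ∃! k : Z ⟶ (A ⟶[V] L), eMul (C := EnrichedFunctor V I V) (X := W)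
          (Y := G.comp V (coyo L)) (W := G.comp V (coyo A)) (toUnit Z ≫ l.toHom)
          (k ≫ coneMap G (op L) (op A)) = f := by
  have happ (A : C) {Z : V} (k : Z ⟶ (A ⟶[V] L)) :
      ap k (toUnit Z ≫ (yonedaTrans (weightedConeFunctor W G) L l.toHom).app (op A)) =
        eMul (C := EnrichedFunctor V I V) (X := W) (Y := G.comp V (coyo L))
          (W := G.comp V (coyo A)) (toUnit Z ≫ l.toHom) (k ≫ coneMap G (op L) (op A)) := by
    refine (ap_yonedaTrans _ _ _ _ _).trans (Eq.trans ?_ (ap_eComp _ _))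
    exact congrArg (ap _) (Category.assoc _ _ _).symm
  refine (VNatTrans.isIso_iff_bijective _).trans ?_
  have key (A : C) (Z : V) : (Function.Bijective fun k : Z ⟶ (A ⟶[V] L) =>
      ap k (toUnit Z ≫ (yonedaTrans (weightedConeFunctor W G) L l.toHom).app (op A))) ↔
      ∀ f : Z ⟶ natObj W (G.comp V (coyo A)),
        ∃! k : Z ⟶ (A ⟶[V] L), eMul (C := EnrichedFunctor V I V) (X := W)
          (Y := G.comp V (coyo L)) (W := G.comp V (coyo A)) (toUnit Z ≫ l.toHom)
          (k ≫ coneMap G (op L) (op A)) = f := by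
    rw [funext fun k => happ A (Z := Z) k]
    exact Function.bijective_iff_existsUnique _
  exact ⟨fun h A Z => (key A Z).1 (h (op A) Z), fun h A Z => (key A.unop Z).2 (h A.unop)⟩

end WeightedLimit

end EnrichedInternal

theorem mainTheorem4 {V : Type u} [Category.{v} V] [CartesianMonoidalCategory V]
    [BraidedCategory V] [MonoidalClosed V] [HasPullbacks V] [EnrichedInternal.IsExtensive.{w} V]
    {I : Type w} [EnrichedCategory V I] {C : Type w} [EnrichedCategory V C]
    (W : EnrichedFunctor V I V) (G : EnrichedFunctor V I C) (L : C)
    (l : EnrichedInternal.VNatTrans W (G.comp V (EnrichedInternal.coyo L)))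
    (𝒢 : Set V) (h𝒢 : EnrichedInternal.IsConservative 𝒢) :
    List.TFAE
      [EnrichedInternal.IsWeightedLimit W G L l,
       (EnrichedInternal.weightedCones W G).IsInternalTerminal
         (EnrichedInternal.coneElement L l),
       ∀ X ∈ 𝒢, EnrichedInternal.IsVTerminal V
         (EnrichedInternal.Und.mk
           ((EnrichedInternal.weightedCones W G).constElement X
             (EnrichedInternal.coneElement L l)))] := by
  tfae_have 1 ↔ 2 := (EnrichedInternal.isWeightedLimit_iff W G L l).trans
    ((EnrichedInternal.weightedCones_hasUniqueArrowsTo_iff l).symm.trans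
      EnrichedInternal.InternalCat.isInternalTerminal_iff.symm)
  tfae_have 2 ↔ 3 := EnrichedInternal.InternalCat.isInternalTerminal_iff.trans
    (EnrichedInternal.InternalCat.hasUniqueArrowsTo_iff_of_isConservative h𝒢 _ _)
  tfae_finish
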